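/- Let $F$ be a non-archimedean local field of characteristic $0$ with residue field of cardinality $q$, Weil group $W_F$, inertia group $I_F$ and norm $|\cdot|$ on $W_F$ ($|w|=q^n$ if $w$ acts on the residue field of $\overline F$ as $x\mapsto x^{q^n}$). Let $n\ge 1$, let $G$ be the split group $\mathrm{SO}_{2n+1}(F)$ or $\mathrm{Sp}_{2n}(F)$, and let $\mathbf G^\vee$ be its complex dual group, that is, $\mathrm{Sp}_{2n}(\mathbb C)$ or $\mathrm{SO}_{2n+1}(\mathbb C)$ respectively; put $N=2n$ or $N=2n+1$ respectively. A sign $z\in\{\pm1\}$ is called possible if $z=1$ or $G=\mathrm{SO}_{2n+1}(F)$. **Unipotent classes.** Let $\mathcal U^\vee$ be the set of unipotent conjugacy classes of $\mathbf G^\vee$, and for $\mathcal O\in\mathcal U^\vee$ let $\overline{\mathcal O}\subset\mathcal U^\vee$ be the set of classes contained in the topological closure of $\mathcal O$. A class in $\mathcal U^\vee$ is special if the partition $\lambda$ of $N$ given by the sizes of its Jordan blocks has the following property: for every part $c$ of $\lambda$ with $c\not\equiv N \pmod 2$, the number (with multiplicity) of parts $k>c$ of $\lambda$ with $k\equiv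 N\pmod 2$ is congruent to $N$ modulo $2$. (Equivalently, the transposed partition of $\lambda$ is again the partition of a class in $\mathcal U^\vee$.) The relative special piece of $\mathcal O\in\mathcal U^\vee$ is $$\mathrm{Spc}(\mathcal O)=\overline{\mathcal O}\ \setminus\bigcup_{\mathcal O'\ \text{special},\ \mathcal O\notin\overline{\mathcal O'}}\overline{\mathcal O'} .$$ **Parameters.** An $L$-parameter is a $\mathbf G^\vee$-conjugacy class of continuous homomorphisms $\phi:W_F\times \mathrm{SL}_2(\mathbb C)\to\mathbf G^\vee$ that are algebraic on $\mathrm{SL}_2(\mathbb C)$ and for which $\phi(W_F)$ consists of semisimple elements. An $A$-parameter is a $\mathbf G^\vee$-conjugacy class of continuous homomorphisms $\psi:W_F\times \mathrm{SL}_2(\mathbb C)\times \mathrm{SL}_2(\mathbb C)\to\mathbf G^\vee$ that are algebraic on $\mathrm{SL}_2(\mathbb C)\times \mathrm{SL}_2(\mathbb C)$ and for which $\psi(W_F)$ is bounded and consists of semisimple elements. Write $t(w)=\mathrm{diag}(|w|^{1/2},|w|^{-1/2})$ and $u=\begin{pmatrix}1&1\\0&1\end{pmatrix}$. To an $L$-parameter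 $\phi$ one attaches its infinitesimal character $\chi_\phi$, the conjugacy class of $w\mapsto\phi(w,t(w))$, and the class $\mathcal O^\vee_\phi\in\mathcal U^\vee$ of $\phi(1,u)$. To an $A$-parameter $\psi$ one attaches the $L$-parameter $\phi_\psi(w,x)=\psi(w,x,t(w))$; an $L$-parameter is of Arthur type if it equals $\phi_\psi$ for some $A$-parameter $\psi$. For $\mathcal O\in\mathcal U^\vee$ and a possible sign $z$, consider the $A$-parameters $\psi$ that are trivial on $I_F$ and on the first factor $\mathrm{SL}_2(\mathbb C)$, map Frobenius elements to $z\cdot 1$, and satisfy $\psi(1,1,u)\in\mathcal O$. All of them have the same infinitesimal character $\chi_{\phi_\psi}$, denoted $\chi_{z,\mathcal O}$, and there is at least one. **Proposition.** Let $\mathcal O_1^\vee\in\mathcal U^\vee$, let $\mathcal O_2^\vee\in\mathrm{Spc}(\mathcal O_1^\vee)$, and let $z$ be a possible sign. Then $\chi_{z,\mathcal O_1^\vee}$ is well defined, there is a unique $L$-parameter $\phi$ with $\chi_\phi=\chi_{z,\mathcal O_1^\vee}$ and $\mathcal O^\vee_\phi=\mathcal O_2^\vee$, and this $L$-parameter is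 of Arthur type. -/

import Mathlib

open scoped ValuativeRel MatrixGroups

noncomputable section

namespace WeakArthur

/-! ### The Weil group of a non-archimedean local field -/

section WeilGroup

variable (F : Type*) [Field F] [ValuativeRel F] [TopologicalSpace F]
  [IsNonarchimedeanLocalField F]

/-- The cardinality `q` of the residue field of `F`. -/
def residueCard : ℕ := Nat.card 𝓀[F]

theorem residueCard_pos : 0 < residueCard F := Nat.card_pos

/-- The ring of integers of the algebraic closure of `F`, a local ring. -/
abbrev IntegersBar : Type _ := integralClosure 𝒪[F] (AlgebraicClosure F)

/-- The residue field of the algebraic closure of `F`. (The maximal ideal of a local ring is its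
Jacobson radical.) -/
abbrev ResidueBar : Type _ := IntegersBar F ⧸ Ring.jacobson (IntegersBar F)

variable {F}

/-- The action of the Galois group on the integers of the algebraic closure. -/
def galInt (σ : AlgebraicClosure F ≃ₐ[F] AlgebraicClosure F) :
    IntegersBar F ≃ₐ[𝒪[F]] IntegersBar F :=
  (σ.restrictScalars 𝒪[F]).mapIntegralClosure

/-- The residue class of an integer of the algebraic closure. -/
def residueBar (x : IntegersBar F) : ResidueBar F := Ideal.Quotient.mk _ x

/-- `σ` acts on the residue field of the algebraic closure as the `n`-th power, `n ∈ ℤ`, of the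
Frobenius automorphism `x ↦ x ^ q`: writing `n = b - a` with natural numbers `a`, `b`, this says
that `σ(x) ^ (q ^ a) = x ^ (q ^ b)`. -/
def ActsAsFrobPow (σ : AlgebraicClosure F ≃ₐ[F] AlgebraicClosure F) (n : ℤ) : Prop :=
  ∃ a b : ℕ, (b : ℤ) - a = n ∧ ∀ x : IntegersBar F,
    residueBar (galInt σ x) ^ residueCard F ^ a = residueBar x ^ residueCard F ^ b

set_option linter.unusedSectionVars false in
theorem galInt_mul (σ τ : AlgebraicClosure F ≃ₐ[F] AlgebraicClosure F) (x : IntegersBar F) :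
    galInt (σ * τ) x = galInt σ (galInt τ x) := rfl

theorem ActsAsFrobPow.one : ActsAsFrobPow (F := F) 1 0 :=
  ⟨0, 0, by simp, fun _ => rfl⟩

theorem ActsAsFrobPow.mul {σ τ : AlgebraicClosure F ≃ₐ[F] AlgebraicClosure F} {n m : ℤ}
    (hσ : ActsAsFrobPow σ n) (hτ : ActsAsFrobPow τ m) : ActsAsFrobPow (σ * τ) (n + m) := by
  obtain ⟨a, b, hab, h⟩ := hσ
  obtain ⟨c, d, hcd, k⟩ := hτ
  refine ⟨a + c, b + d, by push_cast; omega, fun x => ?_⟩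
  rw [galInt_mul, pow_add, pow_mul, h, ← pow_mul, mul_comm, pow_mul, k, ← pow_mul, ← pow_add,
    add_comm d b]

theorem ActsAsFrobPow.inv {σ : AlgebraicClosure F ≃ₐ[F] AlgebraicClosure F} {n : ℤ}
    (hσ : ActsAsFrobPow σ n) : ActsAsFrobPow σ⁻¹ (-n) := by
  obtain ⟨a, b, hab, h⟩ := hσ
  refine ⟨b, a, by omega, fun x => ?_⟩
  rw [← h, ← galInt_mul, mul_inv_cancel]
  rfl

variable (F) in
/-- The Weil group `W_F`, as the fibre product of the absolute Galois group of `F` and of `ℤ` over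
the absolute Galois group of the residue field: pairs `(σ, n)` such that `σ` acts on the residue
field as the `n`-th power of Frobenius. -/
def weilSubgroup :
    Subgroup ((AlgebraicClosure F ≃ₐ[F] AlgebraicClosure F) × Multiplicative ℤ) where
  carrier := {w | ActsAsFrobPow w.1 w.2.toAdd}
  one_mem' := ActsAsFrobPow.one
  mul_mem' h k := ActsAsFrobPow.mul h k
  inv_mem' h := ActsAsFrobPow.inv h

variable (F) in
/-- The Weil group of `F`. Its topology is induced from the product of the Krull topology on the
Galois group and the discrete topology on `ℤ`, so that the inertia group (`n = 0`) is an open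
subgroup carrying its profinite topology. -/
abbrev WeilGroup : Type _ := weilSubgroup F

/-- The exponent `n` of the power of Frobenius as which `w` acts on the residue field. -/
def weilDeg (w : WeilGroup F) : ℤ := w.1.2.toAdd

variable (F) in
/-- The inertia subgroup `I_F`. -/
def inertia : Set (WeilGroup F) := {w | weilDeg w = 0}

variable (F) in
/-- The Frobenius elements of the Weil group. -/
def frobenius : Set (WeilGroup F) := {w | weilDeg w = 1}

/-- The norm `|w| = q ^ n` on the Weil group. -/
def weilNorm (w : WeilGroup F) : ℝ := (residueCard F : ℝ) ^ weilDeg w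

theorem weilNorm_pos (w : WeilGroup F) : 0 < weilNorm w :=
  zpow_pos (by exact_mod_cast residueCard_pos F) _

theorem weilNorm_one : weilNorm (1 : WeilGroup F) = 1 := by
  simp [weilNorm, weilDeg]

theorem weilNorm_mul (v w : WeilGroup F) : weilNorm (v * w) = weilNorm v * weilNorm w :=
  zpow_add₀ (by exact_mod_cast (residueCard_pos F).ne') _ _

/-- The matrix `diag(|w|^{1/2}, |w|^{-1/2})`. -/
def weilDiag (w : WeilGroup F) : SL(2, ℂ) :=
  ⟨!![((√(weilNorm w) : ℝ) : ℂ), 0; 0, ((√(weilNorm w) : ℝ) : ℂ)⁻¹], by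
    have h : ((√(weilNorm w) : ℝ) : ℂ) ≠ 0 := by
      exact_mod_cast (Real.sqrt_pos.mpr (weilNorm_pos w)).ne'
    simp [Matrix.det_fin_two_of, h]⟩

variable (F) in
/-- The homomorphism `w ↦ diag(|w|^{1/2}, |w|^{-1/2})` from the Weil group to `SL₂(ℂ)`. -/
def weilTorus : WeilGroup F →* SL(2, ℂ) where
  toFun := weilDiag
  map_one' := by
    apply Subtype.ext
    rw [Matrix.SpecialLinearGroup.coe_one]
    simp [weilDiag, weilNorm_one, Matrix.one_fin_two]
  map_mul' v w := by
    apply Subtype.ext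
    rw [Matrix.SpecialLinearGroup.coe_mul]
    simp [weilDiag, weilNorm_mul, Real.sqrt_mul (weilNorm_pos v).le, mul_comm]

variable (F) in
/-- `r_F(w) = (w, diag(|w|^{1/2}, |w|^{-1/2}))`. -/
def rF : WeilGroup F →* WeilGroup F × SL(2, ℂ) :=
  (MonoidHom.id _).prod (weilTorus F)

variable (F) in
/-- `r'_F(w, x) = (w, x, diag(|w|^{1/2}, |w|^{-1/2}))`. -/
def rF' : WeilGroup F × SL(2, ℂ) →* WeilGroup F × SL(2, ℂ) × SL(2, ℂ) :=
  (MonoidHom.fst _ _).prod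
    ((MonoidHom.snd _ _).prod ((weilTorus F).comp (MonoidHom.fst _ _)))

end WeilGroup

/-! ### Conjugacy classes of homomorphisms -/

section Classes

/-- Two homomorphisms into `H` are equivalent if they are conjugate by an element of `H`. -/
def conjSetoid (A H : Type*) [Monoid A] [Monoid H] : Setoid (A →* H) where
  r φ φ' := ∃ g : Hˣ, ∀ a, SemiconjBy (g : H) (φ a) (φ' a)
  iseqv :=
    { refl := fun φ => ⟨1, fun a => by simp⟩
      symm := fun ⟨g, hg⟩ => ⟨g⁻¹, fun a => (hg a).units_inv_symm_left⟩
      trans := fun ⟨g, hg⟩ ⟨k, hk⟩ => ⟨k * g, fun a => by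
        simpa using (hk a).mul_left (hg a)⟩ }

/-- The set of `H`-conjugacy classes of homomorphisms `A → H`. -/
def HomClass (A H : Type*) [Monoid A] [Monoid H] : Type _ := Quotient (conjSetoid A H)

variable {A B H : Type*} [Monoid A] [Monoid B] [Monoid H]

/-- The conjugacy class of a homomorphism. -/
def HomClass.mk (φ : A →* H) : HomClass A H := Quotient.mk (conjSetoid A H) φ

/-- Precomposition of a class of homomorphisms with a fixed homomorphism. -/
def HomClass.precomp (f : B →* A) : HomClass A H → HomClass B H :=
  Quotient.map' (s₁ := conjSetoid A H) (s₂ := conjSetoid B H) (fun φ => φ.comp f)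
    (fun _ _ ⟨g, hg⟩ => ⟨g, fun b => hg (f b)⟩)

/-- The conjugacy class of the value at a fixed element of a class of homomorphisms. -/
def HomClass.eval (a : A) : HomClass A H → ConjClasses H :=
  Quotient.lift (s := conjSetoid A H) (fun φ => ConjClasses.mk (φ a))
    (fun _ _ ⟨g, hg⟩ => ConjClasses.mk_eq_mk_iff_isConj.mpr ⟨g, hg a⟩)

end Classes

/-! ### Unipotent classes, special classes, relative special pieces

Here `H` is a group of complex matrices. -/

section Unipotent

variable {ι : Type*} [Fintype ι] [DecidableEq ι]

/-- For a unipotent matrix `u` and `c ≥ 1`, the number of Jordan blocks of size `c` of `u`. (The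
number of blocks of size at least `c` is `rank (u - 1) ^ (c - 1) - rank (u - 1) ^ c`.) -/
def jordanMult (u : Matrix ι ι ℂ) (c : ℕ) : ℕ :=
  ((u - 1) ^ (c - 1)).rank + ((u - 1) ^ (c + 1)).rank - 2 * ((u - 1) ^ c).rank

/-- The partition of a unipotent matrix `u` in `Sp_N` (`N` even) or `SO_N` (`N` odd) is special:
for every part `c` whose parity differs from that of `N`, the number (with multiplicity) of parts
`k > c` of the same parity as `N` is even when `N` is even, and odd when `N` is odd. -/
def IsSpecialMatrix (u : Matrix ι ι ℂ) : Prop :=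
  ∀ c : ℕ, 1 ≤ c → 0 < jordanMult u c → ¬ c ≡ Fintype.card ι [MOD 2] →
    (∑ k ∈ Finset.Ioc c (Fintype.card ι) with k ≡ Fintype.card ι [MOD 2], jordanMult u k)
      ≡ Fintype.card ι [MOD 2]

variable (H : Submonoid (Matrix ι ι ℂ))

/-- The unipotent conjugacy classes of `H`. -/
def unipotentClasses : Set (ConjClasses H) :=
  {O | ∃ u : H, IsNilpotent ((u : Matrix ι ι ℂ) - 1) ∧ ConjClasses.mk u = O}

/-- The special unipotent conjugacy classes of `H`. -/
def specialClasses : Set (ConjClasses H) :=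
  {O | ∃ u : H, IsNilpotent ((u : Matrix ι ι ℂ) - 1) ∧ IsSpecialMatrix (u : Matrix ι ι ℂ) ∧
    ConjClasses.mk u = O}

variable {H}

/-- The unipotent classes contained in the topological closure of `O`. -/
def closureClasses (O : ConjClasses H) : Set (ConjClasses H) :=
  {O' | O' ∈ unipotentClasses H ∧ O'.carrier ⊆ closure O.carrier}

/-- The relative special piece of `O`: the unipotent classes in the closure of `O` that do not lie
in the closure of any special class whose closure does not contain `O`. -/
def Spc (O : ConjClasses H) : Set (ConjClasses H) :=
  closureClasses O \ ⋃ O' ∈ {O' | O' ∈ specialClasses H ∧ O ∉ closureClasses O'}, closureClasses O'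

end Unipotent

/-! ### L-parameters and A-parameters -/

section Parameters

variable (F : Type*) [Field F] [ValuativeRel F] [TopologicalSpace F]
  [IsNonarchimedeanLocalField F]
variable {ι : Type*} [Fintype ι] [DecidableEq ι] (H : Submonoid (Matrix ι ι ℂ))

variable {F H} in
/-- A homomorphism `W_F × SL₂(ℂ) → H` that represents an L-parameter. -/
structure IsLParameter (φ : WeilGroup F × SL(2, ℂ) →* H) : Prop where
  continuous : Continuous φ
  /-- the restriction to `SL₂(ℂ)` is given by polynomials in the matrix entries -/
  algebraic : ∀ i j, ∃ p : MvPolynomial (Fin 2 × Fin 2) ℂ, ∀ g : SL(2, ℂ),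
    (φ (1, g) : Matrix ι ι ℂ) i j = p.eval (fun a => g.1 a.1 a.2)
  semisimple : ∀ w, Module.End.IsSemisimple (Matrix.toLin' (φ (w, 1) : Matrix ι ι ℂ))

variable {F H} in
/-- A homomorphism `W_F × SL₂(ℂ) × SL₂(ℂ) → H` that represents an A-parameter. -/
structure IsAParameter (ψ : WeilGroup F × SL(2, ℂ) × SL(2, ℂ) →* H) : Prop where
  continuous : Continuous ψ
  /-- the restriction to `SL₂(ℂ) × SL₂(ℂ)` is given by polynomials in the matrix entries -/
  algebraic : ∀ i j, ∃ p : MvPolynomial ((Fin 2 × Fin 2) ⊕ (Fin 2 × Fin 2)) ℂ,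
    ∀ g h : SL(2, ℂ), (ψ (1, g, h) : Matrix ι ι ℂ) i j =
      p.eval (Sum.elim (fun a => g.1 a.1 a.2) (fun a => h.1 a.1 a.2))
  semisimple : ∀ w, Module.End.IsSemisimple (Matrix.toLin' (ψ (w, 1, 1) : Matrix ι ι ℂ))
  bounded : ∃ C : ℝ, ∀ w i j, ‖(ψ (w, 1, 1) : Matrix ι ι ℂ) i j‖ ≤ C

/-- The set of L-parameters valued in `H`, up to conjugation. -/
def LParameters : Set (HomClass (WeilGroup F × SL(2, ℂ)) H) :=
  HomClass.mk '' {φ | IsLParameter φ}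

/-- The set of A-parameters valued in `H`, up to conjugation. -/
def AParameters : Set (HomClass (WeilGroup F × SL(2, ℂ) × SL(2, ℂ)) H) :=
  HomClass.mk '' {ψ | IsAParameter ψ}

variable {F H}

/-- The infinitesimal character `χ_φ = φ ∘ r_F`. -/
def infChar : HomClass (WeilGroup F × SL(2, ℂ)) H → HomClass (WeilGroup F) H :=
  HomClass.precomp (rF F)

/-- The class `φ_ψ = ψ ∘ r'_F` attached to an A-parameter. -/
def lOfA : HomClass (WeilGroup F × SL(2, ℂ) × SL(2, ℂ)) H →
    HomClass (WeilGroup F × SL(2, ℂ)) H :=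
  HomClass.precomp (rF' F)

/-- The L-parameter `φ` is of Arthur type, i.e. equal to `φ_ψ` for an A-parameter `ψ`. -/
def IsArthurType (φ : HomClass (WeilGroup F × SL(2, ℂ)) H) : Prop :=
  ∃ ψ ∈ AParameters F H, lOfA ψ = φ

/-- The standard unipotent element of `SL₂(ℂ)`. -/
def stdUnipotent : SL(2, ℂ) := ⟨!![1, 1; 0, 1], by simp [Matrix.det_fin_two_of]⟩

/-- The unipotent class `O_φ` of `φ(1, (1 1; 0 1))`. -/
def unipotentClass : HomClass (WeilGroup F × SL(2, ℂ)) H → ConjClasses H :=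
  HomClass.eval (1, stdUnipotent)

/-- The homomorphism `ψ` represents the quasi-basic A-parameter `ψ_{z,O}`: it is trivial on the
inertia group and on the first `SL₂(ℂ)`, Frobenius maps to the scalar `z`, and the second `SL₂(ℂ)`
maps the standard unipotent element into `O`. -/
structure IsQuasiBasic (z : ℤˣ) (O : ConjClasses H)
    (ψ : WeilGroup F × SL(2, ℂ) × SL(2, ℂ) →* H) : Prop where
  isAParameter : IsAParameter ψ
  trivial : ∀ w ∈ inertia F, ∀ g, ψ (w, g, 1) = 1
  frobenius : ∀ w ∈ frobenius F, (ψ (w, 1, 1) : Matrix ι ι ℂ) = ((z : ℤ) : ℂ) • 1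
  unipotent : ConjClasses.mk (ψ (1, 1, stdUnipotent)) = O

variable (F) in
/-- The infinitesimal characters `χ_ψ` of the quasi-basic A-parameters `ψ_{z,O}`. For a unipotent
class `O` and a scalar `z` in `H` there is exactly one, `χ_{z,O}`, if `H` is a symplectic or odd
special orthogonal group. -/
def quasiBasicInfChars (z : ℤˣ) (O : ConjClasses H) : Set (HomClass (WeilGroup F) H) :=
  {χ | ∃ ψ : WeilGroup F × SL(2, ℂ) × SL(2, ℂ) →* H,
    IsQuasiBasic z O ψ ∧ infChar (lOfA (HomClass.mk ψ)) = χ}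

end Parameters

/-! ### The groups -/

/-- The split groups `SO_{2n+1}` and `Sp_{2n}`. -/
inductive SplitGroup : Type
  | oddOrthogonal (n : ℕ) : SplitGroup
  | symplectic (n : ℕ) : SplitGroup

namespace SplitGroup

/-- The rank `n`. -/
def rank : SplitGroup → ℕ
  | oddOrthogonal n => n
  | symplectic n => n

/-- The index set of the rows of the matrices in the dual group. -/
def Index : SplitGroup → Type
  | oddOrthogonal n => Fin n ⊕ Fin n
  | symplectic n => Fin (2 * n + 1)

instance (G : SplitGroup) : Fintype G.Index :=
  match G with
  | oddOrthogonal n => inferInstanceAs (Fintype (Fin n ⊕ Fin n))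
  | symplectic n => inferInstanceAs (Fintype (Fin (2 * n + 1)))

instance (G : SplitGroup) : DecidableEq G.Index :=
  match G with
  | oddOrthogonal n => inferInstanceAs (DecidableEq (Fin n ⊕ Fin n))
  | symplectic n => inferInstanceAs (DecidableEq (Fin (2 * n + 1)))

/-- The complex dual group: `Sp_{2n}(ℂ)` for `SO_{2n+1}`, and `SO_{2n+1}(ℂ)` for `Sp_{2n}`. -/
def dual : (G : SplitGroup) → Submonoid (Matrix G.Index G.Index ℂ)
  | oddOrthogonal n => Matrix.symplecticGroup (Fin n) ℂ
  | symplectic n => Matrix.specialOrthogonalGroup (Fin (2 * n + 1)) ℂ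

/-- The possible signs `z`: both signs for `SO_{2n+1}`, only `z = 1` for `Sp_{2n}`. -/
def IsPossibleSign : SplitGroup → ℤˣ → Prop
  | oddOrthogonal _, _ => True
  | symplectic _, z => z = 1

end SplitGroup

end WeakArthur

end

/-! Let N be the size of the matrices and let r_m(u) be the rank of (u - 1)^m; the numbers r_m(u)
encode the Jordan type. Let u₁ and u₂ represent the two classes.

Special pieces. If the class of u₂ lies in the relative special piece of that of u₁, there is a set
S of block sizes c of u₂, all of parity opposite to N, such that u₁ arises from u₂ by trading one
pair (c, c) for (c + 1, c - 1) for every c in S; equivalently r_c grows by one for c in S and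
nothing else changes (`IsClassicalGroup.exists_rank_pow_of_mem_Spc`). Indeed, trading at all sizes
that violate the special condition gives a special class whose closure contains u₂. By definition of
the special piece this closure contains u₁ too, so the ranks of u₁ are squeezed between those of u₂
and of the special class.

Existence. Sizes c of parity opposite to N have even multiplicity in u₂, so their blocks group into
copies of Sym^(c-1) ⊗ ℂ². Let a second SL₂ act on the factor ℂ² of one copy for each c in S and
trivially elsewhere. The resulting homomorphism Ψ from SL₂ × SL₂ (`IsClassicalGroup.exists_hom`) has
type u₂ on the first factor and, by Sym^(c-1) ⊗ ℂ² = Sym^c ⊕ Sym^(c-2), type u₁ on the diagonal.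
Twisted by the unramified character of sign z it is an A-parameter ψ, and φ_ψ is the required
L-parameter.

Uniqueness. An L-parameter with this infinitesimal character is trivial on inertia, so it is a sum
of strings: symmetric powers on which Frobenius acts by a scalar. The unipotent class prescribes the
lengths of the strings, the infinitesimal character their weights. The reference family has all
strings centred at z, except for one pair of each length c in S, centred at z q^(1/2) and z
q^(-1/2). Comparing extremal weights from the longest strings downwards shows that no other family
has the same lengths and weights (`eq_of_totalMult_eq`). Equal families are conjugate in GL_N, and a
polynomial square root improves this to conjugacy in the classical group (`exists_isometry_conj`).
Complete reducibility and the same descent make the infinitesimal character well defined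
(`IsClassicalGroup.quasiBasicInfChars_eq`). -/

noncomputable section

namespace WeakArthur

/-! ### The integers of the algebraic closure and the existence of Frobenius elements. -/

section Frobenius
variable (F : Type*) [Field F] [ValuativeRel F] [TopologicalSpace F]
  [IsNonarchimedeanLocalField F]

/-- The spectral norm works: it is multiplicative because `F` is complete. Its unit ball consists of
the integral elements because `𝒪[F]` is integrally closed, so that integrality can be read off from
the coefficients of the minimal polynomial over `F`. -/
theorem exists_norm_algebraicClosure :
    ∃ N : AlgebraicClosure F → ℝ, (∀ x y, N (x * y) = N x * N y) ∧ N 0 = 0 ∧ (∀ x, 0 ≤ N x) ∧ N 1 = 1 ∧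
      (∀ x y, N (x + y) ≤ max (N x) (N y)) ∧ ∀ x, IsIntegral 𝒪[F] x ↔ N x ≤ 1 := by
  let := IsTopologicalAddGroup.rightUniformSpace F
  have := isUniformAddGroup_of_addCommGroup (G := F)
  let : (Valued.v (R := F) (Γ₀ := ValuativeRel.ValueGroupWithZero F)).RankOne :=
  { hom' := ValuativeRel.IsRankLeOne.nonempty.some.emb (R := F).comp
      MonoidWithZeroHom.ValueGroup₀.embedding
    strictMono' := ValuativeRel.IsRankLeOne.nonempty.some.strictMono.comp
        MonoidWithZeroHom.ValueGroup₀.embedding_strictMono }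
  let : NontriviallyNormedField F := Valued.toNontriviallyNormedField F (ValuativeRel.ValueGroupWithZero F)
  have : IsUltrametricDist F := Valued.instIsUltrametricDist F (ValuativeRel.ValueGroupWithZero F)
  have : CompleteSpace F := inferInstance
  refine ⟨spectralNorm F (AlgebraicClosure F), fun x y => ?_, spectralNorm_zero, spectralNorm_nonneg, spectralNorm_one,
    isNonarchimedean_spectralNorm, fun x => ?_⟩
  · exact spectralAlgNorm_mul x y
  · have hx : IsIntegral F x := Algebra.IsIntegral.isIntegral x
    rw [spectralNorm, spectralValue_le_one_iff (minpoly.monic hx)]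
    have key : ∀ y : F, ‖y‖ ≤ 1 ↔ y ∈ 𝒪[F] := fun y => Valued.toNormedField.norm_le_one_iff
    simp only [key]
    constructor
    · intro h n
      rw [minpoly.isIntegrallyClosed_eq_field_fractions' F h,
        Polynomial.coeff_map]
      exact ((minpoly 𝒪[F] x).coeff n).2
    · intro h
      have hl : minpoly F x ∈ Polynomial.lifts (algebraMap 𝒪[F] F) :=
        (Polynomial.lifts_iff_coeff_lifts _).2 fun n => ⟨⟨_, h n⟩, rfl⟩
      obtain ⟨q, hq, -, hqm⟩ := Polynomial.lifts_and_natDegree_eq_and_monic hl (minpoly.monic hx)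
      refine ⟨q, hqm, ?_⟩
      rw [IsScalarTower.algebraMap_eq 𝒪[F] F, ← Polynomial.eval₂_map, hq]
      exact minpoly.aeval F x

/-- The nonunits are the elements of norm less than one, which are closed under addition by the
ultrametric inequality. Locality turns the Jacobson radical in `ResidueBar` into the maximal ideal.
-/
instance isLocalRing_integersBar : IsLocalRing (IntegersBar F) := by
  obtain ⟨N, hmul, hzero, hnn, hone, hadd, hint⟩ := exists_norm_algebraicClosure F
  have hu : ∀ x : IntegersBar F, IsUnit x ↔ ¬ N x.1 < 1 := by
    intro x
    have hx : N x.1 ≤ 1 := (hint _).1 x.2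
    constructor
    · rintro ⟨u, rfl⟩ h
      have h1 : N ((u : IntegersBar F) * (↑u⁻¹ : IntegersBar F) : IntegersBar F).1 = 1 := by
        rw [Units.mul_inv]; exact hone
      have h2 : N ((↑u⁻¹ : IntegersBar F)).1 ≤ 1 := (hint _).1 (↑u⁻¹ : IntegersBar F).2
      change N (_ * _) = 1 at h1
      rw [hmul] at h1
      nlinarith [hnn (u : IntegersBar F).1]
    · intro h
      have h1 : N x.1 = 1 := le_antisymm hx (not_lt.1 h)
      have hx0 : x.1 ≠ 0 := fun h0 => by rw [h0, hzero] at h1; exact zero_ne_one h1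
      have h2 : N x.1⁻¹ = 1 := by
        have := hmul x.1 x.1⁻¹
        rw [mul_inv_cancel₀ hx0, hone, h1] at this
        linarith
      refine IsUnit.of_mul_eq_one ⟨x.1⁻¹, (hint _).2 h2.le⟩ (Subtype.ext (mul_inv_cancel₀ hx0))
  refine IsLocalRing.of_nonunits_add fun a b ha hb => ?_
  simp only [mem_nonunits_iff, hu, not_not] at ha hb ⊢
  exact (hadd _ _).trans_lt (max_lt ha hb)

/-- The profinite Galois group has `𝒪[F]` as its ring of invariants, so the stabilizer of the
maximal ideal surjects onto the automorphisms of the residue extension, and the Frobenius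
automorphism lifts. Characteristic zero makes the algebraic closure Galois over `F`. -/
theorem frobenius_nonempty [CharZero F] : (frobenius F).Nonempty := by
  let G := AlgebraicClosure F ≃ₐ[F] AlgebraicClosure F
  let B := IntegersBar F
  let : MulSemiringAction G B :=
    { smul := fun σ x => galInt σ x
      one_smul := fun x => rfl
      mul_smul := fun σ τ x => rfl
      smul_zero := fun σ => map_zero (galInt σ)
      smul_add := fun σ => map_add (galInt σ)
      smul_one := fun σ => map_one (galInt σ)
      smul_mul := fun σ => map_mul (galInt σ) }
  have hsm : ∀ (σ : G) (x : B), σ • x = galInt σ x := fun _ _ => rfl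
  have : SMulCommClass G 𝒪[F] B := ⟨fun σ a x => map_smul (galInt σ) a x⟩
  -- The surjectivity is applied to a continuous action on a discrete ring; stabilizers are open
  -- since every element is algebraic.
  let : TopologicalSpace B := ⊥
  have : DiscreteTopology B := ⟨rfl⟩
  have : ContinuousSMul G B := by
    refine (continuousSMul_iff_stabilizer_isOpen).2 fun x => ?_
    convert stabilizer_isOpen_of_isIntegral (K := F) (x : AlgebraicClosure F) using 1
    ext σ
    exact Subtype.ext_iff
  have : Algebra.IsInvariant 𝒪[F] B G := by
    refine ⟨fun x hx => ?_⟩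
    have h1 : (x : AlgebraicClosure F) ∈ (⊥ : IntermediateField F (AlgebraicClosure F)) :=
      (InfiniteGalois.mem_bot_iff_fixed _).2 fun σ => congrArg Subtype.val (hx σ)
    obtain ⟨y, hy⟩ := h1
    have hy' : IsIntegral 𝒪[F] y := by
      have := x.2
      rw [← hy] at this
      exact (isIntegral_algebraMap_iff (algebraMap F (AlgebraicClosure F)).injective).1 this
    obtain ⟨a, ha⟩ := IsIntegrallyClosed.isIntegral_iff.1 hy'
    refine ⟨a, Subtype.ext ?_⟩
    rw [← hy, ← ha]
    rfl
  let Q := IsLocalRing.maximalIdeal B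
  have : Algebra.IsIntegral 𝒪[F] B := inferInstance
  have hQ : Q.LiesOver 𝓂[F] := by
    refine ⟨?_⟩
    have : (Q.under 𝒪[F]).IsMaximal := Ideal.IsMaximal.under _ _
    exact (IsLocalRing.eq_maximalIdeal this).symm
  let : Field (𝒪[F] ⧸ 𝓂[F]) := Ideal.Quotient.field _
  let : Field (B ⧸ Q) := Ideal.Quotient.field _
  have : Finite (𝒪[F] ⧸ 𝓂[F]) := inferInstanceAs (Finite 𝓀[F])
  let := Fintype.ofFinite (𝒪[F] ⧸ 𝓂[F])
  have hcard : Fintype.card (𝒪[F] ⧸ 𝓂[F]) = residueCard F := Fintype.card_eq_nat_card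
  have : Algebra.IsAlgebraic (𝒪[F] ⧸ 𝓂[F]) (B ⧸ Q) := by
    refine ⟨fun y => ?_⟩
    obtain ⟨x, rfl⟩ := Ideal.Quotient.mk_surjective y
    have hx : IsIntegral 𝒪[F] x := Algebra.IsIntegral.isIntegral x
    have h1 : IsIntegral 𝒪[F] (Ideal.Quotient.mk Q x) := hx.map (Ideal.Quotient.mkₐ 𝒪[F] Q)
    exact IsIntegral.isAlgebraic h1.tower_top
  obtain ⟨σ, hσ⟩ := Ideal.Quotient.stabilizerHom_surjective_of_profinite (G := G) 𝓂[F] Q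
    (FiniteField.frobeniusAlgEquivOfAlgebraic (𝒪[F] ⧸ 𝓂[F]) (B ⧸ Q))
  refine ⟨⟨(σ.1, Multiplicative.ofAdd 1), 0, 1, rfl, fun x => ?_⟩, rfl⟩
  have h1 := DFunLike.congr_fun hσ (Ideal.Quotient.mk Q x)
  rw [FiniteField.coe_frobeniusAlgEquivOfAlgebraic, hcard] at h1
  have h2 : galInt σ.1 x - x ^ residueCard F ∈ Q :=
    Ideal.Quotient.eq.1 (h1.trans (map_pow (Ideal.Quotient.mk Q) x _).symm)
  rw [pow_zero, pow_one, pow_one, residueBar, residueBar, ← map_pow, Ideal.Quotient.eq]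
  rw [IsLocalRing.ringJacobson_eq_maximalIdeal]
  exact h2

theorem one_lt_residueCard : 1 < residueCard F := Finite.one_lt_card

variable {F}

theorem weilDeg_mul (v w : WeilGroup F) : weilDeg (v * w) = weilDeg v + weilDeg w := rfl

theorem weilDeg_one : weilDeg (1 : WeilGroup F) = 0 := rfl

variable (F) in
/-- The degree of a Weil group element, as a homomorphism. -/
def weilDegHom : WeilGroup F →* Multiplicative ℤ :=
  (MonoidHom.snd _ _).comp (weilSubgroup F).subtype

theorem weilDegHom_apply (w : WeilGroup F) : weilDegHom F w = Multiplicative.ofAdd (weilDeg w) :=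
  rfl

theorem continuous_weilDegHom : Continuous (weilDegHom F) :=
  continuous_snd.comp continuous_subtype_val

theorem weilDeg_zpow (v : WeilGroup F) (n : ℤ) : weilDeg (v ^ n) = n * weilDeg v := by
  have : weilDegHom F (v ^ n) = (weilDegHom F v) ^ n := map_zpow _ _ _
  rw [weilDegHom_apply, weilDegHom_apply, ← ofAdd_zsmul] at this
  simpa using Multiplicative.ofAdd.injective this

theorem exists_eq_zpow_mul {v : WeilGroup F} (hv : v ∈ frobenius F) (w : WeilGroup F) :
    ∃ i ∈ inertia F, w = v ^ weilDeg w * i := by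
  refine ⟨(v ^ weilDeg w)⁻¹ * w, ?_, by simp⟩
  have hv' : weilDeg v = 1 := hv
  change weilDeg _ = 0
  rw [weilDeg_mul, ← zpow_neg, weilDeg_zpow, hv']
  ring

end Frobenius

/-! ### Symmetric powers of the standard representation of `SL₂` -/

section SymPower

open Polynomial
open scoped Matrix

section Ring

variable {R : Type*} [CommRing R]

/-- The polynomial `(a + c X) ^ (k - j) * (b + d X) ^ j` attached to a matrix `(a b; c d)`. -/
def symPoly (k j : ℕ) (g : Matrix (Fin 2) (Fin 2) R) : R[X] :=
  (C (g 0 0) + C (g 1 0) * X) ^ (k - j) * (C (g 0 1) + C (g 1 1) * X) ^ j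

/-- The `k`-th symmetric power of a `2 × 2` matrix. -/
def symMat (k : ℕ) (g : Matrix (Fin 2) (Fin 2) R) : Matrix (Fin (k + 1)) (Fin (k + 1)) R :=
  Matrix.of fun i j => (symPoly k j g).coeff i

theorem symMat_apply (k : ℕ) (g : Matrix (Fin 2) (Fin 2) R) (i j : Fin (k + 1)) :
    symMat k g i j = (symPoly k j g).coeff i := rfl

theorem symMat_map {S : Type*} [CommRing S] (f : R →+* S) (k : ℕ) (g : Matrix (Fin 2) (Fin 2) R) :
    symMat k (g.map f) = (symMat k g).map f := by
  ext i j
  rw [Matrix.map_apply, symMat_apply, symMat_apply, ← coeff_map]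
  simp [symPoly, Polynomial.map_mul, Polynomial.map_pow, Polynomial.map_add]

theorem natDegree_symPoly_le {k j : ℕ} (hj : j ≤ k) (g : Matrix (Fin 2) (Fin 2) R) :
    (symPoly k j g).natDegree ≤ k := by
  have h : ∀ a b : R, (C a + C b * X).natDegree ≤ 1 := fun a b => by compute_degree
  refine natDegree_mul_le.trans ?_
  have h1 := natDegree_pow_le_of_le (k - j) (h (g 0 0) (g 1 0))
  have h2 := natDegree_pow_le_of_le j (h (g 0 1) (g 1 1))
  omega

end Ring

variable {k : ℕ}

/-- The value at `(U, W)` of the homogeneous polynomial with given coefficients. -/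
def homEval (x : Fin (k + 1) → ℂ) (U W : ℂ) : ℂ := ∑ i, x i * (U ^ (k - (i : ℕ)) * W ^ (i : ℕ))

theorem eq_of_homEval_one_eq {x y : Fin (k + 1) → ℂ} (h : ∀ W, homEval x 1 W = homEval y 1 W) :
    x = y := by
  let P : (Fin (k + 1) → ℂ) → ℂ[X] := fun x => ∑ i, C (x i) * X ^ (i : ℕ)
  have hP : ∀ x W, (P x).eval W = homEval x 1 W := fun x W => by
    simp [P, homEval, eval_finsetSum]
  have hc : ∀ x (j : Fin (k + 1)), (P x).coeff j = x j := fun x j => by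
    simp [P, finsetSum_coeff, coeff_C_mul, coeff_X_pow, Fin.val_inj]
  have h1 : P x = P y := Polynomial.funext fun W => by rw [hP, hP, h]
  ext j
  rw [← hc x, ← hc y, h1]

theorem homEval_injective {x y : Fin (k + 1) → ℂ} (h : ∀ U W, homEval x U W = homEval y U W) :
    x = y :=
  eq_of_homEval_one_eq (h 1)

theorem homEval_coeff_of_ne_zero {p : ℂ[X]} (hp : p.natDegree ≤ k) {U : ℂ} (hU : U ≠ 0) (W : ℂ) :
    homEval (fun i : Fin (k + 1) => p.coeff i) U W = U ^ k * p.eval (W / U) := by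
  rw [eval_eq_sum_range' (Nat.lt_succ_of_le hp), Finset.mul_sum, homEval,
    Finset.sum_range (n := k + 1)]
  refine Finset.sum_congr rfl fun i _ => ?_
  have hi : U ^ k = U ^ (k - (i : ℕ)) * U ^ (i : ℕ) := by rw [← pow_add]; congr 1; omega
  rw [hi, div_pow]
  field_simp

/-- For `U ≠ 0` this is the homogenization of `symPoly`; both sides are continuous in `U`, so `U =
0` follows by density. -/
theorem homEval_symMat_col (g : Matrix (Fin 2) (Fin 2) ℂ) (j : Fin (k + 1)) (U W : ℂ) :
    homEval (fun i => symMat k g i j) U W =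
      (g 0 0 * U + g 1 0 * W) ^ (k - (j : ℕ)) * (g 0 1 * U + g 1 1 * W) ^ (j : ℕ) := by
  have key : Set.EqOn (fun U => homEval (fun i => symMat k g i j) U W) (fun U =>
      (g 0 0 * U + g 1 0 * W) ^ (k - (j : ℕ)) * (g 0 1 * U + g 1 1 * W) ^ (j : ℕ)) {0}ᶜ := by
    intro U hU
    have hU : U ≠ 0 := hU
    have hj : (j : ℕ) ≤ k := by omega
    change homEval (fun i : Fin (k + 1) => (symPoly k j g).coeff i) U W = _
    rw [homEval_coeff_of_ne_zero (natDegree_symPoly_le hj g) hU]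
    have hk : U ^ k = U ^ (k - (j : ℕ)) * U ^ (j : ℕ) := by rw [← pow_add]; congr 1; omega
    rw [hk]
    simp only [symPoly, eval_mul, eval_pow, eval_add, eval_C, eval_X]
    rw [mul_mul_mul_comm, ← mul_pow, ← mul_pow]
    congr 2 <;> field_simp
  have := Continuous.ext_on (dense_compl_singleton (0 : ℂ))
    (by unfold homEval; fun_prop) (by fun_prop) key
  exact congrFun this U

/-- The symmetric power acts by substituting linear forms into homogeneous polynomials.
Multiplicativity and the invariance of the form are deduced from this description instead of from
the coefficients. -/
theorem homEval_symMat_mulVec (g : Matrix (Fin 2) (Fin 2) ℂ) (x : Fin (k + 1) → ℂ) (U W : ℂ) :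
    homEval (symMat k g *ᵥ x) U W =
      homEval x (g 0 0 * U + g 1 0 * W) (g 0 1 * U + g 1 1 * W) := by
  rw [homEval, homEval]
  simp only [← homEval_symMat_col, Matrix.mulVec, dotProduct, homEval, Finset.sum_mul,
    Finset.mul_sum]
  rw [Finset.sum_comm]
  refine Finset.sum_congr rfl fun i _ => Finset.sum_congr rfl fun j _ => by ring

variable (k) in
theorem symMat_mul (g h : Matrix (Fin 2) (Fin 2) ℂ) : symMat k (g * h) = symMat k g * symMat k h := by
  refine Matrix.toLin'.injective (LinearMap.ext fun x => homEval_injective fun U W => ?_)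
  rw [Matrix.toLin'_apply, Matrix.toLin'_apply, ← Matrix.mulVec_mulVec, homEval_symMat_mulVec,
    homEval_symMat_mulVec, homEval_symMat_mulVec]
  simp only [Matrix.mul_apply, Fin.sum_univ_two]
  congr 1 <;> ring

variable (k) in
theorem symMat_diagonal (a d : ℂ) : symMat k !![a, 0; 0, d] =
    Matrix.diagonal fun j : Fin (k + 1) => a ^ (k - (j : ℕ)) * d ^ (j : ℕ) := by
  ext i j
  simp only [symMat_apply, symPoly, Matrix.of_apply, Matrix.cons_val_zero, Matrix.cons_val_one,
    Matrix.cons_val', Matrix.cons_val_fin_one, map_zero, zero_mul, add_zero, zero_add, mul_pow,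
    ← map_pow, ← mul_assoc, ← map_mul]
  rw [coeff_C_mul, coeff_X_pow, Matrix.diagonal_apply]
  simp only [Fin.val_inj]
  split_ifs with h
  · rw [h, mul_one]
  · rw [mul_zero]

variable (k) in
theorem symMat_one : symMat k (1 : Matrix (Fin 2) (Fin 2) ℂ) = 1 := by
  rw [Matrix.one_fin_two, symMat_diagonal]
  simp

theorem exists_eval_eq_symMat (i j : Fin (k + 1)) :
    ∃ p : MvPolynomial (Fin 2 × Fin 2) ℂ, ∀ g : Matrix (Fin 2) (Fin 2) ℂ,
      symMat k g i j = p.eval (fun a => g a.1 a.2) := by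
  refine ⟨symMat k (Matrix.mvPolynomialX (Fin 2) (Fin 2) ℂ) i j, fun g => ?_⟩
  have : g = (Matrix.mvPolynomialX (Fin 2) (Fin 2) ℂ).map
      (MvPolynomial.eval fun a : Fin 2 × Fin 2 => g a.1 a.2) := by
    ext; simp
  conv_lhs => rw [this, symMat_map]
  rfl

/-! #### The invariant bilinear form -/

/-- The coefficients of `(γ U + δ W) ^ k`. -/
def powVec (k : ℕ) (γ δ : ℂ) (j : Fin (k + 1)) : ℂ :=
  (k.choose j : ℂ) * (γ ^ (k - (j : ℕ)) * δ ^ (j : ℕ))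

theorem homEval_powVec (γ δ U W : ℂ) : homEval (powVec k γ δ) U W = (γ * U + δ * W) ^ k := by
  rw [add_comm, add_pow, Finset.sum_range (n := k + 1), homEval]
  refine Finset.sum_congr rfl fun i _ => ?_
  rw [powVec, mul_pow, mul_pow]
  ring

theorem symMat_mulVec_powVec (g : Matrix (Fin 2) (Fin 2) ℂ) (γ δ : ℂ) :
    symMat k g *ᵥ powVec k γ δ = powVec k (γ * g 0 0 + δ * g 0 1) (γ * g 1 0 + δ * g 1 1) := by
  refine homEval_injective fun U W => ?_
  rw [homEval_symMat_mulVec, homEval_powVec, homEval_powVec]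
  ring

variable (k) in
/-- The invariant bilinear form on the `k`-th symmetric power. -/
def symForm : Matrix (Fin (k + 1)) (Fin (k + 1)) ℂ :=
  Matrix.of fun i j => if j = i.rev then (-1) ^ (i : ℕ) * (k.choose i : ℂ)⁻¹ else 0

theorem symForm_mulVec (x : Fin (k + 1) → ℂ) (i : Fin (k + 1)) :
    (symForm k *ᵥ x) i = (-1) ^ (i : ℕ) * (k.choose i : ℂ)⁻¹ * x i.rev := by
  simp [symForm, Matrix.mulVec, dotProduct]

theorem choose_ne_zero (i : Fin (k + 1)) : (k.choose i : ℂ) ≠ 0 := by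
  exact_mod_cast (Nat.choose_pos (by omega)).ne'

/-- Pairing with the `k`-th power of a linear form is evaluation at a point. This reduces the
invariance of `symForm` under a matrix to its determinant being one. -/
theorem dotProduct_symForm_powVec (x : Fin (k + 1) → ℂ) (γ δ : ℂ) :
    x ⬝ᵥ (symForm k *ᵥ powVec k γ δ) = homEval x δ (-γ) := by
  refine Finset.sum_congr rfl fun i _ => ?_
  rw [symForm_mulVec, powVec, Fin.val_rev]
  have h1 : k + 1 - ((i : ℕ) + 1) = k - i := by omega
  have h2 : k - (k - (i : ℕ)) = i := by omega
  rw [h1, h2, Nat.choose_symm (by omega), neg_pow γ]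
  have := choose_ne_zero i
  field_simp

theorem matrix_eq_of_mulVec_powVec {M M' : Matrix (Fin (k + 1)) (Fin (k + 1)) ℂ}
    (h : ∀ x γ δ, x ⬝ᵥ (M *ᵥ powVec k γ δ) = x ⬝ᵥ (M' *ᵥ powVec k γ δ)) : M = M' := by
  ext i j
  have h1 : (fun j => M i j * (k.choose j : ℂ)) = fun j => M' i j * (k.choose j : ℂ) := by
    refine homEval_injective fun U W => ?_
    have := h (Pi.single i 1) U W
    rw [single_one_dotProduct, single_one_dotProduct] at this
    simpa [homEval, Matrix.mulVec, dotProduct, powVec, mul_assoc] using this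
  exact mul_right_cancel₀ (choose_ne_zero j) (congrFun h1 j)

theorem symMat_transpose_mul_symForm_mul (g : SL(2, ℂ)) :
    (symMat k g.1)ᵀ * symForm k * symMat k g.1 = symForm k := by
  refine matrix_eq_of_mulVec_powVec fun x γ δ => ?_
  have hg := g.2
  rw [Matrix.det_fin_two] at hg
  rw [← Matrix.mulVec_mulVec, ← Matrix.mulVec_mulVec, Matrix.mulVec_transpose,
    dotProduct_comm, ← Matrix.dotProduct_mulVec, dotProduct_comm, symMat_mulVec_powVec,
    dotProduct_symForm_powVec, dotProduct_symForm_powVec, homEval_symMat_mulVec]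
  congr 1
  · linear_combination δ * hg
  · linear_combination -γ * hg

theorem symForm_transpose : (symForm k)ᵀ = (-1 : ℂ) ^ k • symForm k := by
  ext i j
  simp only [symForm, Matrix.transpose_apply, Matrix.of_apply, Matrix.smul_apply, smul_eq_mul]
  by_cases h : j = i.rev
  · have h' : i = j.rev := by rw [h, Fin.rev_rev]
    rw [if_pos h', if_pos h]
    have h1 : (j : ℕ) = k - i := by rw [h, Fin.val_rev]; omega
    rw [h1, Nat.choose_symm (by omega)]
    have h2 : (-1 : ℂ) ^ k = (-1) ^ (k - (i : ℕ)) * (-1) ^ (i : ℕ) := by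
      rw [← pow_add]; congr 1; omega
    rw [h2, ← mul_assoc, mul_assoc ((-1 : ℂ) ^ (k - (i : ℕ))), ← pow_add, ← two_mul,
      pow_mul, neg_one_sq, one_pow, mul_one]
  · have h' : ¬ i = j.rev := fun h' => h (by rw [h', Fin.rev_rev])
    rw [if_neg h', if_neg h, mul_zero]

theorem isUnit_symForm : IsUnit (symForm k) := by
  rw [← Matrix.mulVec_injective_iff_isUnit]
  intro x y h
  ext i
  have := congrFun h i.rev
  rw [symForm_mulVec, symForm_mulVec, Fin.rev_rev] at this
  exact mul_left_cancel₀ (mul_ne_zero (pow_ne_zero _ (by norm_num))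
    (inv_ne_zero (choose_ne_zero _))) this

/-! #### The standard unipotent element -/

theorem symMat_stdUnipotent (i j : Fin (k + 1)) :
    symMat k stdUnipotent.1 i j = ((j : ℕ).choose i : ℂ) := by
  simp [symMat_apply, symPoly, stdUnipotent, coeff_one_add_X_pow]

/-- In the last column of the `m`-th power the lowest nonzero entry sits in row `k - m`; at `m = k`
this is the top right corner. Together with nilpotency it makes the unipotent element a single
Jordan block. -/
theorem symMat_stdUnipotent_sub_one_pow_ne_zero : (symMat k stdUnipotent.1 - 1) ^ k ≠ 0 := by
  have key : ∀ m (hm : m ≤ k), ∀ i : Fin (k + 1), k - m ≤ (i : ℕ) →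
      ((k - m < (i : ℕ) → ((symMat k stdUnipotent.1 - 1) ^ m) i (Fin.last k) = 0) ∧
       ((i : ℕ) = k - m → ((symMat k stdUnipotent.1 - 1) ^ m) i (Fin.last k) ≠ 0)) := by
    intro m
    induction m with
    | zero =>
      intro _ i _
      rw [pow_zero]
      refine ⟨fun h => by omega, fun h => ?_⟩
      have : i = Fin.last k := Fin.ext h
      rw [this, Matrix.one_apply_eq]
      exact one_ne_zero
    | succ m ih =>
      intro hm i hi
      have ih := ih (by omega)
      rw [pow_succ', Matrix.mul_apply]
      have hN : ∀ j : Fin (k + 1), (j : ℕ) ≤ i → (symMat k stdUnipotent.1 - 1) i j = 0 := by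
        intro j hj
        rw [Matrix.sub_apply, symMat_stdUnipotent]
        rcases hj.lt_or_eq with h | h
        · rw [Nat.choose_eq_zero_of_lt h, Matrix.one_apply_ne (by rintro rfl; omega)]
          simp
        · obtain rfl := Fin.ext h
          simp
      constructor
      · intro h
        refine Finset.sum_eq_zero fun j _ => ?_
        by_cases hj : (j : ℕ) ≤ i
        · rw [hN j hj, zero_mul]
        · rw [(ih j (by omega)).1 (by omega), mul_zero]
      · intro h
        -- Only the summand `j = k - m` survives: smaller `j` vanish by strict triangularity, larger
        -- `j` by the induction hypothesis.
        let l : Fin (k + 1) := ⟨k - m, by omega⟩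
        rw [Finset.sum_eq_single l]
        · refine mul_ne_zero ?_ ((ih l le_rfl).2 rfl)
          rw [Matrix.sub_apply, symMat_stdUnipotent,
            Matrix.one_apply_ne (by intro h'; have := congrArg Fin.val h'; simp only [l] at this; omega),
            sub_zero]
          exact_mod_cast (Nat.choose_pos (by simp only [l]; omega)).ne'
        · intro j _ hj
          by_cases hj' : (j : ℕ) ≤ i
          · rw [hN j hj', zero_mul]
          · rw [(ih j (by omega)).1 ?_, mul_zero]
            have : (j : ℕ) ≠ k - m := fun h' => hj (Fin.ext h')
            omega
        · simp
  intro h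
  have := (key k le_rfl 0 (by simp)).2 (by simp)
  rw [h] at this
  exact this rfl

end SymPower

/-! ### Decompositions of families of operators into standard blocks -/

section Decomposition

open Module

variable {α D : Type*} {dim : D → ℕ} (model : ∀ d : D, α → End ℂ (Fin (dim d) → ℂ))

/-- The family `T` of operators is isomorphic to the direct sum of the standard blocks `d i`. -/
def IsDecomposition {V : Type*} [AddCommGroup V] [Module ℂ V] (T : α → End ℂ V)
    {I : Type} (d : I → D) : Prop :=
  ∃ e : V ≃ₗ[ℂ] (∀ i, Fin (dim (d i)) → ℂ), ∀ a v i, e (T a v) i = model (d i) a (e v i)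

variable {model}

/-- If every nonzero member of a hereditary class of families of operators on finite dimensional
spaces splits off a block, then every member is a direct sum of blocks. -/
theorem exists_isDecomposition
    (C : ∀ (V : Type) [AddCommGroup V] [Module ℂ V], (α → End ℂ V) → Prop)
    (hsub : ∀ (V : Type) [AddCommGroup V] [Module ℂ V] (T : α → End ℂ V), C V T →
      ∀ (K : Submodule ℂ V) (hK : ∀ a, ∀ v ∈ K, T a v ∈ K), C K fun a => (T a).restrict (hK a))
    (hsplit : ∀ (V : Type) [AddCommGroup V] [Module ℂ V] [FiniteDimensional ℂ V] [Nontrivial V]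
      (T : α → End ℂ V), C V T → ∃ (d : D) (Φ : V →ₗ[ℂ] (Fin (dim d) → ℂ)) (W : Submodule ℂ V),
        0 < dim d ∧ (∀ a v, Φ (T a v) = model d a (Φ v)) ∧ (∀ a, ∀ v ∈ W, T a v ∈ W) ∧
        (∀ y, ∃ w ∈ W, Φ w = y) ∧ ∀ w ∈ W, Φ w = 0 → w = 0)
    (V : Type) [AddCommGroup V] [Module ℂ V] [FiniteDimensional ℂ V] (T : α → End ℂ V)
    (hT : C V T) : ∃ (I : Type) (_ : Fintype I) (d : I → D), IsDecomposition model T d := by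
  induction hn : finrank ℂ V using Nat.strong_induction_on generalizing V with
  | _ n ih =>
  rcases subsingleton_or_nontrivial V with hV | hV
  · exact ⟨PEmpty, inferInstance, PEmpty.elim,
      ⟨⟨0, 0, fun v => Subsingleton.elim _ _, fun v => funext fun i => i.elim⟩,
        fun a v i => i.elim⟩⟩
  obtain ⟨d, Φ, W, hd, hΦ, hW, hsurj, hinj⟩ := hsplit V T hT
  have hK : ∀ a, ∀ v ∈ LinearMap.ker Φ, T a v ∈ LinearMap.ker Φ := by
    intro a v hv
    rw [LinearMap.mem_ker] at hv ⊢
    rw [hΦ, hv, map_zero]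
  have hlt : finrank ℂ (LinearMap.ker Φ) < n := by
    rw [← hn]
    refine Submodule.finrank_lt fun h => ?_
    obtain ⟨w, -, hw⟩ := hsurj (fun _ => 1)
    have h1 : Φ w = 0 := LinearMap.mem_ker.1 (h ▸ Submodule.mem_top)
    rw [h1] at hw
    exact zero_ne_one (congrFun hw ⟨0, hd⟩)
  obtain ⟨I, _, d', e', he'⟩ := ih _ hlt _ _ (hsub V T hT _ hK) rfl
  -- `Φ` maps `W` isomorphically onto the block, so `W` is a stable complement of the stable kernel,
  -- which is left to the induction.
  have hcompl : IsCompl W (LinearMap.ker Φ) := by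
    refine IsCompl.of_eq ?_ ?_
    · exact (Submodule.eq_bot_iff _).2 fun w hw => hinj w hw.1 hw.2
    · refine (Submodule.eq_top_iff').2 fun v => ?_
      obtain ⟨w, hw, hw'⟩ := hsurj (Φ v)
      exact Submodule.mem_sup.2 ⟨w, hw, v - w, by simp [hw'], by simp⟩
  let eW : W ≃ₗ[ℂ] (Fin (dim d) → ℂ) := LinearEquiv.ofBijective (Φ.domRestrict W)
    ⟨(injective_iff_map_eq_zero _).2 fun w hw => Subtype.ext (hinj w.1 w.2 hw),
      fun y => by obtain ⟨w, hw, hw'⟩ := hsurj y; exact ⟨⟨w, hw⟩, hw'⟩⟩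
  let dd : Option I → D := fun o => o.elim d d'
  let e1 := (Submodule.prodEquivOfIsCompl W (LinearMap.ker Φ) hcompl).symm.trans
    (eW.prodCongr e')
  let e2 : ((i : Option I) → Fin (dim (dd i)) → ℂ) ≃ₗ[ℂ]
      ((Fin (dim d) → ℂ) × ((i : I) → Fin (dim (d' i)) → ℂ)) :=
    LinearEquiv.piOptionEquivProd ℂ
  refine ⟨Option I, inferInstance, dd, e1.trans e2.symm, fun a v i => ?_⟩
  obtain ⟨⟨w, k⟩, rfl⟩ := (Submodule.prodEquivOfIsCompl W (LinearMap.ker Φ) hcompl).surjective v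
  have h1 : T a (Submodule.prodEquivOfIsCompl W (LinearMap.ker Φ) hcompl (w, k)) =
      Submodule.prodEquivOfIsCompl W (LinearMap.ker Φ) hcompl
        (⟨T a w, hW a w w.2⟩, ⟨T a k, hK a k k.2⟩) := by
    simp
  rw [h1]
  simp only [e1, LinearEquiv.trans_apply, LinearEquiv.symm_apply_apply]
  cases i with
  | none => exact hΦ a w
  | some i => exact he' a k i

theorem exists_equiv_comp_eq {I I' : Type} [Finite I] [Finite I'] (d : I → D) (d' : I' → D)
    (h : ∀ x, Nat.card {i // d i = x} = Nat.card {i // d' i = x}) :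
    ∃ σ : I ≃ I', d' ∘ σ = d := by
  let f : ∀ x, {i // d i = x} ≃ {i // d' i = x} := fun x => (Finite.card_eq.1 (h x)).some
  refine ⟨((Equiv.sigmaFiberEquiv d).symm.trans (Equiv.sigmaCongrRight f)).trans
    (Equiv.sigmaFiberEquiv d'), funext fun i => ?_⟩
  exact (f (d i) ⟨i, rfl⟩).2

/-- Families of operators that decompose into the same blocks are isomorphic. -/
theorem IsDecomposition.exists_equiv {V V' : Type*} [AddCommGroup V] [Module ℂ V]
    [AddCommGroup V'] [Module ℂ V'] {T : α → End ℂ V} {T' : α → End ℂ V'}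
    {I I' : Type} [Finite I] [Finite I'] {d : I → D} {d' : I' → D}
    (hT : IsDecomposition model T d) (hT' : IsDecomposition model T' d')
    (h : ∀ x, Nat.card {i // d i = x} = Nat.card {i // d' i = x}) :
    ∃ e : V ≃ₗ[ℂ] V', ∀ a v, e (T a v) = T' a (e v) := by
  obtain ⟨σ, rfl⟩ := exists_equiv_comp_eq d d' h
  obtain ⟨e, he⟩ := hT
  obtain ⟨e', he'⟩ := hT'
  let e1 : (∀ i, Fin (dim (d' (σ i))) → ℂ) ≃ₗ[ℂ] (∀ i, Fin (dim (d' i)) → ℂ) :=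
    LinearEquiv.piCongrLeft ℂ (fun i => Fin (dim (d' i)) → ℂ) σ
  refine ⟨(e.trans e1).trans e'.symm, fun a v => ?_⟩
  apply e'.injective
  ext1 i'
  obtain ⟨i, rfl⟩ := σ.surjective i'
  rw [he']
  simp only [LinearEquiv.trans_apply, LinearEquiv.apply_symm_apply]
  have h1 : ∀ x i, e1 x (σ i) = x i := fun x i =>
    Equiv.piCongrLeft_apply_apply (fun i => Fin (dim (d' i)) → ℂ) σ x i
  rw [h1, h1]
  exact he a v i

theorem finrank_ker_eq_sum {V : Type*} [AddCommGroup V] [Module ℂ V] {I : Type} [Fintype I]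
    {M : I → Type*} [∀ i, AddCommGroup (M i)] [∀ i, Module ℂ (M i)]
    [∀ i, FiniteDimensional ℂ (M i)] (e : V ≃ₗ[ℂ] (∀ i, M i)) (f : End ℂ V)
    (g : ∀ i, End ℂ (M i)) (h : ∀ v i, e (f v) i = g i (e v i)) :
    finrank ℂ (LinearMap.ker f) = ∑ i, finrank ℂ (LinearMap.ker (g i)) := by
  rw [← finrank_pi_fintype ℂ]
  refine LinearEquiv.finrank_eq ?_
  refine
    { toFun := fun v i => ⟨e v.1 i, by rw [LinearMap.mem_ker, ← h, v.2, map_zero]; rfl⟩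
      invFun := fun x => ⟨e.symm fun i => (x i).1, by
        rw [LinearMap.mem_ker]
        apply e.injective
        ext1 i
        rw [h, e.apply_symm_apply, map_zero]
        exact (x i).2⟩
      map_add' := fun v w => by ext i; simp
      map_smul' := fun c v => by ext i; simp
      left_inv := fun v => by simp
      right_inv := fun x => by ext i; simp }

end Decomposition

/-! ### Polynomial functions and elements of `SL₂(ℂ)` -/

section PolyFun

open Polynomial
open scoped Matrix

/-- The diagonal matrix `diag(a, a⁻¹)`. -/
def torus (a : ℂˣ) : SL(2, ℂ) := ⟨!![(a : ℂ), 0; 0, (a : ℂ)⁻¹], by simp [Matrix.det_fin_two_of]⟩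

/-- The upper triangular unipotent matrix with entry `x`. -/
def upper (x : ℂ) : SL(2, ℂ) := ⟨!![1, x; 0, 1], by simp [Matrix.det_fin_two_of]⟩

/-- The lower triangular unipotent matrix with entry `x`. -/
def lower (x : ℂ) : SL(2, ℂ) := ⟨!![1, 0; x, 1], by simp [Matrix.det_fin_two_of]⟩

theorem coe_torus (a : ℂˣ) : (torus a).1 = !![(a : ℂ), 0; 0, (a : ℂ)⁻¹] := rfl

theorem coe_upper (x : ℂ) : (upper x).1 = !![1, x; 0, 1] := rfl

theorem coe_lower (x : ℂ) : (lower x).1 = !![1, 0; x, 1] := rfl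

theorem upper_zero : upper 0 = 1 := by
  ext i j; fin_cases i <;> fin_cases j <;> simp [upper]

theorem lower_zero : lower 0 = 1 := by
  ext i j; fin_cases i <;> fin_cases j <;> simp [lower]

theorem stdUnipotent_eq_upper : stdUnipotent = upper 1 := rfl

theorem torus_mul (a b : ℂˣ) : torus (a * b) = torus a * torus b := by
  refine Subtype.ext ?_
  rw [Matrix.SpecialLinearGroup.coe_mul, coe_torus, coe_torus, coe_torus]
  simp [mul_comm]

theorem torus_one : torus 1 = 1 := by
  ext i j; fin_cases i <;> fin_cases j <;> simp [torus]

/-- The torus as a homomorphism. -/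
def torusHom : ℂˣ →* SL(2, ℂ) where
  toFun := torus
  map_one' := torus_one
  map_mul' := torus_mul

theorem torus_mul_upper (a : ℂˣ) (x : ℂ) : torus a * upper x = upper (a ^ 2 * x) * torus a := by
  refine Subtype.ext ?_
  rw [Matrix.SpecialLinearGroup.coe_mul, Matrix.SpecialLinearGroup.coe_mul, coe_torus, coe_upper,
    coe_upper]
  ext i j; fin_cases i <;> fin_cases j <;> simp
  field_simp

theorem lower_mul_torus (a : ℂˣ) (y : ℂ) : lower y * torus a = torus a * lower (a ^ 2 * y) := by
  refine Subtype.ext ?_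
  rw [Matrix.SpecialLinearGroup.coe_mul, Matrix.SpecialLinearGroup.coe_mul, coe_torus, coe_lower,
    coe_lower]
  ext i j; fin_cases i <;> fin_cases j <;> simp
  field_simp

theorem lower_mul_torus_mul_upper {g : SL(2, ℂ)} (a : ℂˣ) (ha : (a : ℂ) = g.1 0 0) :
    g = lower (g.1 1 0 / g.1 0 0) * torus a * upper (g.1 0 1 / g.1 0 0) := by
  have hd := g.2
  rw [Matrix.det_fin_two] at hd
  have h0 : g.1 0 0 ≠ 0 := ha ▸ a.ne_zero
  refine Subtype.ext ?_
  rw [Matrix.SpecialLinearGroup.coe_mul, Matrix.SpecialLinearGroup.coe_mul, coe_torus, coe_lower,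
    coe_upper, ha]
  ext i j
  fin_cases i <;> fin_cases j <;> simp <;> field_simp
  linear_combination hd

/-- A function on `SL₂(ℂ)` given by a polynomial in the matrix entries. -/
def IsPolyFun (f : SL(2, ℂ) → ℂ) : Prop :=
  ∃ p : MvPolynomial (Fin 2 × Fin 2) ℂ, ∀ g, f g = p.eval (fun a => g.1 a.1 a.2)

theorem isPolyFun_entry (i j : Fin 2) : IsPolyFun fun g => g.1 i j :=
  ⟨MvPolynomial.X (i, j), fun g => by simp⟩

theorem isPolyFun_const (c : ℂ) : IsPolyFun fun _ => c := ⟨MvPolynomial.C c, fun g => by simp⟩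

theorem IsPolyFun.add {f f' : SL(2, ℂ) → ℂ} (h : IsPolyFun f) (h' : IsPolyFun f') :
    IsPolyFun fun g => f g + f' g := by
  obtain ⟨p, hp⟩ := h
  obtain ⟨p', hp'⟩ := h'
  exact ⟨p + p', fun g => by simp only [hp, hp', map_add]⟩

theorem IsPolyFun.mul {f f' : SL(2, ℂ) → ℂ} (h : IsPolyFun f) (h' : IsPolyFun f') :
    IsPolyFun fun g => f g * f' g := by
  obtain ⟨p, hp⟩ := h
  obtain ⟨p', hp'⟩ := h'
  exact ⟨p * p', fun g => by simp only [hp, hp', map_mul]⟩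

theorem IsPolyFun.sum {I : Type*} (s : Finset I) {f : I → SL(2, ℂ) → ℂ}
    (h : ∀ i ∈ s, IsPolyFun (f i)) : IsPolyFun fun g => ∑ i ∈ s, f i g := by
  classical
  induction s using Finset.induction_on with
  | empty => simpa using isPolyFun_const 0
  | insert i s hi ih =>
    simp only [Finset.sum_insert hi]
    exact (h i (Finset.mem_insert_self _ _)).add (ih fun j hj => h j (Finset.mem_insert_of_mem hj))

theorem IsPolyFun.comp {f : SL(2, ℂ) → ℂ} (h : IsPolyFun f) {σ : SL(2, ℂ) → SL(2, ℂ)}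
    (hσ : ∀ i j, IsPolyFun fun g => (σ g).1 i j) : IsPolyFun fun g => f (σ g) := by
  obtain ⟨p, hp⟩ := h
  choose q hq using hσ
  refine ⟨MvPolynomial.bind₁ (fun a => q a.1 a.2) p, fun g => ?_⟩
  have e : (fun a : Fin 2 × Fin 2 => (σ g).1 a.1 a.2) = fun a =>
      MvPolynomial.eval (fun b : Fin 2 × Fin 2 => g.1 b.1 b.2) (q a.1 a.2) :=
    funext fun a => hq a.1 a.2 g
  have e' := MvPolynomial.eval₂Hom_bind₁ (RingHom.id ℂ) (fun a : Fin 2 × Fin 2 => g.1 a.1 a.2)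
    (fun a => q a.1 a.2) p
  generalize (MvPolynomial.bind₁ fun a : Fin 2 × Fin 2 => q a.1 a.2) p = r at e'
  exact ((hp (σ g)).trans (congrArg (fun x => MvPolynomial.eval x p) e)).trans e'.symm

theorem IsPolyFun.mul_left {f : SL(2, ℂ) → ℂ} (h : IsPolyFun f) (k : SL(2, ℂ)) :
    IsPolyFun fun g => f (k * g) :=
  h.comp fun i j => by
    simp only [Matrix.SpecialLinearGroup.coe_mul, Matrix.mul_apply]
    exact IsPolyFun.sum _ fun l _ => (isPolyFun_const _).mul (isPolyFun_entry l j)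

theorem IsPolyFun.transpose {f : SL(2, ℂ) → ℂ} (h : IsPolyFun f) :
    IsPolyFun fun g => f g.transpose :=
  h.comp fun i j => isPolyFun_entry j i

theorem IsPolyFun.exists_polynomial {f : SL(2, ℂ) → ℂ} (h : IsPolyFun f) {c : ℂ → SL(2, ℂ)}
    (E : Fin 2 → Fin 2 → ℂ[X]) (hc : ∀ x i j, (c x).1 i j = (E i j).eval x) :
    ∃ q : ℂ[X], ∀ x, f (c x) = q.eval x := by
  obtain ⟨p, hp⟩ := h
  refine ⟨MvPolynomial.aeval (fun a => E a.1 a.2) p, fun x => ?_⟩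
  rw [hp, ← Polynomial.coe_evalRingHom, MvPolynomial.map_aeval]
  simp only [hc, Polynomial.coe_evalRingHom, MvPolynomial.eval]
  congr 1
  ext <;> simp

theorem IsPolyFun.exists_polynomial_upper {f : SL(2, ℂ) → ℂ} (h : IsPolyFun f) :
    ∃ q : ℂ[X], ∀ x, f (upper x) = q.eval x :=
  h.exists_polynomial (fun i j => !![(1 : ℂ[X]), X; 0, 1] i j) fun x i j => by
    fin_cases i <;> fin_cases j <;> simp [upper]

theorem IsPolyFun.exists_polynomial_lower {f : SL(2, ℂ) → ℂ} (h : IsPolyFun f) :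
    ∃ q : ℂ[X], ∀ x, f (lower x) = q.eval x :=
  h.exists_polynomial (fun i j => !![(1 : ℂ[X]), 0; X, 1] i j) fun x i j => by
    fin_cases i <;> fin_cases j <;> simp [lower]

theorem IsPolyFun.exists_polynomial_torus {f : SL(2, ℂ) → ℂ} (h : IsPolyFun f) :
    ∃ (D : ℕ) (q : ℂ[X]), ∀ a : ℂˣ, (a : ℂ) ^ D * f (torus a) = q.eval (a : ℂ) := by
  obtain ⟨p, hp⟩ := h
  simp only [hp]
  clear hp
  induction p using MvPolynomial.induction_on with
  | C c => exact ⟨0, C c, fun a => by simp⟩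
  | add p p' h h' =>
    obtain ⟨D, q, hq⟩ := h
    obtain ⟨D', q', hq'⟩ := h'
    refine ⟨D + D', X ^ D' * q + X ^ D * q', fun a => ?_⟩
    simp only [map_add, eval_add, eval_mul, eval_pow, eval_X, ← hq, ← hq']
    ring
  | mul_X p b h =>
    obtain ⟨D, q, hq⟩ := h
    have hb : ∃ r : ℂ[X], ∀ a : ℂˣ, (a : ℂ) * (torus a).1 b.1 b.2 = r.eval (a : ℂ) := by
      obtain ⟨i, j⟩ := b
      fin_cases i <;> fin_cases j
      · exact ⟨X * X, fun a => by simp [torus]⟩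
      · exact ⟨0, fun a => by simp [torus]⟩
      · exact ⟨0, fun a => by simp [torus]⟩
      · exact ⟨1, fun a => by simp [torus]⟩
    obtain ⟨r, hr⟩ := hb
    refine ⟨D + 1, q * r, fun a => ?_⟩
    simp only [map_mul, eval_mul, ← hq, ← hr, MvPolynomial.eval_X]
    ring

/-- Letting `a` tend to zero gives `0 ^ e * h(0) = h(y)`, whose left side does not involve `y`.
Unipotent elements fix extremal weight vectors for this reason. -/
theorem polynomial_const_of_scaling {h : ℂ[X]} {e : ℕ}
    (H : ∀ (a : ℂˣ) (y : ℂ), (a : ℂ) ^ e * h.eval ((a : ℂ) ^ 2 * y) = h.eval y) (y : ℂ) :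
    h.eval y = h.eval 0 := by
  have key : ∀ y, (0 : ℂ) ^ e * h.eval 0 = h.eval y := by
    intro y
    have h1 : Set.EqOn (fun a : ℂ => a ^ e * h.eval (a ^ 2 * y)) (fun _ => h.eval y) {0}ᶜ :=
      fun a ha => H (Units.mk0 a ha) y
    have h2 := Continuous.ext_on (dense_compl_singleton (0 : ℂ))
      (by have := h.continuous; fun_prop) (by fun_prop) h1
    simpa using congrFun h2 0
  rcases Nat.eq_zero_or_pos e with rfl | he
  · simpa using (key y).symm
  · rw [← key y, ← key 0, zero_pow he.ne', zero_mul, zero_mul]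

/-- If the degree exceeded `k`, the reversed polynomial would vanish at zero, where its value is the
leading coefficient of `p`. -/
theorem natDegree_le_of_eval_inv {p q : ℂ[X]} {k : ℕ}
    (h : ∀ a : ℂˣ, (a : ℂ) ^ k * p.eval (a : ℂ)⁻¹ = q.eval (a : ℂ)) : p.natDegree ≤ k := by
  by_contra! hlt
  have h1 : Set.EqOn (fun a : ℂ => p.reverse.eval a)
      (fun a => a ^ (p.natDegree - k) * q.eval a) {0}ᶜ := by
    intro a ha
    have ha : a ≠ 0 := ha
    have h2 := h (Units.mk0 a ha)
    let : Invertible a⁻¹ := invertibleOfNonzero (inv_ne_zero ha)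
    have h3 := eval₂_reverse_mul_pow (RingHom.id ℂ) a⁻¹ p
    rw [invOf_eq_inv, inv_inv, eval₂_id, eval₂_id] at h3
    rw [Units.val_mk0, ← h3, inv_pow] at h2
    dsimp only
    rw [← h2, ← mul_assoc, ← pow_add, Nat.sub_add_cancel hlt.le]
    field_simp
  have h2 := Continuous.ext_on (dense_compl_singleton (0 : ℂ))
    (by have := p.reverse.continuous; fun_prop)
    (by have := q.continuous; fun_prop) h1
  have h3 := congrFun h2 0
  simp only [zero_pow (Nat.sub_ne_zero_of_lt hlt), zero_mul] at h3
  rw [← coeff_zero_eq_eval_zero, coeff_zero_reverse, leadingCoeff_eq_zero] at h3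
  rw [h3] at hlt
  simp at hlt

theorem nonneg_of_zpow_eq_eval {n : ℤ} {q : ℂ[X]}
    (h : ∀ a : ℂˣ, (a : ℂ) ^ n = q.eval (a : ℂ)) : 0 ≤ n := by
  by_contra! hn
  obtain ⟨m, hm⟩ : ∃ m : ℕ, n = -(m + 1 : ℕ) := ⟨(-n - 1).toNat, by omega⟩
  have h1 : Set.EqOn (fun a : ℂ => a ^ (m + 1) * q.eval a) (fun _ => 1) {0}ᶜ := by
    intro a ha
    have ha : a ≠ 0 := ha
    have h2 := h (Units.mk0 a ha)
    rw [Units.val_mk0] at h2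
    simp only [← h2, hm, zpow_neg, zpow_natCast]
    field_simp
  have h2 := congrFun (Continuous.ext_on (dense_compl_singleton (0 : ℂ))
    (by have := q.continuous; fun_prop) (by fun_prop) h1) 0
  simp at h2

/-- The polynomial satisfies `q(b a) = q(b) q(a)`; comparing a nonzero coefficient, of index `i`,
gives `q(b) = b ^ i`. -/
theorem exists_zpow_of_multiplicative {χ : ℂˣ → ℂ} (h1 : χ 1 = 1)
    (hmul : ∀ a b, χ (a * b) = χ a * χ b) {D : ℕ} {q : ℂ[X]}
    (hq : ∀ a : ℂˣ, (a : ℂ) ^ D * χ a = q.eval (a : ℂ)) :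
    ∃ n : ℤ, ∀ a : ℂˣ, χ a = (a : ℂ) ^ n := by
  have hq0 : q ≠ 0 := by
    rintro rfl
    have := hq 1
    simp [h1] at this
  obtain ⟨i, hi⟩ : ∃ i, q.coeff i ≠ 0 := by
    by_contra! h
    exact hq0 (Polynomial.ext h)
  have hb : ∀ b : ℂˣ, q.eval (b : ℂ) = (b : ℂ) ^ i := by
    intro b
    have h2 : Set.EqOn (fun a : ℂ => (q.comp (C (b : ℂ) * X)).eval a)
        (fun a => (C (q.eval (b : ℂ)) * q).eval a) {0}ᶜ := by
      intro a ha
      have ha : a ≠ 0 := ha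
      have h3 := hq (b * Units.mk0 a ha)
      have h4 := hq b
      have h5 := hq (Units.mk0 a ha)
      rw [hmul, Units.val_mul, mul_pow, Units.val_mk0] at h3
      rw [Units.val_mk0] at h5
      simp only [eval_comp, eval_mul, eval_C, eval_X, ← h3, ← h4, ← h5]
      ring
    have h3 := Polynomial.funext fun a => congrFun (Continuous.ext_on
      (dense_compl_singleton (0 : ℂ)) (Polynomial.continuous _) (Polynomial.continuous _) h2) a
    have h4 := congrArg (fun r => r.coeff i) h3
    simp only [comp_C_mul_X_coeff, coeff_C_mul] at h4
    exact (mul_right_cancel₀ hi ((mul_comm _ _).trans h4)).symm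
  refine ⟨i - D, fun a => ?_⟩
  have h2 := hq a
  rw [hb] at h2
  rw [zpow_sub₀ a.ne_zero, zpow_natCast, zpow_natCast, ← h2]
  field_simp

/-- Roots of unity are Zariski dense in the torus. They matter because the torus elements of finite
order are the ones whose semisimplicity is evident. -/
theorem infinite_units_isOfFinOrder : {a : ℂ | ∃ u : ℂˣ, IsOfFinOrder u ∧ (u : ℂ) = a}.Infinite := by
  refine Set.infinite_of_injective_forall_mem
    (f := fun n : ℕ => Complex.exp (2 * Real.pi * Complex.I / ((n + 1 : ℕ) : ℂ))) ?_ ?_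
  · intro m n h
    have hm := (Complex.isPrimitiveRoot_exp (m + 1) (by omega)).eq_orderOf
    have hn := (Complex.isPrimitiveRoot_exp (n + 1) (by omega)).eq_orderOf
    dsimp only at h
    rw [h, ← hn] at hm
    omega
  · intro n
    have hn := Complex.isPrimitiveRoot_exp (n + 1) (by omega)
    have hu := hn.isUnit (by omega)
    refine ⟨hu.unit, ?_, rfl⟩
    refine isOfFinOrder_iff_pow_eq_one.2 ⟨n + 1, by omega, Units.ext ?_⟩
    simpa using hn.pow_eq_one

end PolyFun

/-! ### Complete reducibility of algebraic representations of `SL₂(ℂ)` -/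

section SemiInvariant

open Polynomial

theorem continuous_homEval {k : ℕ} (c : Fin (k + 1) → ℂ) {u w : ℂ → ℂ} (hu : Continuous u)
    (hw : Continuous w) : Continuous fun x => homEval c (u x) (w x) := by
  unfold homEval
  fun_prop

/-- The polynomial curve `(a 1; -1 0)` in `SL₂`. -/
theorem eval_curve {f : SL(2, ℂ) → ℂ} (hf : IsPolyFun f) (hl : ∀ y g, f (lower y * g) = f g)
    {χ : ℂˣ → ℂ} (ht : ∀ a g, f (torus a * g) = χ a * f g) :
    ∃ q : ℂ[X], ∀ a : ℂˣ, χ a * f (upper (a : ℂ)⁻¹) = q.eval (a : ℂ) := by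
  -- The curve stays in `SL₂` at `a = 0`, and for `a ≠ 0` it is a lower unipotent times `torus a`
  -- times `upper a⁻¹`. It thus controls `f (upper x)` as `x` tends to infinity.
  let c : ℂ → SL(2, ℂ) := fun a => ⟨!![a, 1; -1, 0], by simp [Matrix.det_fin_two_of]⟩
  obtain ⟨q, hq⟩ := hf.exists_polynomial (c := c) (fun i j => !![X, (1 : ℂ[X]); -1, 0] i j)
    fun x i j => by fin_cases i <;> fin_cases j <;> simp [c]
  refine ⟨q, fun a => ?_⟩
  rw [← hq, lower_mul_torus_mul_upper (g := c a) a rfl, mul_assoc, hl, ht]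
  simp [c]

/-- A polynomial function on `SL₂` that is invariant under the lower triangular unipotent matrices
and homogeneous under the torus is a homogeneous polynomial in the first row. -/
theorem exists_homEval_eq {f : SL(2, ℂ) → ℂ} (hf : IsPolyFun f)
    (hl : ∀ y g, f (lower y * g) = f g) {k : ℕ} (ht : ∀ a g, f (torus a * g) = (a : ℂ) ^ k * f g) :
    ∃ c : Fin (k + 1) → ℂ, ∀ g, f g = homEval c (g.1 0 0) (g.1 0 1) := by
  obtain ⟨p, hp⟩ := hf.exists_polynomial_upper
  obtain ⟨q, hq⟩ := eval_curve hf hl ht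
  have hdeg : p.natDegree ≤ k := natDegree_le_of_eval_inv (q := q) fun a => by rw [← hp, hq]
  refine ⟨fun i => p.coeff i, ?_⟩
  have h1 : ∀ g : SL(2, ℂ), g.1 0 0 ≠ 0 →
      f g = homEval (fun i : Fin (k + 1) => p.coeff i) (g.1 0 0) (g.1 0 1) := by
    intro g hg
    rw [homEval_coeff_of_ne_zero hdeg hg, ← hp]
    conv_lhs => rw [lower_mul_torus_mul_upper (g := g) (Units.mk0 _ hg) rfl, mul_assoc, hl, ht]
    rfl
  intro g
  by_cases hg : g.1 0 0 = 0
  · have hg1 : g.1 0 1 ≠ 0 := by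
      intro h
      have := g.2
      rw [Matrix.det_fin_two, hg, h] at this
      simp at this
    -- Outside the big cell: `g * lower x` lies in the big cell for `x ≠ 0`, and both sides are
    -- continuous in `x`, so they agree at `x = 0`.
    obtain ⟨r, hr⟩ := (hf.mul_left g).exists_polynomial_lower
    have e0 : ∀ x, (g * lower x).1 0 0 = g.1 0 1 * x := fun x => by
      rw [Matrix.SpecialLinearGroup.coe_mul, coe_lower]
      simp [Matrix.mul_apply, Fin.sum_univ_two, hg]
    have e1 : ∀ x, (g * lower x).1 0 1 = g.1 0 1 := fun x => by
      rw [Matrix.SpecialLinearGroup.coe_mul, coe_lower]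
      simp [Matrix.mul_apply, Fin.sum_univ_two]
    have h2 : Set.EqOn (fun x : ℂ => r.eval x)
        (fun x => homEval (fun i : Fin (k + 1) => p.coeff i) (g.1 0 1 * x) (g.1 0 1)) {0}ᶜ := by
      intro x hx
      dsimp only
      rw [← hr, h1 _ (by rw [e0]; exact mul_ne_zero hg1 hx), e0, e1]
    have h3 := congrFun (Continuous.ext_on (dense_compl_singleton (0 : ℂ)) r.continuous
      (continuous_homEval _ (by fun_prop) (by fun_prop)) h2) 0
    rw [← hr, lower_zero, mul_one, mul_zero] at h3
    rw [h3, hg]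
  · exact h1 g hg

end SemiInvariant

/-! ### Weight vectors of algebraic representations. -/

section Core

open Module Polynomial

variable {V : Type} [AddCommGroup V] [Module ℂ V]

/-- A representation of `SL₂(ℂ)` whose matrix coefficients are polynomial functions. -/
def IsAlgebraicRep (ρ : SL(2, ℂ) →* End ℂ V) : Prop :=
  ∀ (ξ : Dual ℂ V) (x : V), IsPolyFun fun g => ξ (ρ g x)

variable {ρ : SL(2, ℂ) →* End ℂ V}

theorem isSemisimple_torus_of_isOfFinOrder (ρ : SL(2, ℂ) →* End ℂ V) {u : ℂˣ}
    (hu : IsOfFinOrder u) : (ρ (torus u)).IsSemisimple := by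
  obtain ⟨n, hn, hun⟩ := isOfFinOrder_iff_pow_eq_one.1 hu
  have hs : (X ^ n - C (1 : ℂ)).Separable :=
    separable_X_pow_sub_C 1 (by exact_mod_cast hn.ne') one_ne_zero
  refine End.isSemisimple_of_squarefree_aeval_eq_zero hs.squarefree ?_
  have h1 : ρ (torus u) ^ n = 1 := by
    rw [← map_pow]
    change ρ (torusHom u ^ n) = 1
    rw [← map_pow, hun, map_one, map_one]
  simp [h1]

/-- An algebraic representation of `SL₂(ℂ)` with a commuting semisimple operator has a basis of
joint eigenvectors for the operator and the torus. -/
theorem exists_weight_basis [FiniteDimensional ℂ V] (hρ : IsAlgebraicRep ρ) {s : End ℂ V} (hs : s.IsSemisimple)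
    (hcomm : ∀ g, Commute (ρ g) s) :
    ∃ (I : Type) (b : Basis I ℂ V) (μ : I → ℂ) (n : I → ℤ),
      ∀ i, s (b i) = μ i • b i ∧ ∀ a : ℂˣ, ρ (torus a) (b i) = ((a : ℂ) ^ n i) • b i := by
  let S : Set V := {x | ∃ (μ : ℂ) (n : ℤ), s x = μ • x ∧
    ∀ a : ℂˣ, ρ (torus a) x = ((a : ℂ) ^ n) • x}
  suffices hS : ⊤ ≤ Submodule.span ℂ S by
    have hb := Basis.ofSpan_subset hS
    choose μ n h using fun i => hb (Set.mem_range_self (f := Basis.ofSpan hS) i)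
    exact ⟨_, _, μ, n, h⟩
  -- The family consists of `s` (index `none`) and the torus elements of finite order, all
  -- semisimple and commuting. Their joint eigenvectors turn out to be eigenvectors of the whole
  -- torus.
  let ι := Option {u : ℂˣ // IsOfFinOrder u}
  let T : ι → End ℂ V := fun o => o.elim s fun u => ρ (torus u.1)
  have htc : ∀ u v : ℂˣ, Commute (ρ (torus u)) (ρ (torus v)) := fun u v => by
    change ρ (torus u) * ρ (torus v) = ρ (torus v) * ρ (torus u)
    rw [← map_mul, ← map_mul, ← torus_mul, ← torus_mul, mul_comm]
  have hTc : Pairwise fun i j => Commute (T i) (T j) := by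
    intro i j _
    cases i <;> cases j
    · exact Commute.refl _
    · exact (hcomm _).symm
    · exact hcomm _
    · exact htc _ _
  have hTs : ∀ i, (T i).IsSemisimple := by
    intro i
    cases i with
    | none => exact hs
    | some u => exact isSemisimple_torus_of_isOfFinOrder ρ u.2
  have htop := End.iSup_iInf_maxGenEigenspace_eq_top_of_iSup_maxGenEigenspace_eq_top_of_commute T
    hTc fun i => End.iSup_maxGenEigenspace_eq_top (T i)
  rw [← htop]
  refine iSup_le fun χ => ?_
  intro x hx
  have hx' : ∀ i, T i x = χ i • x := by
    intro i
    have := (Submodule.mem_iInf _).1 hx i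
    rw [(hTs i).isFinitelySemisimple.maxGenEigenspace_eq_eigenspace] at this
    exact End.mem_eigenspace_iff.1 this
  by_cases hx0 : x = 0
  · rw [hx0]; exact Submodule.zero_mem _
  refine Submodule.subset_span ?_
  -- A functional that kills `x` but not `ρ (torus a) x` would yield a polynomial that is nonzero at
  -- `a` and vanishes at all roots of unity.
  have hline : ∀ a : ℂˣ, ρ (torus a) x ∈ Submodule.span ℂ {x} := by
    intro a
    by_contra hna
    obtain ⟨ξ, hξ, hker⟩ := Submodule.exists_le_ker_of_notMem hna
    have hξx : ξ x = 0 := hker (Submodule.mem_span_singleton_self x)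
    obtain ⟨D, q, hq⟩ := (hρ ξ x).exists_polynomial_torus
    have hq0 : q = 0 := by
      refine Polynomial.eq_zero_of_infinite_isRoot q (infinite_units_isOfFinOrder.mono ?_)
      rintro _ ⟨u, hu, rfl⟩
      have h1 : ρ (torus u) x = χ (some ⟨u, hu⟩) • x := hx' (some ⟨u, hu⟩)
      change q.eval (u : ℂ) = 0
      rw [← hq, h1, map_smul, hξx, smul_zero, mul_zero]
    have h2 := hq a
    rw [hq0, eval_zero] at h2
    exact hξ ((mul_eq_zero.1 h2).resolve_left (pow_ne_zero _ a.ne_zero))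
  choose c hc using fun a => Submodule.mem_span_singleton.1 (hline a)
  have hinj : ∀ {z w : ℂ}, z • x = w • x → z = w := fun h => smul_left_injective ℂ hx0 h
  obtain ⟨ξ, hξ⟩ : ∃ ξ : Dual ℂ V, ξ x ≠ 0 := by
    by_contra! h
    exact hx0 ((Module.forall_dual_apply_eq_zero_iff ℂ x).1 h)
  obtain ⟨D, q, hq⟩ := (hρ ξ x).exists_polynomial_torus
  obtain ⟨n, hn⟩ := exists_zpow_of_multiplicative (χ := c) (D := D) (q := C (ξ x)⁻¹ * q)
    (hinj (by rw [hc, torus_one, map_one, one_smul]; rfl))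
    (fun a b => hinj (by
      rw [hc, torus_mul, map_mul, mul_comm (c a), mul_smul, hc, End.mul_apply, ← hc b, map_smul]))
    (fun a => by
      rw [eval_mul, eval_C, ← hq, ← hc, map_smul, smul_eq_mul]
      field_simp)
  exact ⟨χ none, n, hx' none, fun a => by rw [← hc, hn]⟩

end Core

/-! ### Splitting off a symmetric power. -/

section Splitting

open Module Polynomial
open scoped Matrix

/-- The values of `φ` form a polynomial in `y` whose coefficients determine `φ`. The vectors are the
orbit of the highest weight vector under lower unipotents, which therefore spans the symmetric
power. -/
theorem eq_zero_of_powVec_eq_zero {k : ℕ} {φ : Dual ℂ (Fin (k + 1) → ℂ)}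
    (h : ∀ y, φ (powVec k 1 y) = 0) : φ = 0 := by
  have h1 : (fun j : Fin (k + 1) => φ (Pi.single j 1) * (k.choose j : ℂ)) = 0 := by
    refine eq_of_homEval_one_eq fun W => ?_
    have h2 := h W
    rw [LinearMap.pi_apply_eq_sum_univ φ] at h2
    simp only [powVec, smul_eq_mul, one_pow, one_mul] at h2
    simp only [homEval, one_pow, one_mul, Pi.zero_apply, zero_mul, Finset.sum_const_zero]
    rw [← h2]
    refine Finset.sum_congr rfl fun j _ => ?_
    have h3 : (fun i => if j = i then (1 : ℂ) else 0) = Pi.single j 1 := by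
      ext; simp [Pi.single_apply, eq_comm]
    rw [h3]
    ring
  refine LinearMap.pi_ext' fun j => LinearMap.ext_ring ?_
  have h2 := congrFun h1 j
  simpa using (mul_eq_zero.1 h2).resolve_right (choose_ne_zero j)

theorem symMat_lower_mulVec (k : ℕ) (y : ℂ) :
    symMat k (lower y).1 *ᵥ powVec k 1 0 = powVec k 1 y := by
  rw [symMat_mulVec_powVec]
  simp [lower]

variable {V : Type} [AddCommGroup V] [Module ℂ V] {ρ : SL(2, ℂ) →* End ℂ V}

/-- Here `v` is a basis vector of maximal weight and `f` is its dual coordinate. The relevant matrix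
coefficients of one-parameter unipotent groups scale under the torus as in
`polynomial_const_of_scaling`, precisely because the weight is maximal; so the upper unipotents fix
`v` and the lower ones fix `f`. -/
theorem exists_weight_vectors [FiniteDimensional ℂ V] [Nontrivial V] (hρ : IsAlgebraicRep ρ)
    {s : End ℂ V} (hs : s.IsSemisimple) (hcomm : ∀ g, Commute (ρ g) s) :
    ∃ (μ : ℂ) (k : ℕ) (f : Dual ℂ V) (v : V), f v = 1 ∧ s v = μ • v ∧ (∀ x, f (s x) = μ * f x) ∧
      (∀ a : ℂˣ, ρ (torus a) v = ((a : ℂ) ^ k) • v) ∧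
      (∀ (a : ℂˣ) x, f (ρ (torus a) x) = (a : ℂ) ^ k * f x) ∧
      (∀ y, ρ (upper y) v = v) ∧ ∀ y x, f (ρ (lower y) x) = f x := by
  obtain ⟨I, b, μ, n, hb⟩ := exists_weight_basis hρ hs hcomm
  have := Module.Finite.finite_basis b
  have : Nonempty I := b.index_nonempty
  obtain ⟨i₀, hi₀⟩ := Finite.exists_max n
  have hcoord : ∀ j (a : ℂˣ) x, b.coord j (ρ (torus a) x) = (a : ℂ) ^ n j * b.coord j x := by
    intro j a x
    have : b.coord j ∘ₗ ρ (torus a) = ((a : ℂ) ^ n j) • b.coord j := by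
      classical
      refine b.ext fun i => ?_
      simp only [LinearMap.comp_apply, (hb i).2, map_smul, LinearMap.smul_apply, Basis.coord_apply,
        Basis.repr_self, Finsupp.single_apply, smul_eq_mul]
      split_ifs with h
      · rw [h]
      · simp
    exact LinearMap.congr_fun this x
  have hup : ∀ y, ρ (upper y) (b i₀) = b i₀ := by
    intro y
    refine b.ext_elem fun j => ?_
    obtain ⟨h, hh⟩ := (hρ (b.coord j) (b i₀)).exists_polynomial_upper
    obtain ⟨e, he⟩ : ∃ e : ℕ, (e : ℤ) = n i₀ - n j := ⟨(n i₀ - n j).toNat, by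
      have := hi₀ j; omega⟩
    have hsc := polynomial_const_of_scaling (h := h) (e := e) (fun a y => by
      rw [← hh, ← hh]
      have h1 : ρ (upper ((a : ℂ) ^ 2 * y)) (ρ (torus a) (b i₀)) =
          ρ (torus a) (ρ (upper y) (b i₀)) := by
        rw [← End.mul_apply, ← End.mul_apply, ← map_mul, ← map_mul, torus_mul_upper]
      have h2 := congrArg (b.coord j) h1
      rw [(hb i₀).2, map_smul, map_smul, hcoord, smul_eq_mul] at h2
      have ha := a.ne_zero
      rw [← zpow_natCast, he, zpow_sub₀ ha, div_mul_eq_mul_div, h2]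
      field_simp) y
    rw [← hh, ← hh, upper_zero, map_one, End.one_apply] at hsc
    exact hsc
  have hlow : ∀ y x, b.coord i₀ (ρ (lower y) x) = b.coord i₀ x := by
    intro y x
    have : b.coord i₀ ∘ₗ ρ (lower y) = b.coord i₀ := by
      refine b.ext fun j => ?_
      obtain ⟨h, hh⟩ := (hρ (b.coord i₀) (b j)).exists_polynomial_lower
      obtain ⟨e, he⟩ : ∃ e : ℕ, (e : ℤ) = n i₀ - n j := ⟨(n i₀ - n j).toNat, by
        have := hi₀ j; omega⟩
      have hsc := polynomial_const_of_scaling (h := h) (e := e) (fun a y => by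
        rw [← hh, ← hh]
        have h1 : ρ (lower y) (ρ (torus a) (b j)) =
            ρ (torus a) (ρ (lower ((a : ℂ) ^ 2 * y)) (b j)) := by
          rw [← End.mul_apply, ← End.mul_apply, ← map_mul, ← map_mul, lower_mul_torus]
        have h2 := congrArg (b.coord i₀) h1
        rw [(hb j).2, map_smul, map_smul, hcoord, smul_eq_mul] at h2
        have ha := a.ne_zero
        rw [← zpow_natCast, he, zpow_sub₀ ha, div_mul_eq_mul_div, ← h2]
        field_simp) y
      rw [← hh, ← hh, lower_zero, map_one, End.one_apply] at hsc
      exact hsc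
    exact LinearMap.congr_fun this x
  have hone : b.coord i₀ (b i₀) = 1 := by simp
  -- Along the curve of `eval_curve` the matrix coefficient gives `a ^ n i₀`, which must be a
  -- polynomial in `a`.
  have hn : 0 ≤ n i₀ := by
    obtain ⟨q, hq⟩ := eval_curve (hρ (b.coord i₀) (b i₀)) (χ := fun a => (a : ℂ) ^ n i₀)
      (fun y g => by rw [map_mul, End.mul_apply, hlow])
      (fun a g => by rw [map_mul, End.mul_apply, hcoord])
    exact nonneg_of_zpow_eq_eval (q := q) fun a => by rw [← hq, hup, hone, mul_one]
  obtain ⟨k, hk⟩ := Int.eq_ofNat_of_zero_le hn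
  refine ⟨μ i₀, k, b.coord i₀, b i₀, hone, (hb i₀).1, fun x => ?_, fun a => ?_, fun a x => ?_,
    hup, hlow⟩
  · have : b.coord i₀ ∘ₗ s = μ i₀ • b.coord i₀ := by
      classical
      refine b.ext fun i => ?_
      simp only [LinearMap.comp_apply, (hb i).1, map_smul, LinearMap.smul_apply, Basis.coord_apply,
        Basis.repr_self, Finsupp.single_apply, smul_eq_mul]
      split_ifs with h
      · rw [h]
      · simp
    exact LinearMap.congr_fun this x
  · rw [(hb i₀).2, hk, zpow_natCast]
  · rw [hcoord, hk, zpow_natCast]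

/-- The linear map that sends `x` to the coefficients of the homogeneous polynomial `F x`. -/
theorem exists_linearMap_homEval {k : ℕ} {F : V →ₗ[ℂ] (SL(2, ℂ) → ℂ)}
    (hF : ∀ x, IsPolyFun (F x)) (hl : ∀ x y g, F x (lower y * g) = F x g)
    (ht : ∀ x a g, F x (torus a * g) = (a : ℂ) ^ k * F x g) :
    ∃ Φ : V →ₗ[ℂ] (Fin (k + 1) → ℂ), ∀ x g, F x g = homEval (Φ x) (g.1 0 0) (g.1 0 1) := by
  choose c hc using fun x => exists_homEval_eq (hF x) (hl x) (ht x)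
  have hu : ∀ x W, homEval (c x) 1 W = F x (upper W) := fun x W => by
    rw [hc]; simp [upper]
  refine ⟨⟨⟨c, fun x y => ?_⟩, fun z x => ?_⟩, hc⟩
  · refine eq_of_homEval_one_eq fun W => ?_
    have : homEval (c x + c y) 1 W = homEval (c x) 1 W + homEval (c y) 1 W := by
      simp [homEval, add_mul, Finset.sum_add_distrib]
    rw [this, hu, hu, hu, map_add, Pi.add_apply]
  · refine eq_of_homEval_one_eq fun W => ?_
    have : homEval (z • c x) 1 W = z * homEval (c x) 1 W := by
      simp [homEval, Finset.mul_sum, mul_assoc]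
    rw [RingHom.id_apply, this, hu, hu, map_smul, Pi.smul_apply, smul_eq_mul]

/-- A nonzero algebraic representation splits off a symmetric power. -/
theorem exists_splitting [FiniteDimensional ℂ V] [Nontrivial V] (hρ : IsAlgebraicRep ρ)
    {s : End ℂ V} (hs : s.IsSemisimple) (hcomm : ∀ g, Commute (ρ g) s) :
    ∃ (μ : ℂ) (k : ℕ) (Φ : V →ₗ[ℂ] (Fin (k + 1) → ℂ)) (W : Submodule ℂ V),
      (∀ g v, Φ (ρ g v) = symMat k g.1 *ᵥ Φ v) ∧ (∀ v, Φ (s v) = μ • Φ v) ∧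
      (∀ g, ∀ v ∈ W, ρ g v ∈ W) ∧ (∀ v ∈ W, s v ∈ W) ∧
      (∀ y, ∃ w ∈ W, Φ w = y) ∧ ∀ w ∈ W, Φ w = 0 → w = 0 := by
  obtain ⟨μ, k, f, v, hfv, hsv, hfs, hvt, hft, hup, hlow⟩ := exists_weight_vectors hρ hs hcomm
  -- Frobenius reciprocity: the matrix coefficients against `f` are homogeneous polynomials of
  -- degree `k` in the first row of `g`, and this maps `V` equivariantly to the symmetric power.
  let F : V →ₗ[ℂ] (SL(2, ℂ) → ℂ) := LinearMap.pi fun g => f ∘ₗ ρ g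
  obtain ⟨Φ, hΦ⟩ := exists_linearMap_homEval (F := F) (k := k) (fun x => hρ f x)
    (fun x y g => by
      change f (ρ (lower y * g) x) = f (ρ g x)
      rw [map_mul, End.mul_apply, hlow])
    (fun x a g => by
      change f (ρ (torus a * g) x) = _ * f (ρ g x)
      rw [map_mul, End.mul_apply, hft])
  have hΦ : ∀ x g, f (ρ g x) = homEval (Φ x) (g.1 0 0) (g.1 0 1) := hΦ
  have hupΦ : ∀ x W, homEval (Φ x) 1 W = f (ρ (upper W) x) := fun x W => by
    rw [hΦ]; simp [upper]
  -- The dual construction with `v`: transposition turns invariance under upper unipotents on the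
  -- right into invariance under lower ones on the left. It serves only to bound the dimension of
  -- `W`.
  let F' : Dual ℂ V →ₗ[ℂ] (SL(2, ℂ) → ℂ) :=
    LinearMap.pi fun g => Dual.eval ℂ V (ρ g.transpose v)
  have htr : ∀ g h : SL(2, ℂ), (g * h).transpose = h.transpose * g.transpose := fun g h =>
    Subtype.ext (Matrix.transpose_mul g.1 h.1)
  obtain ⟨Ψ, hΨ⟩ := exists_linearMap_homEval (F := F') (k := k) (fun ξ => (hρ ξ v).transpose)
    (fun ξ y g => by
      change ξ (ρ (lower y * g).transpose v) = ξ (ρ g.transpose v)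
      have : (lower y).transpose = upper y := by
        refine Subtype.ext ?_
        change (lower y).1.transpose = _
        rw [coe_lower, coe_upper]
        ext i j; fin_cases i <;> fin_cases j <;> rfl
      rw [htr, map_mul, End.mul_apply, this, hup])
    (fun ξ a g => by
      change ξ (ρ (torus a * g).transpose v) = _ * ξ (ρ g.transpose v)
      have : (torus a).transpose = torus a := by
        refine Subtype.ext ?_
        change (torus a).1.transpose = _
        rw [coe_torus]
        ext i j; fin_cases i <;> fin_cases j <;> rfl
      rw [htr, map_mul, End.mul_apply, this, hvt, map_smul, map_smul, smul_eq_mul])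
  let W : Submodule ℂ V := Submodule.span ℂ (Set.range fun g => ρ g v)
  have hW : ∀ g, ∀ x ∈ W, ρ g x ∈ W := by
    intro g x hx
    have : W ≤ W.comap (ρ g) := by
      refine Submodule.span_le.2 ?_
      rintro _ ⟨h, rfl⟩
      refine Submodule.subset_span ⟨g * h, ?_⟩
      simp
    exact this hx
  have hsW : ∀ x ∈ W, s x ∈ W := by
    intro x hx
    have : W ≤ W.comap s := by
      refine Submodule.span_le.2 ?_
      rintro _ ⟨h, rfl⟩
      have : s (ρ h v) = μ • ρ h v := by
        rw [← End.mul_apply, ← (hcomm h).eq, End.mul_apply, hsv, map_smul]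
      change s (ρ h v) ∈ W
      rw [this]
      exact W.smul_mem _ (Submodule.subset_span ⟨h, rfl⟩)
    exact this hx
  have hequi : ∀ g x, Φ (ρ g x) = symMat k g.1 *ᵥ Φ x := by
    intro g x
    refine eq_of_homEval_one_eq fun Y => ?_
    rw [hupΦ, homEval_symMat_mulVec, ← End.mul_apply, ← map_mul, hΦ,
      Matrix.SpecialLinearGroup.coe_mul, coe_upper]
    congr 1 <;> simp [Matrix.mul_apply, Fin.sum_univ_two, mul_comm]
  have hΦv : Φ v = powVec k 1 0 := by
    refine eq_of_homEval_one_eq fun Y => ?_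
    rw [hupΦ, hup, hfv, homEval_powVec]
    simp
  have hsurj : ∀ y, ∃ w ∈ W, Φ w = y := by
    suffices h : W.map Φ = ⊤ from fun y => (h ▸ Submodule.mem_top : y ∈ W.map Φ)
    by_contra hne
    obtain ⟨φ, hφ, hle⟩ := Submodule.exists_le_ker_of_lt_top _ (lt_top_iff_ne_top.2 hne)
    refine hφ (eq_zero_of_powVec_eq_zero fun y => hle ?_)
    refine ⟨ρ (lower y) v, Submodule.subset_span ⟨_, rfl⟩, ?_⟩
    rw [hequi, hΦv, symMat_lower_mulVec]
  -- The kernel of `Ψ` is the annihilator of `W`, so the dimension of `W` is the rank of `Ψ`. As `Φ`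
  -- maps `W` onto a space of dimension `k + 1`, it is injective there.
  have hdim : finrank ℂ W ≤ k + 1 := by
    have h1 : LinearMap.ker Ψ = W.dualAnnihilator := by
      ext ξ
      rw [LinearMap.mem_ker, Submodule.mem_dualAnnihilator]
      constructor
      · intro h x hx
        have : W ≤ LinearMap.ker ξ := by
          refine Submodule.span_le.2 ?_
          rintro _ ⟨g, rfl⟩
          have h2 := hΨ ξ g.transpose
          rw [h] at h2
          change ξ (ρ g v) = 0
          have h3 : F' ξ g.transpose = ξ (ρ g v) := rfl
          rw [← h3, h2]
          simp [homEval]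
        exact this hx
      · intro h
        refine eq_of_homEval_one_eq fun Y => ?_
        have h2 := hΨ ξ (upper Y)
        have h3 : F' ξ (upper Y) = 0 := h _ (Submodule.subset_span ⟨_, rfl⟩)
        rw [h3] at h2
        simp only [upper] at h2
        rw [show homEval (0 : Fin (k + 1) → ℂ) 1 Y = 0 by simp [homEval]]
        simpa using h2.symm
    have h2 := LinearMap.finrank_range_add_finrank_ker Ψ
    have h3 := Subspace.finrank_add_finrank_dualAnnihilator_eq W
    have h4 : finrank ℂ (LinearMap.range Ψ) ≤ k + 1 := by
      simpa using Submodule.finrank_le (LinearMap.range Ψ)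
    rw [h1, Subspace.dual_finrank_eq] at h2
    omega
  have hinj : ∀ w ∈ W, Φ w = 0 → w = 0 := by
    have h1 := LinearMap.finrank_range_add_finrank_ker (Φ.domRestrict W)
    have h2 : LinearMap.range (Φ.domRestrict W) = ⊤ := by
      refine (Submodule.eq_top_iff').2 fun y => ?_
      obtain ⟨w, hw, hw'⟩ := hsurj y
      exact ⟨⟨w, hw⟩, hw'⟩
    rw [h2, finrank_top, finrank_fin_fun] at h1
    have h3 : finrank ℂ (LinearMap.ker (Φ.domRestrict W)) = 0 := by omega
    have h4 := Submodule.finrank_eq_zero.1 h3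
    intro w hw hw0
    have : (⟨w, hw⟩ : W) ∈ LinearMap.ker (Φ.domRestrict W) := hw0
    rw [h4] at this
    exact congrArg Subtype.val ((Submodule.mem_bot ℂ).1 this)
  refine ⟨μ, k, Φ, W, hequi, fun x => ?_, hW, hsW, hsurj, hinj⟩
  refine eq_of_homEval_one_eq fun Y => ?_
  rw [hupΦ, ← End.mul_apply, (hcomm _).eq, End.mul_apply, hfs, ← hupΦ]
  simp [homEval, Finset.mul_sum, mul_assoc]

/-- The `k`-th symmetric power, together with the scalar operator `μ`. -/
def repModel (d : ℂ × ℕ) : Option SL(2, ℂ) → End ℂ (Fin (d.2 + 1) → ℂ)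
  | none => d.1 • 1
  | some g => Matrix.toLin' (symMat d.2 g.1)

/-- The family of operators consisting of a representation and a further operator. -/
def repFamily (ρ : SL(2, ℂ) →* End ℂ V) (s : End ℂ V) : Option SL(2, ℂ) → End ℂ V
  | none => s
  | some g => ρ g

/-- Complete reducibility. -/
theorem exists_isDecomposition_repFamily [FiniteDimensional ℂ V] (hρ : IsAlgebraicRep ρ)
    {s : End ℂ V} (hs : s.IsSemisimple) (hcomm : ∀ g, Commute (ρ g) s) :
    ∃ (I : Type) (_ : Fintype I) (d : I → ℂ × ℕ),
      IsDecomposition (dim := fun d => d.2 + 1) repModel (repFamily ρ s) d := by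
  refine exists_isDecomposition (dim := fun d : ℂ × ℕ => d.2 + 1)
    (fun V _ _ T => ∃ (ρ : SL(2, ℂ) →* End ℂ V) (s : End ℂ V), T = repFamily ρ s ∧
      IsAlgebraicRep ρ ∧ s.IsSemisimple ∧ ∀ g, Commute (ρ g) s) ?_ ?_ V _
    ⟨ρ, s, rfl, hρ, hs, hcomm⟩
  · rintro V _ _ _ ⟨ρ, s, rfl, hρ, hs, hcomm⟩ K hK
    have h1 : ∀ g, ∀ v ∈ K, ρ g v ∈ K := fun g => hK (some g)
    have h2 : ∀ v ∈ K, s v ∈ K := hK none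
    refine ⟨⟨⟨fun g => (ρ g).restrict (h1 g), ?_⟩, ?_⟩, s.restrict h2, ?_, ?_, ?_, ?_⟩
    · ext; simp
    · intro g h; ext; simp
    · ext a x; cases a <;> rfl
    · intro ξ x
      obtain ⟨ξ', hξ'⟩ := LinearMap.exists_extend ξ
      have := hρ ξ' x.1
      convert this using 2 with g
      rw [← hξ']
      rfl
    · exact hs.restrict h2
    · intro g
      ext x
      exact congrArg (fun t : End ℂ V => t x.1) (hcomm g).eq
  · rintro V _ _ _ _ _ ⟨ρ, s, rfl, hρ, hs, hcomm⟩
    obtain ⟨μ, k, Φ, W, h1, h2, h3, h4, h5, h6⟩ := exists_splitting hρ hs hcomm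
    refine ⟨(μ, k), Φ, W, Nat.succ_pos k, ?_, ?_, h5, h6⟩
    · intro a v
      cases a with
      | none => exact h2 v
      | some g => exact h1 g v
    · intro a
      cases a with
      | none => exact h4
      | some g => exact h3 g

end Splitting

/-! ### Conjugacy in classical groups -/

section SquareRoot

open Polynomial
open scoped Matrix

/-- Roots are added one at a time. If `p² - X = f h`, then `p + c f` works for a new root `a` once
`h + 2 c p + c² f` vanishes at `a`. This equation for `c` is quadratic if `f(a) ≠ 0`; otherwise it
is linear with slope `2 p(a)`, where `p(a)² = a ≠ 0`. -/
theorem exists_dvd_sq_sub_X (m : Multiset ℂ) (hm : 0 ∉ m) :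
    ∃ p : ℂ[X], (m.map fun a => X - C a).prod ∣ p ^ 2 - X := by
  induction m using Multiset.induction_on with
  | empty => exact ⟨0, by simp⟩
  | cons a m ih =>
    obtain ⟨p, h, hp⟩ := ih fun h => hm (Multiset.mem_cons_of_mem h)
    have ha : a ≠ 0 := fun h => hm (h ▸ Multiset.mem_cons_self a m)
    set f := (m.map fun a => X - C a).prod with hf
    obtain ⟨c, hc⟩ : ∃ c : ℂ, h.eval a + 2 * c * p.eval a + c ^ 2 * f.eval a = 0 := by
      by_cases hfa : f.eval a = 0
      · have hpa : p.eval a ≠ 0 := by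
          intro h0
          have := congrArg (eval a) hp
          simp [h0, hfa] at this
          exact ha this
        exact ⟨-h.eval a / (2 * p.eval a), by rw [hfa]; field_simp; ring⟩
      · obtain ⟨r, hr⟩ := IsAlgClosed.exists_pow_nat_eq
          (p.eval a ^ 2 - f.eval a * h.eval a) (n := 2) (by norm_num)
        refine ⟨(r - p.eval a) / f.eval a, ?_⟩
        field_simp
        linear_combination hr
    have hroot : (X - C a) ∣ h + 2 * C c * p + C c ^ 2 * f := by
      rw [dvd_iff_isRoot, IsRoot.def]
      simpa using hc
    obtain ⟨t, ht⟩ := hroot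
    refine ⟨p + C c * f, t, ?_⟩
    rw [Multiset.map_cons, Multiset.prod_cons, ← hf]
    linear_combination hp + f * ht

variable {ι : Type*} [Fintype ι] [DecidableEq ι]

/-- By Cayley–Hamilton a square root of `X` modulo the characteristic polynomial suffices. A square
root that is polynomial in `A` inherits self-adjointness and commutation relations from `A`. -/
theorem exists_aeval_sq_eq {A : Matrix ι ι ℂ} (hA : IsUnit A) : ∃ p : ℂ[X], (aeval A p) ^ 2 = A := by
  have h0 : (0 : ℂ) ∉ A.charpoly.roots := by
    intro h
    have h1 := (mem_roots'.1 h).2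
    rw [IsRoot.def, Matrix.eval_charpoly] at h1
    simp only [map_zero, zero_sub, Matrix.det_neg] at h1
    have h2 := (Matrix.isUnit_iff_isUnit_det A).1 hA
    exact h2.ne_zero ((mul_eq_zero.1 h1).resolve_left (pow_ne_zero _ (by norm_num)))
  obtain ⟨p, q, hp⟩ := exists_dvd_sq_sub_X _ h0
  rw [← (IsAlgClosed.splits A.charpoly).eq_prod_roots_of_monic A.charpoly_monic] at hp
  refine ⟨p, ?_⟩
  have := congrArg (aeval A) hp
  rw [map_mul, Matrix.aeval_self_charpoly, zero_mul, map_sub, map_pow, aeval_X] at this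
  exact sub_eq_zero.1 this

theorem semiconjBy_aeval {A B J : Matrix ι ι ℂ} (h : J * A = B * J) (p : ℂ[X]) :
    J * aeval A p = aeval B p * J := by
  induction p using Polynomial.induction_on' with
  | add p q hp hq => rw [map_add, map_add, mul_add, add_mul, hp, hq]
  | monomial n c =>
    have h1 : J * A ^ n = B ^ n * J := (SemiconjBy.pow_right h n).eq
    simp only [aeval_monomial, Algebra.algebraMap_eq_smul_one, smul_mul_assoc, one_mul,
      mul_smul_comm, h1]

theorem transpose_aeval (A : Matrix ι ι ℂ) (p : ℂ[X]) : (aeval A p)ᵀ = aeval Aᵀ p := by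
  induction p using Polynomial.induction_on' with
  | add p q hp hq => rw [map_add, map_add, Matrix.transpose_add, hp, hq]
  | monomial n c =>
    simp only [aeval_monomial, Algebra.algebraMap_eq_smul_one, smul_mul_assoc, one_mul,
      Matrix.transpose_smul, Matrix.transpose_pow]

/-- Two nondegenerate bilinear forms of the same symmetry are equivalent, by an equivalence that
commutes with all common isometries. -/
theorem exists_equivalence_of_forms {J J' : Matrix ι ι ℂ} (hJ : IsUnit J) (hJ' : IsUnit J')
    {ε : ℂ} (hε : ε * ε = 1) (hJε : Jᵀ = ε • J) (hJε' : J'ᵀ = ε • J') :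
    ∃ P : Matrix ι ι ℂ, IsUnit P ∧ Pᵀ * J * P = J' ∧
      ∀ g : Matrix ι ι ℂ, gᵀ * J * g = J → gᵀ * J' * g = J' → Commute P g := by
  have hJd := (Matrix.isUnit_iff_isUnit_det J).1 hJ
  -- `A` is self-adjoint for `J` and commutes with all common isometries, hence so does its
  -- polynomial square root `P`, and `Pᵀ J P = J P² = J A = J'`.
  set A := J⁻¹ * J' with hA
  have hJA : J * A = J' := by rw [hA, Matrix.mul_nonsing_inv_cancel_left _ _ hJd]
  have hAu : IsUnit A := by
    rw [hA]
    exact ((Matrix.isUnit_nonsing_inv_iff).2 hJ).mul hJ'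
  have hsemi : J * A = Aᵀ * J := by
    have h1 : Aᵀ * Jᵀ = J'ᵀ := by rw [← Matrix.transpose_mul, hJA]
    rw [hJε, hJε', mul_smul_comm] at h1
    have h2 := congrArg (ε • ·) h1
    simp only [smul_smul, hε, one_smul] at h2
    rw [h2, hJA]
  obtain ⟨p, hp⟩ := exists_aeval_sq_eq hAu
  refine ⟨aeval A p, ?_, ?_, fun g hg hg' => ?_⟩
  · exact (isUnit_pow_iff two_ne_zero).1 (by rw [hp]; exact hAu)
  · rw [transpose_aeval, ← semiconjBy_aeval hsemi, mul_assoc, ← sq, hp, hJA]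
  · have h1 : IsUnit (gᵀ * J) := by
      refine (IsUnit.of_mul_eq_one (g * J⁻¹) ?_)
      rw [← mul_assoc, hg, Matrix.mul_nonsing_inv _ hJd]
    have h2 : gᵀ * J * (g * A) = gᵀ * J * (A * g) := by
      rw [← mul_assoc, hg, hJA, mul_assoc gᵀ, ← mul_assoc J, hJA, ← mul_assoc, hg']
    have h3 : g * A = A * g := h1.mul_left_cancel h2
    exact (semiconjBy_aeval h3 p).symm

/-- Families of isometries that are conjugate are conjugate by an isometry. -/
theorem exists_isometry_conj {S : Type*} {J : Matrix ι ι ℂ} (hJ : IsUnit J)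
    {ε : ℂ} (hε : ε * ε = 1) (hJε : Jᵀ = ε • J) {φ φ' : S → Matrix ι ι ℂ}
    (hφ : ∀ a, (φ a)ᵀ * J * φ a = J) (hφ' : ∀ a, (φ' a)ᵀ * J * φ' a = J)
    {h : Matrix ι ι ℂ} (hh : IsUnit h) (hconj : ∀ a, h * φ a = φ' a * h) :
    ∃ k : Matrix ι ι ℂ, kᵀ * J * k = J ∧ ∀ a, k * φ a = φ' a * k := by
  have hht : IsUnit hᵀ := (Matrix.isUnit_transpose h).2 hh
  -- Every `φ a` preserves both `J` and the form `hᵀ J h`, so `P` commutes with it. Hence `h * P⁻¹`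
  -- conjugates as `h` does and is moreover an isometry.
  obtain ⟨P, hPu, hP, hPc⟩ := exists_equivalence_of_forms (J' := hᵀ * J * h) hJ
    ((hht.mul hJ).mul hh) hε hJε (by
      rw [Matrix.transpose_mul, Matrix.transpose_mul, Matrix.transpose_transpose, hJε,
        smul_mul_assoc, mul_smul_comm, mul_assoc])
  have hPd := (Matrix.isUnit_iff_isUnit_det P).1 hPu
  refine ⟨h * P⁻¹, ?_, fun a => ?_⟩
  · have h1 : (P⁻¹)ᵀ * Pᵀ = 1 := by
      rw [← Matrix.transpose_mul, Matrix.mul_nonsing_inv _ hPd, Matrix.transpose_one]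
    calc (h * P⁻¹)ᵀ * J * (h * P⁻¹) = (P⁻¹)ᵀ * (hᵀ * J * h) * P⁻¹ := by
          rw [Matrix.transpose_mul]; simp only [mul_assoc]
      _ = ((P⁻¹)ᵀ * Pᵀ) * J * (P * P⁻¹) := by rw [← hP]; simp only [mul_assoc]
      _ = J := by rw [h1, Matrix.mul_nonsing_inv _ hPd, one_mul, mul_one]
  · have hc : Commute P (φ a) := by
      refine hPc _ (hφ a) ?_
      calc (φ a)ᵀ * (hᵀ * J * h) * φ a = (h * φ a)ᵀ * J * (h * φ a) := by
            rw [Matrix.transpose_mul]; simp only [mul_assoc]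
        _ = hᵀ * ((φ' a)ᵀ * J * φ' a) * h := by
            rw [hconj, Matrix.transpose_mul]; simp only [mul_assoc]
        _ = hᵀ * J * h := by rw [hφ']
    have hc' : P⁻¹ * φ a = φ a * P⁻¹ := by
      have h1 : P * (P⁻¹ * φ a) = P * (φ a * P⁻¹) := by
        rw [← mul_assoc, ← mul_assoc, hc.eq, Matrix.mul_nonsing_inv _ hPd, one_mul, mul_assoc,
          Matrix.mul_nonsing_inv _ hPd, mul_one]
      exact hPu.mul_left_cancel h1
    rw [mul_assoc, hc', ← mul_assoc, hconj, mul_assoc]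

end SquareRoot

/-! ### From conjugacy in the general linear group to conjugacy in a classical group. -/

section ClassicalGroup

open scoped Matrix

variable {ι : Type*} [Fintype ι] [DecidableEq ι]

/-- The sign of the invariant form of a classical group in `N` dimensions. -/
def formSign (N : ℕ) : ℂ := (-1) ^ (N + 1)

theorem formSign_mul_self (N : ℕ) : formSign N * formSign N = 1 := by
  rw [formSign, ← pow_add, ← two_mul, pow_mul]; simp

/-- `H` is, up to sign, the isometry group of the form `J`, which is symmetric in odd dimensions and
alternating in even dimensions. -/
structure IsClassicalGroup (H : Submonoid (Matrix ι ι ℂ)) (J : Matrix ι ι ℂ) : Prop where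
  isUnit : IsUnit J
  transpose_eq : Jᵀ = formSign (Fintype.card ι) • J
  isometry : ∀ g ∈ H, gᵀ * J * g = J
  mem_or_neg_mem : ∀ g, gᵀ * J * g = J → g ∈ H ∨ -g ∈ H

variable {H : Submonoid (Matrix ι ι ℂ)} {J : Matrix ι ι ℂ}

/-- The sign ambiguity disappears on squares. Since `SL₂ × SL₂` is generated by squares, its
isometric actions have image in `H`. -/
theorem IsClassicalGroup.mul_self_mem (hH : IsClassicalGroup H J) {g : Matrix ι ι ℂ} (hg : gᵀ * J * g = J) : g * g ∈ H := by
  rcases hH.mem_or_neg_mem g hg with h | h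
  · exact H.mul_mem h h
  · simpa using H.mul_mem h h

theorem IsClassicalGroup.exists_unit (hH : IsClassicalGroup H J) {g : Matrix ι ι ℂ} (hg : g ∈ H) :
    ∃ u : Hˣ, ((u : H) : Matrix ι ι ℂ) = g := by
  have hJd := (Matrix.isUnit_iff_isUnit_det J).1 hH.isUnit
  have h1 := hH.isometry g hg
  have hl : J⁻¹ * gᵀ * J * g = 1 := by
    rw [mul_assoc J⁻¹, mul_assoc J⁻¹, h1, Matrix.nonsing_inv_mul _ hJd]
  have hr : g * (J⁻¹ * gᵀ * J) = 1 := mul_eq_one_comm.1 hl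
  generalize J⁻¹ * gᵀ * J = k at hl hr
  have hkiso : kᵀ * J * k = J := by
    calc kᵀ * J * k = kᵀ * (gᵀ * J * g) * k := by rw [h1]
      _ = (g * k)ᵀ * J * (g * k) := by rw [Matrix.transpose_mul]; simp only [mul_assoc]
      _ = J := by rw [hr]; simp
  have hkH : k ∈ H := by
    rcases hH.mem_or_neg_mem k hkiso with h | h
    · exact h
    -- Here `g * -k = -1` lies in `H`, and so does `-1 * -k = k`.
    · have h2 := H.mul_mem hg h
      rw [mul_neg, hr] at h2
      simpa using H.mul_mem h2 h
  exact ⟨⟨⟨g, hg⟩, ⟨k, hkH⟩, Subtype.ext hr, Subtype.ext hl⟩, rfl⟩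

/-- Families of elements of a classical group that are conjugate in the general linear group are
conjugate in the classical group. -/
theorem IsClassicalGroup.exists_unit_semiconjBy (hH : IsClassicalGroup H J) {S : Type*} {φ φ' : S → H} {h : Matrix ι ι ℂ}
    (hh : IsUnit h) (hconj : ∀ a, h * φ a = φ' a * h) :
    ∃ u : Hˣ, ∀ a, SemiconjBy (u : H) (φ a) (φ' a) := by
  obtain ⟨k, hk, hkc⟩ := exists_isometry_conj (φ := fun a => (φ a : Matrix ι ι ℂ))
    (φ' := fun a => (φ' a : Matrix ι ι ℂ)) hH.isUnit
    (formSign_mul_self _) hH.transpose_eq (fun a => hH.isometry _ (φ a).2)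
    (fun a => hH.isometry _ (φ' a).2) hh hconj
  -- Conjugation by `k` and by `-k` is the same.
  rcases hH.mem_or_neg_mem k hk with h | h
  · obtain ⟨u, hu⟩ := hH.exists_unit h
    exact ⟨u, fun a => Subtype.ext (by simpa [hu] using hkc a)⟩
  · obtain ⟨u, hu⟩ := hH.exists_unit h
    exact ⟨u, fun a => Subtype.ext (by simpa [hu] using hkc a)⟩

theorem IsClassicalGroup.homClass_eq (hH : IsClassicalGroup H J) {A : Type*} [Monoid A] {φ φ' : A →* H} {h : Matrix ι ι ℂ}
    (hh : IsUnit h) (hconj : ∀ a, h * φ a = φ' a * h) : HomClass.mk φ = HomClass.mk φ' :=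
  Quotient.sound (s := conjSetoid A H) (hH.exists_unit_semiconjBy hh hconj)

theorem IsClassicalGroup.conjClasses_eq (hH : IsClassicalGroup H J) {g g' : H} {h : Matrix ι ι ℂ}
    (hh : IsUnit h) (hconj : h * g = g' * h) : ConjClasses.mk g = ConjClasses.mk g' := by
  obtain ⟨u, hu⟩ := hH.exists_unit_semiconjBy (S := Unit) (φ := fun _ => g) (φ' := fun _ => g') hh
    fun _ => hconj
  exact ConjClasses.mk_eq_mk_iff_isConj.2 ⟨u, hu ()⟩

end ClassicalGroup

/-! ### Symplectic and odd special orthogonal groups. -/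

section DualGroup

open scoped Matrix

theorem isClassicalGroup_symplecticGroup (n : ℕ) :
    IsClassicalGroup (Matrix.symplecticGroup (Fin n) ℂ) (Matrix.J (Fin n) ℂ) where
  isUnit := (Matrix.isUnit_iff_isUnit_det _).2 (Matrix.isUnit_det_J _ _)
  transpose_eq := by
    rw [Matrix.J_transpose, formSign, Fintype.card_sum, ← two_mul, pow_succ, pow_mul]
    simp
  isometry g hg := SymplecticGroup.mem_iff'.1 hg
  mem_or_neg_mem g hg := Or.inl (SymplecticGroup.mem_iff'.2 hg)

theorem isClassicalGroup_specialOrthogonalGroup (n : ℕ) :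
    IsClassicalGroup (Matrix.specialOrthogonalGroup (Fin (2 * n + 1)) ℂ) 1 where
  isUnit := isUnit_one
  transpose_eq := by
    rw [Matrix.transpose_one, formSign, Fintype.card_fin, add_assoc, pow_add, pow_mul]
    simp
  isometry g hg := by
    rw [mul_one]
    exact (Matrix.mem_orthogonalGroup_iff' _ _).1 (Matrix.mem_specialOrthogonalGroup_iff.1 hg).1
  mem_or_neg_mem g hg := by
    rw [mul_one] at hg
    have hd : g.det * g.det = 1 := by
      have := congrArg Matrix.det hg
      rwa [Matrix.det_mul, Matrix.det_transpose, Matrix.det_one] at this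
    rcases mul_self_eq_one_iff.1 hd with h | h
    · exact Or.inl (Matrix.mem_specialOrthogonalGroup_iff.2
        ⟨(Matrix.mem_orthogonalGroup_iff' _ _).2 hg, h⟩)
    · refine Or.inr (Matrix.mem_specialOrthogonalGroup_iff.2
        ⟨(Matrix.mem_orthogonalGroup_iff' _ _).2 ?_, ?_⟩)
      · change (-g)ᵀ * -g = 1
        rw [Matrix.transpose_neg, neg_mul_neg, hg]
      · rw [Matrix.det_neg, h, Fintype.card_fin, pow_succ, pow_mul]
        simp

theorem exists_isClassicalGroup_dual (G : SplitGroup) : ∃ J, IsClassicalGroup G.dual J := by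
  cases G with
  | oddOrthogonal n => exact ⟨_, isClassicalGroup_symplecticGroup n⟩
  | symplectic n => exact ⟨_, isClassicalGroup_specialOrthogonalGroup n⟩

end DualGroup

/-! ### Jordan types of nilpotent operators -/

section Jordan

open Module

/-- The nilpotent Jordan block of size `k + 1`. -/
def shiftModel (k : ℕ) : Unit → End ℂ (Fin (k + 1) → ℂ) := fun _ =>
  { toFun := fun x i => if h : (i : ℕ) + 1 < k + 1 then x ⟨i + 1, h⟩ else 0
    map_add' := fun x y => by ext i; simp only [Pi.add_apply]; split_ifs <;> simp
    map_smul' := fun c x => by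
      ext i; simp only [Pi.smul_apply, smul_eq_mul, RingHom.id_apply]; split_ifs <;> simp }

theorem shiftModel_apply (k : ℕ) (x : Fin (k + 1) → ℂ) (i : Fin (k + 1)) :
    shiftModel k () x i = if h : (i : ℕ) + 1 < k + 1 then x ⟨i + 1, h⟩ else 0 := rfl

theorem shiftModel_pow_apply (k m : ℕ) (x : Fin (k + 1) → ℂ) (i : Fin (k + 1)) :
    (shiftModel k () ^ m) x i = if h : (i : ℕ) + m < k + 1 then x ⟨i + m, h⟩ else 0 := by
  induction m generalizing x with
  | zero => simp [i.isLt]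
  | succ m ih =>
    rw [pow_succ, End.mul_apply, ih]
    by_cases h : (i : ℕ) + m < k + 1
    · rw [dif_pos h, shiftModel_apply]
      by_cases h' : (i : ℕ) + (m + 1) < k + 1
      · rw [dif_pos h', dif_pos (by simpa [add_assoc] using h')]
        rfl
      · rw [dif_neg h', dif_neg (by simpa [add_assoc] using h')]
    · rw [dif_neg h, dif_neg (by omega)]

/-- As `M ^ k ≠ 0`, the kernels of the powers grow strictly up to the power `k + 1`; in dimension `k
+ 1` each growth is by exactly one. -/
theorem finrank_ker_pow_eq_min {V : Type*} [AddCommGroup V] [Module ℂ V] [FiniteDimensional ℂ V]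
    {M : End ℂ V} {k : ℕ} (hM : IsNilpotent M) (hk : M ^ k ≠ 0) (hd : finrank ℂ V = k + 1)
    (m : ℕ) : finrank ℂ (LinearMap.ker (M ^ m)) = min m (k + 1) := by
  have hlt : ∀ m, m ≤ k → finrank ℂ (LinearMap.ker (M ^ m)) <
      finrank ℂ (LinearMap.ker (M ^ (m + 1))) := by
    intro m hm
    have hle : LinearMap.ker (M ^ m) ≤ LinearMap.ker (M ^ (m + 1)) := by
      intro x hx
      rw [LinearMap.mem_ker] at hx ⊢
      rw [pow_succ', End.mul_apply, hx, map_zero]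
    refine Submodule.finrank_lt_finrank_of_lt (lt_of_le_of_ne hle fun h => hk ?_)
    obtain ⟨r, hr⟩ := hM
    have h2 := Module.End.ker_pow_constant h (k - m + r)
    have h3 := Module.End.ker_pow_constant h (k - m)
    rw [show m + (k - m + r) = k + r by omega, pow_add, hr, mul_zero, LinearMap.ker_zero] at h2
    rw [show m + (k - m) = k by omega, h2] at h3
    exact LinearMap.ker_eq_top.1 h3.symm
  have hge : ∀ m, m ≤ k + 1 → m ≤ finrank ℂ (LinearMap.ker (M ^ m)) := by
    intro m
    induction m with
    | zero => simp
    | succ m ih => intro h; have := ih (by omega); have := hlt m (by omega); omega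
  have htop : ∀ m, k + 1 ≤ m → finrank ℂ (LinearMap.ker (M ^ m)) = k + 1 := by
    intro m hm
    have h1 := hge (k + 1) le_rfl
    have h2 : LinearMap.ker (M ^ (k + 1)) ≤ LinearMap.ker (M ^ m) := by
      intro x hx
      rw [LinearMap.mem_ker] at hx ⊢
      rw [← Nat.sub_add_cancel hm, pow_add, End.mul_apply, hx, map_zero]
    have h3 := Submodule.finrank_mono h2
    have h4 := Submodule.finrank_le (LinearMap.ker (M ^ m))
    omega
  have hle : ∀ j, j ≤ k + 1 → finrank ℂ (LinearMap.ker (M ^ (k + 1 - j))) ≤ k + 1 - j := by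
    intro j
    induction j with
    | zero => intro _; exact (htop _ le_rfl).le
    | succ j ih =>
      intro h
      have h1 := ih (by omega)
      have h2 := hlt (k + 1 - (j + 1)) (by omega)
      rw [show k + 1 - (j + 1) + 1 = k + 1 - j by omega] at h2
      omega
  rcases le_total m (k + 1) with h | h
  · have h1 := hle (k + 1 - m) (by omega)
    rw [show k + 1 - (k + 1 - m) = m by omega] at h1
    rw [min_eq_left h]
    exact le_antisymm h1 (hge m h)
  · rw [min_eq_right h, htop m h]

theorem finrank_ker_shiftModel_pow (k m : ℕ) :
    finrank ℂ (LinearMap.ker (shiftModel k () ^ m)) = min m (k + 1) := by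
  refine finrank_ker_pow_eq_min ⟨k + 1, ?_⟩ ?_ (by simp) m
  · refine LinearMap.ext fun x => funext fun i => ?_
    rw [shiftModel_pow_apply, dif_neg (by omega)]
    rfl
  · intro h
    have := congrArg (fun T : End ℂ (Fin (k + 1) → ℂ) => T (fun _ => 1) 0) h
    simp [shiftModel_pow_apply] at this

/-- A block of maximal size is split off. Take `v` and a functional `f` with `f (N ^ n v) ≠ 0`,
where `n + 1` is the nilpotency class; then `x ↦ (f (N ^ i x))` is injective on the span of the `N ^
i v`. -/
theorem exists_isDecomposition_shiftModel {V : Type} [AddCommGroup V] [Module ℂ V]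
    [FiniteDimensional ℂ V] {N : End ℂ V} (hN : IsNilpotent N) :
    ∃ (I : Type) (_ : Fintype I) (d : I → ℕ),
      IsDecomposition (dim := fun k => k + 1) shiftModel (fun _ => N) d := by
  refine exists_isDecomposition (dim := fun k => k + 1)
    (fun V _ _ T => IsNilpotent (T ())) ?_ ?_ V _ hN
  · rintro V _ _ T ⟨r, hr⟩ K hK
    refine ⟨r, LinearMap.ext fun x => Subtype.ext ?_⟩
    rw [Module.End.pow_restrict r]
    simp [hr]
  · rintro V _ _ _ _ T hT
    set N := T () with hNdef
    obtain ⟨n, hn⟩ : ∃ n, nilpotencyClass N = n + 1 :=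
      Nat.exists_eq_succ_of_ne_zero (pos_nilpotencyClass_iff.2 hT).ne'
    have hn1 : N ^ (n + 1) = 0 := hn ▸ pow_nilpotencyClass hT
    have hn0 : N ^ n ≠ 0 := by
      have h := pow_pred_nilpotencyClass hT
      rwa [hn] at h
    obtain ⟨v, hv⟩ : ∃ v, (N ^ n) v ≠ 0 := by
      by_contra! h
      exact hn0 (LinearMap.ext h)
    obtain ⟨f, hf⟩ : ∃ f : Dual ℂ V, f ((N ^ n) v) ≠ 0 := by
      by_contra! h
      exact hv ((forall_dual_apply_eq_zero_iff ℂ _).1 h)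
    let Φ : V →ₗ[ℂ] (Fin (n + 1) → ℂ) := LinearMap.pi fun i => f ∘ₗ (N ^ (i : ℕ))
    have hΦ : ∀ x i, Φ x i = f ((N ^ (i : ℕ)) x) := fun x i => rfl
    let W : Submodule ℂ V := Submodule.span ℂ (Set.range fun i : Fin (n + 1) => (N ^ (i : ℕ)) v)
    have hmem : ∀ j, (N ^ j) v ∈ W := by
      intro j
      by_cases hj : j < n + 1
      · exact Submodule.subset_span ⟨⟨j, hj⟩, rfl⟩
      · rw [← Nat.sub_add_cancel (not_lt.1 hj), pow_add, hn1, mul_zero]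
        exact W.zero_mem
    have hzero : ∀ c : Fin (n + 1) → ℂ, Φ (∑ i, c i • (N ^ (i : ℕ)) v) = 0 → ∀ i, c i = 0 := by
      intro c hc
      by_contra! h
      obtain ⟨i, hi⟩ := h
      obtain ⟨i₀, hi₀, hmin⟩ := WellFounded.has_min (wellFounded_lt (α := Fin (n + 1)))
        {i | c i ≠ 0} ⟨i, hi⟩
      -- With `i₀` the least index such that `c i₀ ≠ 0`, this coordinate equals `c i₀ * f (N ^ n
      -- v)`, the later terms vanishing by `N ^ (n + 1) = 0`.
      have h1 := congrFun hc ⟨n - i₀, by omega⟩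
      rw [hΦ] at h1
      simp only [map_sum, map_smul, ← End.mul_apply, ← pow_add, Pi.zero_apply] at h1
      rw [Finset.sum_eq_single i₀] at h1
      · rw [show n - (i₀ : ℕ) + i₀ = n by omega] at h1
        exact (smul_ne_zero hi₀ hf) h1
      · intro j _ hj
        rcases lt_or_gt_of_ne hj with h2 | h2
        · have : c j = 0 := by
            by_contra h3
            exact hmin j h3 h2
          rw [this, zero_smul]
        · have h3 : (i₀ : ℕ) < j := h2
          rw [show n - (i₀ : ℕ) + j = (n + 1) + (j - i₀ - 1) by omega, pow_add, hn1, zero_mul]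
          simp
      · simp
    have hinj : ∀ w ∈ W, Φ w = 0 → w = 0 := by
      intro w hw hw0
      obtain ⟨c, rfl⟩ := (Submodule.mem_span_range_iff_exists_fun ℂ).1 hw
      simp [hzero c hw0]
    have hW : ∀ x ∈ W, N x ∈ W := by
      intro x hx
      have : W ≤ W.comap N := Submodule.span_le.2 (by
        rintro _ ⟨i, rfl⟩
        simp only [Submodule.comap_coe, Set.mem_preimage, SetLike.mem_coe]
        rw [← End.mul_apply, ← pow_succ']
        exact hmem _)
      exact this hx
    have hdim : finrank ℂ W = n + 1 := by
      refine (finrank_span_eq_card ?_).trans (by simp)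
      rw [Fintype.linearIndependent_iff]
      exact fun c hc => hzero c (by rw [hc, map_zero])
    refine ⟨n, Φ, W, Nat.succ_pos n, ?_, fun _ => hW, ?_, hinj⟩
    · intro a v
      ext i
      rw [shiftModel_apply, hΦ]
      split_ifs with h
      · rw [hΦ, pow_succ]; rfl
      · rw [show (T a) v = N v from rfl, ← End.mul_apply, ← pow_succ,
          show (i : ℕ) + 1 = n + 1 by omega, hn1]
        simp
    · have h1 : Function.Injective (Φ.domRestrict W) :=
        (injective_iff_map_eq_zero _).2 fun w hw => Subtype.ext (hinj w.1 w.2 hw)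
      have h2 := (LinearMap.injective_iff_surjective_of_finrank_eq_finrank
        (f := Φ.domRestrict W) (by rw [hdim]; simp)).1 h1
      intro y
      obtain ⟨w, hw⟩ := h2 y
      exact ⟨w.1, w.2, hw⟩

theorem IsDecomposition.finrank_ker_pow {V : Type} [AddCommGroup V] [Module ℂ V]
    {N : End ℂ V} {I : Type} [Fintype I] {d : I → ℕ}
    (h : IsDecomposition (dim := fun k => k + 1) shiftModel (fun _ => N) d) (m : ℕ) :
    finrank ℂ (LinearMap.ker (N ^ m)) = ∑ i, min m (d i + 1) := by
  obtain ⟨e, he⟩ := h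
  rw [finrank_ker_eq_sum e (N ^ m) (fun i => shiftModel (d i) () ^ m)]
  · exact Finset.sum_congr rfl fun i _ => finrank_ker_shiftModel_pow _ _
  · intro v i
    induction m generalizing v with
    | zero => rfl
    | succ m ih => rw [pow_succ, End.mul_apply, ih, he () v, pow_succ, End.mul_apply]

/-- The second difference of `c ↦ min c s` is supported at `c = s`. Jordan multiplicities are
recovered from kernel dimensions in this way. -/
theorem card_add_sum_min {I : Type*} [Fintype I] (s : I → ℕ) (c : ℕ) :
    Nat.card {i // s i = c + 1} + (∑ i, min c (s i) + ∑ i, min (c + 2) (s i)) =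
      2 * ∑ i, min (c + 1) (s i) := by
  classical
  rw [Nat.card_eq_fintype_card, Fintype.card_subtype, Finset.card_filter, ← Finset.sum_add_distrib,
    ← Finset.sum_add_distrib, Finset.mul_sum]
  refine Finset.sum_congr rfl fun i _ => ?_
  split_ifs <;> omega

theorem exists_conj_of_finrank_ker_pow_eq {V : Type} [AddCommGroup V] [Module ℂ V]
    [FiniteDimensional ℂ V] {A B : End ℂ V} (hA : IsNilpotent A) (hB : IsNilpotent B)
    (h : ∀ m, finrank ℂ (LinearMap.ker (A ^ m)) = finrank ℂ (LinearMap.ker (B ^ m))) :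
    ∃ e : V ≃ₗ[ℂ] V, ∀ v, e (A v) = B (e v) := by
  obtain ⟨I, _, d, hd⟩ := exists_isDecomposition_shiftModel hA
  obtain ⟨I', _, d', hd'⟩ := exists_isDecomposition_shiftModel hB
  obtain ⟨e, he⟩ := hd.exists_equiv hd' fun c => by
    have h1 := card_add_sum_min (fun i => d i + 1) c
    have h2 := card_add_sum_min (fun i => d' i + 1) c
    simp only [← hd.finrank_ker_pow, ← hd'.finrank_ker_pow, h, add_left_inj] at h1 h2
    omega
  exact ⟨e, he ()⟩

end Jordan

/-! ### Ranks of powers and Jordan multiplicities of matrices. -/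

section JordanMatrix

open Module

theorem rank_add_finrank_ker {ι : Type*} [Fintype ι] [DecidableEq ι] (A : Matrix ι ι ℂ) (m : ℕ) :
    (A ^ m).rank + finrank ℂ (LinearMap.ker (Matrix.toLin' A ^ m)) = Fintype.card ι := by
  rw [← Matrix.toLin'_pow, Matrix.rank, ← Matrix.toLin'_apply', LinearMap.finrank_range_add_finrank_ker]
  simp

theorem sum_min_add_sum_tsub {I : Type*} [Fintype I] (s : I → ℕ) (m : ℕ) :
    ∑ i, min m (s i) + ∑ i, (s i - m) = ∑ i, s i := by
  rw [← Finset.sum_add_distrib]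
  exact Finset.sum_congr rfl fun i _ => by omega

theorem isNilpotent_toLin' {ι : Type*} [Fintype ι] [DecidableEq ι] {A : Matrix ι ι ℂ}
    (hA : IsNilpotent A) : IsNilpotent (Matrix.toLin' A) := by
  obtain ⟨r, hr⟩ := hA
  exact ⟨r, by rw [← Matrix.toLin'_pow, hr, map_zero]⟩

variable {ι : Type} [Fintype ι] [DecidableEq ι]

theorem exists_conj_of_rank_pow_eq {A B : Matrix ι ι ℂ} (hA : IsNilpotent A) (hB : IsNilpotent B)
    (h : ∀ m, (A ^ m).rank = (B ^ m).rank) : ∃ k : Matrix ι ι ℂ, IsUnit k ∧ k * A = B * k := by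
  obtain ⟨e, he⟩ := exists_conj_of_finrank_ker_pow_eq (isNilpotent_toLin' hA)
    (isNilpotent_toLin' hB) fun m => by
      have h1 := rank_add_finrank_ker A m
      have h2 := rank_add_finrank_ker B m
      have h3 := h m
      omega
  refine ⟨LinearMap.toMatrix' e.toLinearMap, ?_, ?_⟩
  · refine IsUnit.of_mul_eq_one (LinearMap.toMatrix' e.symm.toLinearMap) ?_
    rw [← LinearMap.toMatrix'_mul, ← LinearMap.toMatrix'_one]
    congr 1
    ext; simp
  · apply Matrix.toLin'.injective
    rw [Matrix.toLin'_mul, Matrix.toLin'_mul, Matrix.toLin'_toMatrix']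
    exact LinearMap.ext he

theorem exists_rank_pow_eq_sum {A : Matrix ι ι ℂ} (hA : IsNilpotent A) :
    ∃ (I : Type) (_ : Fintype I) (s : I → ℕ), (∀ i, 1 ≤ s i) ∧ ∑ i, s i = Fintype.card ι ∧
      ∀ m, (A ^ m).rank = ∑ i, (s i - m) := by
  obtain ⟨I, _, d, hd⟩ := exists_isDecomposition_shiftModel (isNilpotent_toLin' hA)
  have hsum : ∑ i, (d i + 1) = Fintype.card ι := by
    obtain ⟨r, hr⟩ := hA
    obtain ⟨e, he⟩ := hd
    have := e.finrank_eq
    rw [Module.finrank_fintype_fun_eq_card, Module.finrank_pi_fintype] at this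
    simpa using this.symm
  refine ⟨I, inferInstance, fun i => d i + 1, by simp, hsum, fun m => ?_⟩
  have h1 := rank_add_finrank_ker A m
  have h2 := sum_min_add_sum_tsub (fun i => d i + 1) m
  rw [hd.finrank_ker_pow] at h1
  simp only at h2 ⊢
  omega

theorem jordanMult_eq_card {ι : Type*} [Fintype ι] [DecidableEq ι] {u : Matrix ι ι ℂ} {I : Type*}
    [Fintype I] {s : I → ℕ}
    (h : ∀ m, ((u - 1) ^ m).rank = ∑ i, (s i - m)) {c : ℕ} (hc : 1 ≤ c) :
    jordanMult u c = Nat.card {i // s i = c} := by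
  obtain ⟨c, rfl⟩ := Nat.exists_eq_add_of_le' hc
  have h0 := card_add_sum_min s c
  have h1 := sum_min_add_sum_tsub s c
  have h2 := sum_min_add_sum_tsub s (c + 1)
  have h3 := sum_min_add_sum_tsub s (c + 2)
  rw [jordanMult, h, h, h, show c + 1 - 1 = c by omega, show c + 1 + 1 = c + 2 by omega]
  omega

theorem rank_pow_eq_sum_jordanMult {u : Matrix ι ι ℂ} (hu : IsNilpotent (u - 1)) (m : ℕ) :
    ((u - 1) ^ m).rank =
      ∑ c ∈ Finset.Icc 1 (Fintype.card ι), jordanMult u c * (c - m) := by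
  obtain ⟨I, _, s, hs, hsum, h⟩ := exists_rank_pow_eq_sum hu
  classical
  rw [h, ← Finset.sum_fiberwise_of_maps_to (s := Finset.univ) (g := s)
    (t := Finset.Icc 1 (Fintype.card ι))]
  · refine Finset.sum_congr rfl fun c hc => ?_
    rw [jordanMult_eq_card h (Finset.mem_Icc.1 hc).1, Nat.card_eq_fintype_card,
      Fintype.card_subtype, ← smul_eq_mul, ← Finset.sum_const]
    exact Finset.sum_congr rfl fun i hi => by rw [(Finset.mem_filter.1 hi).2]
  · intro i _
    rw [Finset.mem_Icc, ← hsum]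
    exact ⟨hs i, Finset.single_le_sum (fun _ _ => Nat.zero_le _) (Finset.mem_univ i)⟩

/-- The multiplicities of the Jordan blocks of a unipotent matrix, as second differences. -/
theorem jordanMult_add_two_mul {u : Matrix ι ι ℂ} (hu : IsNilpotent (u - 1)) {c : ℕ} (hc : 1 ≤ c) :
    jordanMult u c + 2 * ((u - 1) ^ c).rank =
      ((u - 1) ^ (c - 1)).rank + ((u - 1) ^ (c + 1)).rank := by
  obtain ⟨I, _, s, hs, hsum, h⟩ := exists_rank_pow_eq_sum hu
  rw [jordanMult_eq_card h hc]
  obtain ⟨c, rfl⟩ := Nat.exists_eq_add_of_le' hc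
  have h0 := card_add_sum_min s c
  have h1 := sum_min_add_sum_tsub s c
  have h2 := sum_min_add_sum_tsub s (c + 1)
  have h3 := sum_min_add_sum_tsub s (c + 2)
  rw [h, h, h, show c + 1 - 1 = c by omega, show c + 1 + 1 = c + 2 by omega]
  omega

theorem rank_pow_eq_zero {A : Matrix ι ι ℂ} (hA : IsNilpotent A) {m : ℕ}
    (hm : Fintype.card ι ≤ m) : (A ^ m).rank = 0 := by
  obtain ⟨I, _, s, hs, hsum, h⟩ := exists_rank_pow_eq_sum hA
  rw [h]
  refine Finset.sum_eq_zero fun i hi => ?_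
  have : s i ≤ ∑ i, s i := Finset.single_le_sum (fun _ _ => Nat.zero_le _) (Finset.mem_univ i)
  omega

end JordanMatrix

/-! ### Parity of the multiplicities of Jordan blocks -/

section Parity

open Module
open scoped Matrix

variable {ι : Type*} [Fintype ι] [DecidableEq ι]

/-- Restricted to a complement of the kernel the form is nondegenerate and still skew, and a skew
matrix of odd size has determinant zero. -/
theorem even_rank_of_transpose_eq_neg {A : Matrix ι ι ℂ} (hA : Aᵀ = -A) : Even A.rank := by
  obtain ⟨W, hW⟩ := (LinearMap.ker (Matrix.toLin' A)).exists_isCompl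
  set r := finrank ℂ W with hr
  have hrank : A.rank = r := by
    have h1 := Submodule.finrank_add_eq_of_isCompl hW
    have h2 := LinearMap.finrank_range_add_finrank_ker (Matrix.toLin' A)
    rw [Matrix.rank, ← Matrix.toLin'_apply']
    omega
  let b : Basis (Fin r) ℂ W := finBasis ℂ W
  let P : Matrix ι (Fin r) ℂ := Matrix.of fun i j => (b j).1 i
  have hP : ∀ x : Fin r → ℂ, P *ᵥ x = (∑ j, x j • b j : W).1 := by
    intro x
    ext i
    simp [P, Matrix.mulVec, dotProduct, mul_comm]
  have hdet : (Pᵀ * A * P).det ≠ 0 := by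
    intro h
    obtain ⟨x, hx, h0⟩ := Matrix.exists_mulVec_eq_zero_iff.2 h
    have h1 : ∀ w ∈ W, w ⬝ᵥ (A *ᵥ (P *ᵥ x)) = 0 := by
      intro w hw
      have hw' : w = P *ᵥ (b.repr ⟨w, hw⟩) := by
        rw [hP, b.sum_repr]
      rw [← Matrix.mulVec_mulVec, ← Matrix.mulVec_mulVec] at h0
      rw [hw', dotProduct_comm, Matrix.dotProduct_mulVec, ← Matrix.mulVec_transpose, h0,
        zero_dotProduct]
    have h2 : ∀ k, A *ᵥ k = 0 → k ⬝ᵥ (A *ᵥ (P *ᵥ x)) = 0 := by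
      intro k hk
      rw [Matrix.dotProduct_mulVec, ← Matrix.mulVec_transpose, hA, Matrix.neg_mulVec, hk]
      simp
    have h3 : A *ᵥ (P *ᵥ x) = 0 := by
      refine dotProduct_eq_zero _ fun y => ?_
      rw [dotProduct_comm]
      obtain ⟨k, hk, w, hw, rfl⟩ := Submodule.mem_sup.1
        ((hW.sup_eq_top ▸ Submodule.mem_top : y ∈ _ ⊔ W))
      rw [add_dotProduct, h1 w hw, h2 k hk, add_zero]
    have h4 : P *ᵥ x = 0 := by
      rw [hP] at h3 ⊢
      exact (Submodule.disjoint_def.1 hW.disjoint) _ h3 (Subtype.prop _)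
    rw [hP] at h4
    have h5 := (Fintype.linearIndependent_iff.1 b.linearIndependent) x (Subtype.ext h4)
    exact hx (funext h5)
  have hskew : (Pᵀ * A * P)ᵀ = -(Pᵀ * A * P) := by
    rw [Matrix.transpose_mul, Matrix.transpose_mul, hA]; simp [Matrix.mul_assoc]
  rw [hrank]
  by_contra hodd
  rw [Nat.not_even_iff_odd] at hodd
  have h1 := congrArg Matrix.det hskew
  rw [Matrix.det_transpose, Matrix.det_neg, Fintype.card_fin, hodd.neg_one_pow] at h1
  exact hdet (by linear_combination (1 / 2 : ℂ) * h1)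

/-- The operator `u - u⁻¹` is skew-adjoint for `J`, so `J (u - u⁻¹) ^ k` is skew under the sign
condition. It is `u - 1` times the invertible commuting factor `u⁻¹ (u + 1)`, so its powers have the
ranks of those of `u - 1`. -/
theorem even_rank_pow_of_isometry {J u : Matrix ι ι ℂ} (hJ : IsUnit J) {ε : ℂ} (hJε : Jᵀ = ε • J)
    (hu : uᵀ * J * u = J) (hn : IsNilpotent (u - 1)) {k : ℕ} (hk : (-1) ^ k * ε = -1) :
    Even ((u - 1) ^ k).rank := by
  have hJd := (Matrix.isUnit_iff_isUnit_det J).1 hJ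
  have huu : IsUnit u := by
    have := hn.isUnit_add_one
    simpa using this
  have hud := (Matrix.isUnit_iff_isUnit_det u).1 huu
  have hplus : IsUnit (u + 1) := by
    have h2 : IsUnit ((2 : ℂ) • (1 : Matrix ι ι ℂ)) :=
      (Matrix.isUnit_iff_isUnit_det _).2 (by simp)
    have h3 := hn.isUnit_add_left_of_commute h2 ((Commute.one_right _).smul_right _)
    rwa [two_smul, show 1 + 1 + (u - 1) = u + 1 by abel] at h3
  set X := u - u⁻¹ with hX
  have hJX : Xᵀ * J = -(J * X) := by
    have h1 : uᵀ * J = J * u⁻¹ := by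
      rw [← Matrix.mul_nonsing_inv_cancel_right u (uᵀ * J) hud, hu]
    have h2 : (u⁻¹)ᵀ * J = J * u := by
      have h3 : (u⁻¹)ᵀ * uᵀ = 1 := by
        rw [← Matrix.transpose_mul, Matrix.mul_nonsing_inv _ hud, Matrix.transpose_one]
      calc (u⁻¹)ᵀ * J = (u⁻¹)ᵀ * (uᵀ * J * u) := by rw [hu]
        _ = ((u⁻¹)ᵀ * uᵀ) * (J * u) := by simp only [mul_assoc]
        _ = J * u := by rw [h3, one_mul]
    rw [hX, Matrix.transpose_sub, sub_mul, h1, h2, mul_sub, neg_sub]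
  have hpow : ∀ j, (X ^ j)ᵀ * J = (-1 : ℂ) ^ j • (J * X ^ j) := by
    intro j
    induction j with
    | zero => simp
    | succ j ih =>
      rw [pow_succ' X, Matrix.transpose_mul, mul_assoc, hJX, mul_neg, ← mul_assoc, ih, pow_succ,
        smul_mul_assoc, mul_assoc, ← pow_succ, mul_neg_one, neg_smul,
        pow_succ' X]
  have hskew : (J * X ^ k)ᵀ = -(J * X ^ k) := by
    rw [Matrix.transpose_mul, hJε, mul_smul_comm, hpow, smul_smul, mul_comm, hk, neg_one_smul]
  have h1 := even_rank_of_transpose_eq_neg hskew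
  have hfac : X = (u⁻¹ * (u + 1)) * (u - 1) := by
    rw [hX, mul_assoc, show (u + 1) * (u - 1) = u * u - 1 by noncomm_ring, mul_sub, ← mul_assoc,
      Matrix.nonsing_inv_mul _ hud, one_mul, mul_one]
  have hc : Commute (u⁻¹ * (u + 1)) (u - 1) := by
    refine Commute.mul_left ?_ ?_
    · refine Commute.sub_right ?_ (Commute.one_right _)
      rw [Commute, SemiconjBy, Matrix.nonsing_inv_mul _ hud, Matrix.mul_nonsing_inv _ hud]
    · exact ((Commute.refl u).add_left (Commute.one_left u)).sub_right (Commute.one_right _)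
  have hunit : IsUnit (J * (u⁻¹ * (u + 1)) ^ k) :=
    hJ.mul (((Matrix.isUnit_nonsing_inv_iff.2 huu).mul hplus).pow k)
  rw [hfac, hc.mul_pow, ← mul_assoc, Matrix.rank_mul_eq_right_of_isUnit_det _ _
    ((Matrix.isUnit_iff_isUnit_det _).1 hunit)] at h1
  exact h1

/-- The multiplicity is a second difference of ranks, and for `c` of this parity the ranks of the
powers `c - 1` and `c + 1` are even. -/
theorem IsClassicalGroup.even_jordanMult {ι : Type} [Fintype ι] [DecidableEq ι]
    {H : Submonoid (Matrix ι ι ℂ)} {J : Matrix ι ι ℂ}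
    (hH : IsClassicalGroup H J) {u : Matrix ι ι ℂ} (hu : u ∈ H) (hn : IsNilpotent (u - 1)) {c : ℕ}
    (hc : 1 ≤ c) (hc' : ¬ c ≡ Fintype.card ι [MOD 2]) : Even (jordanMult u c) := by
  have h1 : ∀ k, Odd (Fintype.card ι + 1 + k) → Even ((u - 1) ^ k).rank := by
    intro k hk
    refine even_rank_pow_of_isometry hH.isUnit hH.transpose_eq (hH.isometry u hu) hn ?_
    rw [formSign, ← pow_add, add_comm]
    exact hk.neg_one_pow
  have h2 := jordanMult_add_two_mul hn hc
  rw [Nat.ModEq] at hc'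
  have h3 := h1 (c - 1) (by rw [Nat.odd_iff]; omega)
  have h4 := h1 (c + 1) (by rw [Nat.odd_iff]; omega)
  rw [Nat.even_iff] at *
  omega

end Parity

/-! ### Products of squares in `SL₂(ℂ)` and polynomial functions of two variables -/

section Squares

theorem upper_add (x y : ℂ) : upper (x + y) = upper x * upper y := by
  refine Subtype.ext ?_
  rw [Matrix.SpecialLinearGroup.coe_mul, coe_upper, coe_upper, coe_upper]
  simp [add_comm]

theorem lower_add (x y : ℂ) : lower (x + y) = lower x * lower y := by
  refine Subtype.ext ?_
  rw [Matrix.SpecialLinearGroup.coe_mul, coe_lower, coe_lower, coe_lower]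
  simp

theorem exists_torus_mul_self (a : ℂˣ) : ∃ b : ℂˣ, b * b = a := by
  obtain ⟨b, hb⟩ := IsAlgClosed.exists_pow_nat_eq (a : ℂ) (n := 2) (by norm_num)
  have hb0 : b ≠ 0 := by
    rintro rfl
    exact a.ne_zero (by simpa using hb.symm)
  exact ⟨Units.mk0 b hb0, Units.ext (by simpa [sq] using hb)⟩

/-- Every upper, lower or diagonal element considered is a square, and these generate the big cell;
multiplication by `upper 1` moves any other element into that cell. -/
theorem mem_of_mul_self_mem {M : Submonoid SL(2, ℂ)} (h : ∀ g, g * g ∈ M) (g : SL(2, ℂ)) :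
    g ∈ M := by
  have hu : ∀ x, upper x ∈ M := fun x => by
    have := h (upper (x / 2))
    rwa [← upper_add, add_halves] at this
  have hl : ∀ x, lower x ∈ M := fun x => by
    have := h (lower (x / 2))
    rwa [← lower_add, add_halves] at this
  have ht : ∀ a, torus a ∈ M := fun a => by
    obtain ⟨b, rfl⟩ := exists_torus_mul_self a
    rw [torus_mul]
    exact h _
  have key : ∀ g : SL(2, ℂ), g.1 0 0 ≠ 0 → g ∈ M := fun g hg => by
    rw [lower_mul_torus_mul_upper (Units.mk0 _ hg) rfl]
    exact M.mul_mem (M.mul_mem (hl _) (ht _)) (hu _)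
  by_cases hg : g.1 0 0 = 0
  · have h1 : (upper 1 * g).1 0 0 ≠ 0 := by
      rw [Matrix.SpecialLinearGroup.coe_mul, coe_upper]
      have h2 := g.2
      rw [Matrix.det_fin_two, hg] at h2
      intro h3
      simp [Matrix.mul_apply, Fin.sum_univ_two, hg] at h3
      simp [h3] at h2
    have h2 := M.mul_mem (hu (-1)) (key _ h1)
    rwa [← mul_assoc, ← upper_add, neg_add_cancel, upper_zero, one_mul] at h2
  · exact key g hg

theorem mem_of_mul_self_mem_prod {M : Submonoid (SL(2, ℂ) × SL(2, ℂ))} (h : ∀ g, g * g ∈ M)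
    (g : SL(2, ℂ) × SL(2, ℂ)) : g ∈ M := by
  have h1 := mem_of_mul_self_mem (M := M.comap (MonoidHom.inl _ SL(2, ℂ)))
    (fun g => by simpa using h (g, 1)) g.1
  have h2 := mem_of_mul_self_mem (M := M.comap (MonoidHom.inr SL(2, ℂ) _))
    (fun g => by simpa using h (1, g)) g.2
  simpa using M.mul_mem h1 h2

end Squares

/-! ### Polynomial functions on two copies of `SL₂`. -/

section PolyFunTwo

/-- The polynomial functions on `SL₂(ℂ) × SL₂(ℂ)`. -/
def polyFunTwo : Subalgebra ℂ (SL(2, ℂ) × SL(2, ℂ) → ℂ) :=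
  (MvPolynomial.aeval (R := ℂ) (σ := (Fin 2 × Fin 2) ⊕ (Fin 2 × Fin 2))
    (Sum.elim (fun a (x : SL(2, ℂ) × SL(2, ℂ)) => x.1.1 a.1 a.2) fun a x => x.2.1 a.1 a.2)).range

theorem mem_polyFunTwo {f : SL(2, ℂ) × SL(2, ℂ) → ℂ} : f ∈ polyFunTwo ↔
    ∃ p : MvPolynomial ((Fin 2 × Fin 2) ⊕ (Fin 2 × Fin 2)) ℂ, ∀ g h : SL(2, ℂ), f (g, h) =
      p.eval (Sum.elim (fun a => g.1 a.1 a.2) (fun a => h.1 a.1 a.2)) := by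
  have key : ∀ (p : MvPolynomial ((Fin 2 × Fin 2) ⊕ (Fin 2 × Fin 2)) ℂ) (g h : SL(2, ℂ)),
      MvPolynomial.aeval (R := ℂ) (Sum.elim (fun a (x : SL(2, ℂ) × SL(2, ℂ)) => x.1.1 a.1 a.2)
        fun a x => x.2.1 a.1 a.2) p (g, h) =
      p.eval (Sum.elim (fun a => g.1 a.1 a.2) (fun a => h.1 a.1 a.2)) := by
    intro p g h
    induction p using MvPolynomial.induction_on with
    | C a => simp
    | add p q hp hq => simp [hp, hq]
    | mul_X p i hp => cases i <;> simp [hp]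
  constructor
  · rintro ⟨p, rfl⟩
    exact ⟨p, key p⟩
  · rintro ⟨p, hp⟩
    exact ⟨p, funext fun x => (key p x.1 x.2).trans (hp x.1 x.2).symm⟩

theorem fst_mem_polyFunTwo {p : MvPolynomial (Fin 2 × Fin 2) ℂ} :
    (fun x => p.eval fun a => x.1.1 a.1 a.2) ∈ polyFunTwo :=
  mem_polyFunTwo.2 ⟨p.rename Sum.inl, fun g h => by rw [MvPolynomial.eval_rename]; rfl⟩

theorem snd_mem_polyFunTwo {p : MvPolynomial (Fin 2 × Fin 2) ℂ} :
    (fun x => p.eval fun a => x.2.1 a.1 a.2) ∈ polyFunTwo :=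
  mem_polyFunTwo.2 ⟨p.rename Sum.inr, fun g h => by rw [MvPolynomial.eval_rename]; rfl⟩

theorem continuous_of_mem_polyFunTwo {f : SL(2, ℂ) × SL(2, ℂ) → ℂ} (hf : f ∈ polyFunTwo) :
    Continuous f := by
  obtain ⟨p, hp⟩ := mem_polyFunTwo.1 hf
  have h1 : f = fun x => p.eval (Sum.elim (fun a => x.1.1 a.1 a.2) (fun a => x.2.1 a.1 a.2)) :=
    funext fun x => hp x.1 x.2
  rw [h1]
  refine (MvPolynomial.continuous_eval p).comp (continuous_pi fun a => ?_)
  cases a with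
  | inl a => exact (continuous_subtype_val.comp continuous_fst).matrix_elem a.1 a.2
  | inr a => exact (continuous_subtype_val.comp continuous_snd).matrix_elem a.1 a.2

end PolyFunTwo

/-! ### Ranks of unipotent elements in tensor products -/

section BlockRank

open Module
open scoped Kronecker Matrix

/-- `T + 1` is the tensor product of `N + 1` with the unipotent block of size two. The power `T ^ (m
+ 1)` is triangular, with diagonal entries `N ^ (m + 1)` and corner `(m + 1) N ^ m (N + 1)`. -/
theorem finrank_ker_pow_eq_add {V W : Type*} [AddCommGroup V] [Module ℂ V] [FiniteDimensional ℂ V]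
    [AddCommGroup W] [Module ℂ W] {N : End ℂ V} (hN : IsNilpotent N) {T : End ℂ W}
    (e : W ≃ₗ[ℂ] (Fin 2 → V)) (h0 : ∀ w, e (T w) 0 = N (e w 0) + (N + 1) (e w 1))
    (h1 : ∀ w, e (T w) 1 = N (e w 1)) (m : ℕ) :
    finrank ℂ (LinearMap.ker (T ^ (m + 1))) =
      finrank ℂ (LinearMap.ker (N ^ m)) + finrank ℂ (LinearMap.ker (N ^ (m + 2))) := by
  have hpow1 : ∀ m w, e ((T ^ m) w) 1 = (N ^ m) (e w 1) := by
    intro m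
    induction m with
    | zero => intro w; rfl
    | succ m ih => intro w; rw [pow_succ, End.mul_apply, ih, h1, pow_succ, End.mul_apply]
  have hpow0 : ∀ m w, e ((T ^ (m + 1)) w) 0 =
      (N ^ (m + 1)) (e w 0) + ((m + 1 : ℂ) • (N ^ m * (N + 1))) (e w 1) := by
    intro m
    induction m with
    | zero => intro w; simp [h0]
    | succ m ih =>
      intro w
      rw [pow_succ T, End.mul_apply, ih, h0, h1]
      simp only [LinearMap.smul_apply, End.mul_apply, map_add, LinearMap.add_apply, End.one_apply,
        pow_succ]
      push_cast
      module
  obtain ⟨B, hB⟩ : IsUnit ((m + 1 : ℂ) • (N + 1)) := by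
    have : IsUnit ((m + 1 : ℂ) • (1 : End ℂ V)) := by
      rw [← Algebra.algebraMap_eq_smul_one]
      exact (IsUnit.mk0 _ (Nat.cast_add_one_ne_zero m)).map _
    rw [← one_mul (N + 1), ← smul_mul_assoc]
    exact this.mul hN.isUnit_add_one
  have hBN : ∀ j v, (N ^ j) (B.1 v) = B.1 ((N ^ j) v) := by
    intro j v
    have : Commute (N ^ j) B.1 := by
      rw [hB]
      exact (((Commute.refl N).add_right (Commute.one_right N)).smul_right _).pow_left j
    exact congrArg (fun f : End ℂ V => f v) this.eq
  have hBB : ∀ v, B.1 (B⁻¹.1 v) = v := fun v => by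
    rw [← End.mul_apply, B.mul_inv]; rfl
  have hBB' : ∀ v, B⁻¹.1 (B.1 v) = v := fun v => by
    rw [← End.mul_apply, B.inv_mul]; rfl
  -- In the coordinates `x₀ = N w₀ + B w₁`, `x₁ = w₀` the kernel is given by the separate equations
  -- `N ^ m x₀ = 0` and `N ^ (m + 2) x₁ = 0`.
  let E : W ≃ₗ[ℂ] (Fin 2 → V) := e.trans
    { toFun := fun x => ![N (x 0) + B.1 (x 1), x 0]
      invFun := fun x => ![x 1, B⁻¹.1 (x 0 - N (x 1))]
      map_add' := fun x y => by
        ext i; fin_cases i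
        · simp; abel
        · simp
      map_smul' := fun c x => by ext i; fin_cases i <;> simp
      left_inv := fun x => by ext i; fin_cases i <;> simp [hBB']
      right_inv := fun x => by ext i; fin_cases i <;> simp [hBB] }
  have hE0 : ∀ w, E w 0 = N (e w 0) + B.1 (e w 1) := fun w => rfl
  have hE1 : ∀ w, E w 1 = e w 0 := fun w => rfl
  let g : Fin 2 → End ℂ V := ![N ^ m, N ^ (m + 2)]
  let f : End ℂ W := E.symm.toLinearMap ∘ₗ (LinearMap.pi fun i => g i ∘ₗ LinearMap.proj i) ∘ₗ
    E.toLinearMap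
  have hf : ∀ w i, E (f w) i = g i (E w i) := fun w i => by simp [f]
  have hker : LinearMap.ker (T ^ (m + 1)) = LinearMap.ker f := by
    ext w
    have hT0 : e ((T ^ (m + 1)) w) 0 = (N ^ m) (E w 0) := by
      rw [hpow0, hE0, map_add, pow_succ, End.mul_apply, ← mul_smul_comm, ← hB, End.mul_apply]
    rw [LinearMap.mem_ker, LinearMap.mem_ker, ← e.map_eq_zero_iff, ← E.map_eq_zero_iff]
    constructor
    · intro h
      have a0 := congrFun h 0
      have a1 := congrFun h 1
      rw [hT0] at a0
      rw [hpow1] at a1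
      ext i
      rw [hf]
      fin_cases i
      · exact a0
      · change (N ^ (m + 2)) (E w 1) = 0
        have a2 : N ((N ^ m) (E w 0)) = 0 := by rw [a0]; exact map_zero N
        rw [← End.mul_apply, ← pow_succ', hE0, map_add, hBN, a1] at a2
        rw [hE1, pow_succ, End.mul_apply]
        simpa using a2
    · intro h
      have a0 : (N ^ m) (E w 0) = 0 := (hf w 0).symm.trans (by rw [h]; rfl)
      have a1 : (N ^ (m + 2)) (E w 1) = 0 := (hf w 1).symm.trans (by rw [h]; rfl)
      ext i
      fin_cases i
      · exact hT0.trans a0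
      · change e ((T ^ (m + 1)) w) 1 = 0
        have a2 : N ((N ^ m) (E w 0)) = 0 := by rw [a0]; exact map_zero N
        rw [← End.mul_apply, ← pow_succ', hE0, map_add, ← End.mul_apply, ← pow_succ, ← hE1, a1,
          zero_add, hBN] at a2
        rw [hpow1, ← hBB' ((N ^ (m + 1)) (e w 1)), a2, map_zero]
  rw [hker, finrank_ker_eq_sum E f g hf, Fin.sum_univ_two]
  rfl

theorem rank_blockDiagonal' {β : Type} [Fintype β] [DecidableEq β] {κ : β → Type}
    [∀ b, Fintype (κ b)] [∀ b, DecidableEq (κ b)] (M : ∀ b, Matrix (κ b) (κ b) ℂ) :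
    (Matrix.blockDiagonal' M).rank = ∑ b, (M b).rank := by
  let e : ((Σ b, κ b) → ℂ) ≃ₗ[ℂ] (∀ b, κ b → ℂ) :=
    { Equiv.piCurry (fun _ _ => ℂ) with
      map_add' := fun _ _ => rfl
      map_smul' := fun _ _ => rfl }
  have he : ∀ v b i, e v b i = v ⟨b, i⟩ := fun v b i => rfl
  have h1 := finrank_ker_eq_sum e (Matrix.toLin' (Matrix.blockDiagonal' M))
    (fun b => Matrix.toLin' (M b)) (fun v b => by
      ext i
      rw [he, Matrix.toLin'_apply, Matrix.toLin'_apply, Matrix.mulVec, dotProduct,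
        Fintype.sum_sigma, Finset.sum_eq_single b]
      · simp [Matrix.mulVec, dotProduct, Matrix.blockDiagonal'_apply_eq, he]
      · intro b' _ hb'
        exact Finset.sum_eq_zero fun j _ => by
          rw [Matrix.blockDiagonal'_apply_ne _ _ _ hb'.symm, zero_mul]
      · simp)
  have h2 := rank_add_finrank_ker (Matrix.blockDiagonal' M) 1
  have h3 : ∀ b, (M b).rank + finrank ℂ (LinearMap.ker (Matrix.toLin' (M b))) =
      Fintype.card (κ b) := fun b => by
    have := rank_add_finrank_ker (M b) 1
    rwa [pow_one, pow_one] at this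
  rw [pow_one, pow_one, h1, Fintype.card_sigma, ← Finset.sum_congr rfl fun b _ => h3 b,
    Finset.sum_add_distrib] at h2
  omega

/-- Vectors in a tensor product as families of vectors. -/
def tensorEquiv (κ κ' : Type) : (κ × κ' → ℂ) ≃ₗ[ℂ] (κ' → κ → ℂ) where
  toFun v j i := v (i, j)
  invFun v p := v p.2 p.1
  map_add' _ _ := rfl
  map_smul' _ _ := rfl

theorem tensorEquiv_kronecker {κ κ' : Type} [Fintype κ] [Fintype κ'] [DecidableEq κ]
    [DecidableEq κ'] (A : Matrix κ κ ℂ) (B : Matrix κ' κ' ℂ) (v : κ × κ' → ℂ) (j : κ') :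
    tensorEquiv κ κ' (Matrix.toLin' (A ⊗ₖ B) v) j =
      ∑ j', B j j' • Matrix.toLin' A (tensorEquiv κ κ' v j') := by
  ext i
  simp only [tensorEquiv, LinearEquiv.coe_mk, LinearMap.coe_mk, AddHom.coe_mk, Matrix.toLin'_apply,
    Matrix.mulVec, dotProduct, Fintype.sum_prod_type, Matrix.kronecker_apply, Finset.sum_apply,
    Pi.smul_apply, smul_eq_mul, Finset.mul_sum]
  rw [Finset.sum_comm]
  exact Finset.sum_congr rfl fun _ _ => Finset.sum_congr rfl fun _ _ => by ring

theorem isNilpotent_symMat_stdUnipotent_sub_one (k : ℕ) :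
    IsNilpotent (symMat k stdUnipotent.1 - 1) := by
  have h1 : (symMat k stdUnipotent.1 - 1).BlockTriangular id := by
    intro i j hij
    have hij : j < i := hij
    rw [Matrix.sub_apply, symMat_stdUnipotent, Nat.choose_eq_zero_of_lt hij,
      Matrix.one_apply_ne hij.ne']
    simp
  have h2 := Matrix.charpoly_of_isUpperTriangular _ h1
  have h3 := Matrix.aeval_self_charpoly (symMat k stdUnipotent.1 - 1)
  rw [h2] at h3
  refine ⟨k + 1, ?_⟩
  simpa [symMat_stdUnipotent] using h3

theorem rank_symMat_stdUnipotent_sub_one_pow (k m : ℕ) :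
    ((symMat k stdUnipotent.1 - 1) ^ m).rank = k + 1 - m := by
  have h1 := rank_add_finrank_ker (symMat k stdUnipotent.1 - 1) m
  rw [finrank_ker_pow_eq_min (k := k)
    (isNilpotent_toLin' (isNilpotent_symMat_stdUnipotent_sub_one k)) ?_ (by simp),
    Fintype.card_fin] at h1
  · omega
  · rw [← Matrix.toLin'_pow]
    intro h
    exact symMat_stdUnipotent_sub_one_pow_ne_zero ((map_eq_zero_iff _ Matrix.toLin'.injective).1 h)

theorem rank_kronecker_one_sub_one_pow (k l m : ℕ) :
    (((symMat k stdUnipotent.1 ⊗ₖ (1 : Matrix (Fin (l + 1)) (Fin (l + 1)) ℂ)) - 1) ^ m).rank =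
      (l + 1) * (k + 1 - m) := by
  have hpow : ∀ (A : Matrix (Fin (k + 1)) (Fin (k + 1)) ℂ),
      (A ⊗ₖ (1 : Matrix (Fin (l + 1)) (Fin (l + 1)) ℂ)) ^ m = (A ^ m) ⊗ₖ 1 := by
    intro A
    induction m with
    | zero => simp
    | succ m ih => rw [pow_succ, ih, ← Matrix.mul_kronecker_mul, mul_one, pow_succ]
  have h1 : (symMat k stdUnipotent.1 ⊗ₖ (1 : Matrix (Fin (l + 1)) (Fin (l + 1)) ℂ)) - 1 =
      (symMat k stdUnipotent.1 - 1) ⊗ₖ 1 := by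
    rw [sub_eq_iff_eq_add]
    conv_rhs => rw [← Matrix.one_kronecker_one, ← Matrix.add_kronecker, sub_add_cancel]
  set A := (symMat k stdUnipotent.1 - 1) ^ m with hA
  rw [h1, hpow, ← hA]
  have h2 := finrank_ker_eq_sum (tensorEquiv (Fin (k + 1)) (Fin (l + 1)))
    (Matrix.toLin' (A ⊗ₖ (1 : Matrix (Fin (l + 1)) (Fin (l + 1)) ℂ))) (fun _ => Matrix.toLin' A)
    (fun v j => by
      rw [tensorEquiv_kronecker, Finset.sum_eq_single j]
      · simp
      · intro j' _ hj'
        rw [Matrix.one_apply_ne hj'.symm, zero_smul]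
      · simp)
  have h3 := rank_add_finrank_ker (A ⊗ₖ (1 : Matrix (Fin (l + 1)) (Fin (l + 1)) ℂ)) 1
  have h4 := rank_add_finrank_ker A 1
  have h5 := rank_symMat_stdUnipotent_sub_one_pow k m
  rw [← hA] at h5
  rw [pow_one, pow_one, h2, Finset.sum_const, Finset.card_univ, smul_eq_mul, Fintype.card_prod,
    Fintype.card_fin, Fintype.card_fin] at h3
  rw [pow_one, pow_one, h5, Fintype.card_fin] at h4
  have h6 : (k + 1 - m) + finrank ℂ (LinearMap.ker (Matrix.toLin' A)) = k + 1 := h4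
  have h7 := congrArg (fun x => (l + 1) * x) h6
  simp only [mul_add (l + 1)] at h7
  rw [mul_comm (k + 1), mul_add (l + 1)] at h3
  omega

/-- Clebsch–Gordan in terms of ranks: blocks of sizes `k + 2` and `k` replace two of size `k + 1`,
which is visible only at `m = k + 1`. -/
theorem rank_kronecker_stdUnipotent_sub_one_pow (k m : ℕ) :
    (((symMat k stdUnipotent.1 ⊗ₖ symMat 1 stdUnipotent.1) - 1) ^ m).rank =
      2 * (k + 1 - m) + if m = k + 1 then 1 else 0 := by
  have hN := isNilpotent_toLin' (isNilpotent_symMat_stdUnipotent_sub_one k)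
  have h3 := rank_add_finrank_ker (symMat k stdUnipotent.1 ⊗ₖ symMat 1 stdUnipotent.1 - 1) m
  rw [Fintype.card_prod, Fintype.card_fin, Fintype.card_fin] at h3
  cases m with
  | zero =>
    rw [pow_zero, pow_zero, End.one_eq_id, LinearMap.ker_id, finrank_bot] at h3
    rw [pow_zero, if_neg (by omega)]
    omega
  | succ m =>
    rw [finrank_ker_pow_eq_add hN (tensorEquiv _ _)] at h3
    · have hr := fun m => rank_add_finrank_ker (symMat k stdUnipotent.1 - 1) m
      simp only [rank_symMat_stdUnipotent_sub_one_pow, Fintype.card_fin] at hr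
      have a := hr m
      have b := hr (m + 2)
      split_ifs <;> omega
    · intro w
      rw [map_sub, LinearMap.sub_apply, map_sub, Pi.sub_apply, tensorEquiv_kronecker,
        Fin.sum_univ_two, symMat_stdUnipotent, symMat_stdUnipotent]
      simp
      abel
    · intro w
      rw [map_sub, LinearMap.sub_apply, map_sub, Pi.sub_apply, tensorEquiv_kronecker,
        Fin.sum_univ_two, symMat_stdUnipotent, symMat_stdUnipotent]
      simp

end BlockRank

/-! ### Construction of homomorphisms from `SL₂(ℂ) × SL₂(ℂ)` to classical groups -/

section Construction

open scoped Kronecker Matrix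

/-- The tensor product of symmetric powers of the two factors; the second factor may act
trivially. -/
def blockHom (k l : ℕ) (act : Prop) [Decidable act] : SL(2, ℂ) × SL(2, ℂ) →*
    Matrix (Fin (k + 1) × Fin (l + 1)) (Fin (k + 1) × Fin (l + 1)) ℂ where
  toFun x := symMat k x.1.1 ⊗ₖ symMat l (if act then x.2 else 1).1
  map_one' := by
    rw [Prod.fst_one, Prod.snd_one, ite_self, Matrix.SpecialLinearGroup.coe_one, symMat_one,
      symMat_one, Matrix.one_kronecker_one]
  map_mul' x y := by
    rw [← Matrix.mul_kronecker_mul, ← symMat_mul, ← symMat_mul,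
      ← Matrix.SpecialLinearGroup.coe_mul, ← Matrix.SpecialLinearGroup.coe_mul]
    split_ifs <;> simp

theorem blockHom_apply (k l : ℕ) (act : Prop) [Decidable act] (x : SL(2, ℂ) × SL(2, ℂ)) :
    blockHom k l act x = symMat k x.1.1 ⊗ₖ symMat l (if act then x.2 else 1).1 := rfl

theorem blockHom_mem_polyFunTwo (k l : ℕ) (act : Prop) [Decidable act]
    (i j : Fin (k + 1) × Fin (l + 1)) : (fun x => blockHom k l act x i j) ∈ polyFunTwo := by
  simp only [blockHom_apply]
  obtain ⟨p, hp⟩ := exists_eval_eq_symMat i.1 j.1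
  obtain ⟨q, hq⟩ := exists_eval_eq_symMat i.2 j.2
  refine Subalgebra.mul_mem _ ?_ ?_
  · simp only [hp]
    exact fst_mem_polyFunTwo
  · by_cases h : act
    · simp only [if_pos h, hq]
      exact snd_mem_polyFunTwo
    · simp only [if_neg h]
      exact Subalgebra.algebraMap_mem polyFunTwo (symMat l (1 : SL(2, ℂ)).1 i.2 j.2)

theorem blockHom_isometry (k l : ℕ) (act : Prop) [Decidable act] (x : SL(2, ℂ) × SL(2, ℂ)) :
    (blockHom k l act x)ᵀ * (symForm k ⊗ₖ symForm l) * blockHom k l act x =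
      symForm k ⊗ₖ symForm l := by
  have h : ∀ (A : Matrix (Fin (k + 1)) (Fin (k + 1)) ℂ) (B : Matrix (Fin (l + 1)) (Fin (l + 1)) ℂ),
      (A ⊗ₖ B)ᵀ = Aᵀ ⊗ₖ Bᵀ := fun _ _ => rfl
  rw [blockHom_apply, h, ← Matrix.mul_kronecker_mul, ← Matrix.mul_kronecker_mul,
    symMat_transpose_mul_symForm_mul, symMat_transpose_mul_symForm_mul]

/-- The direct sum of the blocks preserves the sum of the forms `symForm ⊗ₖ symForm`, of sign `(-1)
^ (k + l)`. As this is the sign of `J`, the two forms are equivalent and the action can be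
transported. -/
theorem exists_hom_of_blocks {ι β : Type} [Fintype ι] [DecidableEq ι] [Fintype β] [DecidableEq β]
    {J : Matrix ι ι ℂ} (hJ : IsUnit J) {ε : ℂ} (hε : ε * ε = 1) (hJε : Jᵀ = ε • J)
    (k l : β → ℕ) (act : β → Prop) [∀ b, Decidable (act b)]
    (e : (Σ b, Fin (k b + 1) × Fin (l b + 1)) ≃ ι) (hsign : ∀ b, (-1) ^ (k b + l b) = ε) :
    ∃ Ψ : SL(2, ℂ) × SL(2, ℂ) →* Matrix ι ι ℂ, (∀ x, (Ψ x)ᵀ * J * Ψ x = J) ∧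
      (∀ i j, (fun x => Ψ x i j) ∈ polyFunTwo) ∧
      ∀ x m, ((Ψ x - 1) ^ m).rank = ∑ b, ((blockHom (k b) (l b) (act b) x - 1) ^ m).rank := by
  let D : (∀ b, Matrix (Fin (k b + 1) × Fin (l b + 1)) (Fin (k b + 1) × Fin (l b + 1)) ℂ) →+*
      Matrix ι ι ℂ :=
    (Matrix.reindexAlgEquiv ℂ ℂ e).toAlgHom.toRingHom.comp
      (Matrix.blockDiagonal'RingHom _ ℂ)
  have hD : ∀ M i j, D M i j = Matrix.blockDiagonal' M (e.symm i) (e.symm j) := fun _ _ _ => rfl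
  have hDT : ∀ M, (D M)ᵀ = D fun b => (M b)ᵀ := fun M => by
    ext i j
    rw [Matrix.transpose_apply, hD, hD, ← Matrix.blockDiagonal'_transpose, Matrix.transpose_apply]
  have hrank : ∀ M, (D M).rank = ∑ b, (M b).rank := fun M => by
    rw [← rank_blockDiagonal']
    exact Matrix.rank_reindex e e _
  let φ : SL(2, ℂ) × SL(2, ℂ) →* Matrix ι ι ℂ :=
    (D : _ →* Matrix ι ι ℂ).comp (MonoidHom.pi fun b => blockHom (k b) (l b) (act b))
  have hφ : ∀ x, φ x = D fun b => blockHom (k b) (l b) (act b) x := fun _ => rfl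
  set B := D fun b => symForm (k b) ⊗ₖ symForm (l b) with hBdef
  have hφB : ∀ x, (φ x)ᵀ * B * φ x = B := fun x => by
    rw [hφ, hDT, hBdef, ← map_mul, ← map_mul]
    congr 1
    funext b
    exact blockHom_isometry _ _ _ _
  have hB : IsUnit B := by
    refine IsUnit.map D (Pi.isUnit_iff.2 fun b => ?_)
    obtain ⟨u, hu⟩ := isUnit_symForm (k := k b)
    obtain ⟨v, hv⟩ := isUnit_symForm (k := l b)
    refine IsUnit.of_mul_eq_one (u⁻¹.1 ⊗ₖ v⁻¹.1) ?_
    rw [← hu, ← hv, ← Matrix.mul_kronecker_mul, u.mul_inv, v.mul_inv, Matrix.one_kronecker_one]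
  have hBε : Bᵀ = ε • B := by
    rw [hBdef, hDT]
    ext i j
    rw [Matrix.smul_apply, hD, hD, ← Matrix.smul_apply, ← Matrix.blockDiagonal'_smul]
    congr 2
    funext b
    change (symForm (k b))ᵀ ⊗ₖ (symForm (l b))ᵀ = ε • (symForm (k b) ⊗ₖ symForm (l b))
    rw [symForm_transpose, symForm_transpose, Matrix.smul_kronecker, Matrix.kronecker_smul,
      smul_smul, ← pow_add, hsign]
  obtain ⟨P, hPu, hP, -⟩ := exists_equivalence_of_forms hJ hB hε hJε hBε
  obtain ⟨P, rfl⟩ := hPu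
  let Ψ : SL(2, ℂ) × SL(2, ℂ) →* Matrix ι ι ℂ :=
    { toFun := fun x => P.1 * φ x * P⁻¹.1
      map_one' := by rw [map_one, mul_one, P.mul_inv]
      map_mul' := fun x y => by
        rw [map_mul]
        simp only [mul_assoc, P.inv_mul_cancel_left] }
  have hΨ : ∀ x, Ψ x = P.1 * φ x * P⁻¹.1 := fun _ => rfl
  refine ⟨Ψ, fun x => ?_, fun i j => ?_, fun x m => ?_⟩
  · have h1 : (P⁻¹.1)ᵀ * P.1ᵀ = 1 := by
      rw [← Matrix.transpose_mul, P.mul_inv, Matrix.transpose_one]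
    calc (Ψ x)ᵀ * J * Ψ x = (P⁻¹.1)ᵀ * ((φ x)ᵀ * (P.1ᵀ * J * P.1) * φ x) * P⁻¹.1 := by
          rw [hΨ, Matrix.transpose_mul, Matrix.transpose_mul]; simp only [mul_assoc]
      _ = ((P⁻¹.1)ᵀ * P.1ᵀ) * J * (P.1 * P⁻¹.1) := by
          rw [hP, hφB, ← hP]; simp only [mul_assoc]
      _ = J := by rw [h1, P.mul_inv, one_mul, mul_one]
  · simp only [hΨ, Matrix.mul_apply]
    have hconst : ∀ c : ℂ, (fun _ : SL(2, ℂ) × SL(2, ℂ) => c) ∈ polyFunTwo :=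
      fun c => Subalgebra.algebraMap_mem polyFunTwo c
    have hmem : ∀ i j, (fun x => φ x i j) ∈ polyFunTwo := by
      intro i j
      simp only [hφ, hD]
      obtain ⟨b, p⟩ := e.symm i
      obtain ⟨b', p'⟩ := e.symm j
      by_cases h : b = b'
      · subst h
        simp only [Matrix.blockDiagonal'_apply_eq]
        exact blockHom_mem_polyFunTwo _ _ _ _ _
      · simp only [Matrix.blockDiagonal'_apply_ne _ _ _ h]
        exact hconst 0
    have hsum : ∀ (f : ι → SL(2, ℂ) × SL(2, ℂ) → ℂ), (∀ a, f a ∈ polyFunTwo) →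
        (fun x => ∑ a, f a x) ∈ polyFunTwo := fun f hf => by
      have := Subalgebra.sum_mem polyFunTwo (t := Finset.univ) fun a _ => hf a
      convert this using 1
      ext x
      simp
    refine hsum _ fun a => Subalgebra.mul_mem _ (hsum _ fun a' => Subalgebra.mul_mem _ ?_ ?_) ?_
    · exact hconst _
    · exact hmem _ _
    · exact hconst _
  · have h1 : ∀ A : Matrix ι ι ℂ, (P.1 * A * P⁻¹.1).rank = A.rank := fun A => by
      rw [Matrix.rank_mul_eq_left_of_isUnit_det _ _
        ((Matrix.isUnit_iff_isUnit_det _).1 (P⁻¹).isUnit),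
        Matrix.rank_mul_eq_right_of_isUnit_det _ _ ((Matrix.isUnit_iff_isUnit_det _).1 P.isUnit)]
    have h2 : Ψ x - 1 = P.1 * (φ x - 1) * P⁻¹.1 := by
      rw [hΨ, mul_sub, sub_mul, mul_one, P.mul_inv]
    rw [h2, Units.conj_pow, h1, hφ, ← map_one D, ← map_sub, ← map_pow, hrank]
    rfl

/-- Blocks of size `c ≡ N` carry a form of the right sign by themselves. Other sizes have even
multiplicity, and pairs of blocks are realized as Sym^(c-1) ⊗ ℂ², with the product of two
alternating or of a symmetric and an alternating form. The second `SL₂` acts on one pair for each `c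
∈ S`, so on the diagonal one pair (c, c) becomes (c + 1, c - 1). -/
theorem IsClassicalGroup.exists_hom {ι : Type} [Fintype ι] [DecidableEq ι]
    {H : Submonoid (Matrix ι ι ℂ)} {J : Matrix ι ι ℂ} (hH : IsClassicalGroup H J)
    {u : Matrix ι ι ℂ} (hu : u ∈ H) (hn : IsNilpotent (u - 1)) (S : Finset ℕ)
    (hS : ∀ c ∈ S, 1 ≤ c ∧ ¬ c ≡ Fintype.card ι [MOD 2] ∧ 0 < jordanMult u c) :
    ∃ Ψ : SL(2, ℂ) × SL(2, ℂ) →* H,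
      (∀ i j, (fun x => (Ψ x : Matrix ι ι ℂ) i j) ∈ polyFunTwo) ∧
      (∀ m, (((Ψ (stdUnipotent, 1) : Matrix ι ι ℂ) - 1) ^ m).rank = ((u - 1) ^ m).rank) ∧
      ∀ m, (((Ψ (stdUnipotent, stdUnipotent) : Matrix ι ι ℂ) - 1) ^ m).rank =
        ((u - 1) ^ m).rank + if m ∈ S then 1 else 0 := by
  set N := Fintype.card ι with hN
  -- There are `nb c` summands Sym^(c-1) ⊗ Sym^(ll c). Below, `k : Fin N` stands for the size `k +
  -- 1`, and the second factor acts on the summand numbered `0`.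
  let nb : ℕ → ℕ := fun c => if c ≡ N [MOD 2] then jordanMult u c else jordanMult u c / 2
  let ll : ℕ → ℕ := fun c => if c ≡ N [MOD 2] then 0 else 1
  have hnb : ∀ c, 1 ≤ c → nb c * (ll c + 1) = jordanMult u c := by
    intro c hc
    simp only [nb, ll]
    split_ifs with h
    · simp
    · obtain ⟨t, ht⟩ := hH.even_jordanMult hu hn hc h
      omega
  have hsum : ∀ f : ℕ → ℕ, ∑ b : Σ k : Fin N, Fin (nb (k + 1)), (ll (b.1 + 1) + 1) * f (b.1 + 1) =
      ∑ c ∈ Finset.Icc 1 N, jordanMult u c * f c := by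
    intro f
    have h1 : ∀ g : ℕ → ℕ, ∑ k : Fin N, g (k + 1) = ∑ c ∈ Finset.Icc 1 N, g c := fun g => by
      rw [Fin.sum_univ_eq_sum_range fun k => g (k + 1), Finset.range_eq_Ico,
        Finset.sum_Ico_add' g 0 N 1, zero_add, Finset.Ico_add_one_right_eq_Icc]
    rw [Fintype.sum_sigma, ← h1]
    refine Finset.sum_congr rfl fun k _ => ?_
    simp only [Finset.sum_const, Finset.card_univ, Fintype.card_fin, smul_eq_mul]
    rw [← mul_assoc, hnb _ (by omega)]
  have hcard : Fintype.card (Σ b : (Σ k : Fin N, Fin (nb (k + 1))),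
      Fin ((b.1 : ℕ) + 1) × Fin (ll (b.1 + 1) + 1)) = Fintype.card ι := by
    have h1 := rank_pow_eq_sum_jordanMult hn 0
    rw [pow_zero, Matrix.rank_one, ← hsum] at h1
    rw [h1, Fintype.card_sigma]
    refine Finset.sum_congr rfl fun b _ => ?_
    rw [Fintype.card_prod, Fintype.card_fin, Fintype.card_fin, mul_comm]
    rfl
  obtain ⟨Ψ, hΨ, hpoly, hrank⟩ := exists_hom_of_blocks hH.isUnit (formSign_mul_self N)
    hH.transpose_eq (fun b : Σ k : Fin N, Fin (nb (k + 1)) => (b.1 : ℕ)) (fun b => ll (b.1 + 1))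
    (fun b => ((b.1 : ℕ) + 1 ∈ S ∧ (b.2 : ℕ) = 0)) (Fintype.equivOfCardEq hcard) (by
      intro b
      rw [formSign]
      refine neg_one_pow_congr ?_
      simp only [ll, Nat.even_iff]
      split_ifs with h <;> rw [Nat.ModEq] at h <;> omega)
  have hmem : ∀ x, Ψ x ∈ H := mem_of_mul_self_mem_prod (M := H.comap Ψ) fun x => by
    rw [Submonoid.mem_comap, map_mul]
    exact hH.mul_self_mem (hΨ x)
  refine ⟨Ψ.codRestrict H hmem, hpoly, fun m => ?_, fun m => ?_⟩
  · change ((Ψ (stdUnipotent, 1) - 1) ^ m).rank = _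
    rw [hrank, rank_pow_eq_sum_jordanMult hn, ← hsum fun c => c - m]
    refine Finset.sum_congr rfl fun b _ => ?_
    rw [← rank_kronecker_one_sub_one_pow, blockHom_apply, ite_self,
      Matrix.SpecialLinearGroup.coe_one, symMat_one]
  · change ((Ψ (stdUnipotent, stdUnipotent) - 1) ^ m).rank = _
    rw [hrank, rank_pow_eq_sum_jordanMult hn, ← hsum fun c => c - m]
    -- The correction is distributed over the summands: it comes from the active one of size `m`,
    -- which exists because `m` is a block size of `u`.
    have h1 : (if m ∈ S then 1 else 0) = ∑ b : Σ k : Fin N, Fin (nb (k + 1)),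
        if ((b.1 : ℕ) + 1 ∈ S ∧ (b.2 : ℕ) = 0) ∧ m = b.1 + 1 then 1 else 0 := by
      by_cases hm : m ∈ S
      · obtain ⟨hm1, hmN, hm0⟩ := hS m hm
        have hle : m - 1 < N := by
          by_contra h
          rw [jordanMult, rank_pow_eq_zero hn (by omega), rank_pow_eq_zero hn (by omega)] at hm0
          omega
        have hpos : 0 < nb (m - 1 + 1) := by
          have := hnb m hm1
          rw [Nat.sub_add_cancel hm1]
          exact Nat.pos_of_ne_zero fun h => by rw [h] at this; omega
        rw [if_pos hm, Finset.sum_eq_single ⟨⟨m - 1, hle⟩, ⟨0, hpos⟩⟩]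
        · refine (if_pos ⟨⟨?_, rfl⟩, (Nat.sub_add_cancel hm1).symm⟩).symm
          simpa [Nat.sub_add_cancel hm1] using hm
        · rintro ⟨⟨k, hk⟩, ⟨j, hj⟩⟩ _ hne
          refine if_neg ?_
          rintro ⟨⟨-, h1⟩, h2⟩
          simp only at h1 h2
          subst h1 h2
          exact hne rfl
        · simp
      · rw [if_neg hm]
        refine (Finset.sum_eq_zero fun b _ => if_neg ?_).symm
        rintro ⟨⟨h1, -⟩, h2⟩
        exact hm (h2 ▸ h1)
    rw [h1, ← Finset.sum_add_distrib]
    refine Finset.sum_congr rfl fun b _ => ?_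
    by_cases h : (b.1 : ℕ) + 1 ∈ S ∧ (b.2 : ℕ) = 0
    · have h2 : ll (b.1 + 1) = 1 := if_neg (hS _ h.1).2.1
      generalize ll (b.1 + 1) = l at h2
      subst h2
      simp only [h, if_true, true_and, blockHom_apply, and_self]
      exact rank_kronecker_stdUnipotent_sub_one_pow _ _
    · rw [← rank_kronecker_one_sub_one_pow, blockHom_apply, if_neg h, if_neg (fun h' => h h'.1),
        Matrix.SpecialLinearGroup.coe_one, symMat_one, add_zero]

end Construction

/-! ### Closures of unipotent classes and special pieces -/

section RankClosure

open Module

variable {ι : Type*} [Fintype ι] [DecidableEq ι]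

theorem isClosed_setOf_rank_le (r : ℕ) : IsClosed {A : Matrix ι ι ℂ | A.rank ≤ r} := by
  let L : Matrix ι ι ℂ →ₗ[ℂ] ((ι → ℂ) →L[ℂ] (ι → ℂ)) :=
    LinearMap.toContinuousLinearMap.toLinearMap ∘ₗ Matrix.toLin'.toLinearMap
  have hL : Continuous L := LinearMap.continuous_of_finiteDimensional L
  have h1 := (isOpen_setOfPred_nat_le_rank (𝕜 := ℂ) (E := ι → ℂ) (F := ι → ℂ) (r + 1)).preimage hL
  rw [← isOpen_compl_iff]
  convert h1 using 1
  ext A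
  have h2 : ((L A : (ι → ℂ) →L[ℂ] (ι → ℂ)) : (ι → ℂ) →ₗ[ℂ] (ι → ℂ)).rank = (A.rank : Cardinal) := by
    rw [Matrix.rank, finrank_eq_rank]
    rfl
  simp only [Set.mem_compl_iff, Set.mem_ofPred_eq, not_le, Set.mem_preimage, h2, Nat.cast_le,
    Nat.succ_le_iff]

variable {H : Submonoid (Matrix ι ι ℂ)}

theorem rank_pow_eq_of_isConj {a b : H} (h : IsConj a b) (m : ℕ) :
    (((b : Matrix ι ι ℂ) - 1) ^ m).rank = (((a : Matrix ι ι ℂ) - 1) ^ m).rank := by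
  obtain ⟨c, hc⟩ := h
  let P : (Matrix ι ι ℂ)ˣ := Units.map H.subtype c
  have h1 : (b : Matrix ι ι ℂ) = P.1 * a * P⁻¹.1 := by
    rw [Units.eq_mul_inv_iff_mul_eq]
    exact (congrArg Subtype.val hc).symm
  have h2 : (b : Matrix ι ι ℂ) - 1 = P.1 * (a - 1) * P⁻¹.1 := by
    rw [h1, mul_sub, sub_mul, mul_one, P.mul_inv]
  rw [h2, Units.conj_pow, Matrix.rank_mul_eq_left_of_isUnit_det _ _
    ((Matrix.isUnit_iff_isUnit_det _).1 (P⁻¹).isUnit),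
    Matrix.rank_mul_eq_right_of_isUnit_det _ _ ((Matrix.isUnit_iff_isUnit_det _).1 P.isUnit)]

/-- Upper bounds on ranks are closed and conjugation invariant. Only this necessary condition for
the closure order is used; the one inclusion needed in the other direction is the explicit
degeneration in `mk_mem_closureClasses`. -/
theorem rank_pow_le_of_mem_closureClasses {a b : H}
    (h : ConjClasses.mk b ∈ closureClasses (ConjClasses.mk a)) (m : ℕ) :
    (((b : Matrix ι ι ℂ) - 1) ^ m).rank ≤ (((a : Matrix ι ι ℂ) - 1) ^ m).rank := by
  have hcl : IsClosed {x : H | (((x : Matrix ι ι ℂ) - 1) ^ m).rank ≤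
      (((a : Matrix ι ι ℂ) - 1) ^ m).rank} :=
    (isClosed_setOf_rank_le _).preimage (by fun_prop : Continuous fun x : H =>
      ((x : Matrix ι ι ℂ) - 1) ^ m)
  have hsub : (ConjClasses.mk a).carrier ⊆ {x : H | (((x : Matrix ι ι ℂ) - 1) ^ m).rank ≤
      (((a : Matrix ι ι ℂ) - 1) ^ m).rank} := fun x hx =>
    (rank_pow_eq_of_isConj (ConjClasses.mk_eq_mk_iff_isConj.1
      (ConjClasses.mem_carrier_iff_mk_eq.1 hx)).symm m).le
  exact closure_minimal hsub hcl (h.2 ConjClasses.mem_carrier_mk)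

end RankClosure

/-! ### The combinatorics of special partitions. -/

section Special

/-- An element of `S` above `c` is counted at both of its neighbours, `c` itself only at `c + 1`,
and smaller elements not at all. The induction descends from `c = N + 1` in steps of two. -/
theorem sum_neighbours_modEq (N : ℕ) (S : Finset ℕ) (hS : ∀ c ∈ S, c ≤ N ∧ ¬ c ≡ N [MOD 2]) (t : ℕ) :
    ∀ c, c + 2 * t = N + 1 →
      (∑ k ∈ Finset.Ioc c N with k ≡ N [MOD 2],
        ((if k - 1 ∈ S then 1 else 0) + if k + 1 ∈ S then 1 else 0)) ≡
      (if c ∈ S then 1 else 0) [MOD 2] := by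
  induction t with
  | zero =>
    intro c hc
    rw [Finset.Ioc_eq_empty (by omega), Finset.filter_empty, Finset.sum_empty,
      if_neg fun h => by have := (hS c h).1; omega]
  | succ t ih =>
    intro c hc
    have h1 : (Finset.Ioc c N).filter (fun k => k ≡ N [MOD 2]) =
        insert (c + 1) ((Finset.Ioc (c + 2) N).filter fun k => k ≡ N [MOD 2]) := by
      ext k
      rw [Finset.mem_filter, Finset.mem_insert, Finset.mem_filter, Finset.mem_Ioc, Finset.mem_Ioc]
      unfold Nat.ModEq
      omega
    rw [h1, Finset.sum_insert (by simp)]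
    have h2 := ih (c + 2) (by omega)
    rw [Nat.add_sub_cancel, show c + 1 + 1 = c + 2 from rfl]
    change _ % 2 = _ % 2 at h2
    change _ % 2 = _ % 2
    omega

variable {ι : Type} [Fintype ι] [DecidableEq ι]

theorem jordanMult_le_card {u : Matrix ι ι ℂ} (hn : IsNilpotent (u - 1)) {c : ℕ}
    (h : 0 < jordanMult u c) : c ≤ Fintype.card ι := by
  by_contra hc
  rw [jordanMult, rank_pow_eq_zero hn (by omega), rank_pow_eq_zero hn (by omega)] at h
  omega

theorem isNilpotent_sub_one_of_rank_pow {u v : Matrix ι ι ℂ} (hn : IsNilpotent (u - 1))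
    {S : Finset ℕ} (hr : ∀ m, ((v - 1) ^ m).rank = ((u - 1) ^ m).rank + if m ∈ S then 1 else 0) :
    IsNilpotent (v - 1) := by
  obtain ⟨m, hm, hmS⟩ : ∃ m, Fintype.card ι ≤ m ∧ m ∉ S := by
    obtain ⟨m, hm⟩ := (Finset.range (Fintype.card ι) ∪ S).exists_notMem
    simp only [Finset.mem_union, Finset.mem_range, not_or, not_lt] at hm
    exact ⟨m, hm⟩
  refine ⟨m, ?_⟩
  have h1 := hr m
  rw [if_neg hmS, rank_pow_eq_zero hn hm, Matrix.rank, Submodule.finrank_eq_zero,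
    LinearMap.range_eq_bot, ← Matrix.toLin'_apply'] at h1
  exact (map_eq_zero_iff _ Matrix.toLin'.injective).1 h1

/-- Taking second differences of the ranks, each element of `S` removes two blocks of its own size
and adds one of each neighbouring size. -/
theorem jordanMult_add_of_rank_pow {u v : Matrix ι ι ℂ} (hn : IsNilpotent (u - 1)) {S : Finset ℕ}
    (hr : ∀ m, ((v - 1) ^ m).rank = ((u - 1) ^ m).rank + if m ∈ S then 1 else 0) {c : ℕ}
    (hc : 1 ≤ c) : jordanMult v c + 2 * (if c ∈ S then 1 else 0) = jordanMult u c +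
      ((if c - 1 ∈ S then 1 else 0) + if c + 1 ∈ S then 1 else 0) := by
  have h1 := jordanMult_add_two_mul hn hc
  have h2 := jordanMult_add_two_mul (isNilpotent_sub_one_of_rank_pow hn hr) hc
  rw [hr, hr, hr] at h2
  omega

/-- Raising the ranks at the parts that violate the condition makes a partition special. -/
theorem isSpecialMatrix_of_rank_pow {u v : Matrix ι ι ℂ} (hn : IsNilpotent (u - 1)) {S : Finset ℕ}
    (hS : ∀ c, c ∈ S ↔ 1 ≤ c ∧ ¬ c ≡ Fintype.card ι [MOD 2] ∧ 0 < jordanMult u c ∧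
      ¬ (∑ k ∈ Finset.Ioc c (Fintype.card ι) with k ≡ Fintype.card ι [MOD 2], jordanMult u k)
        ≡ Fintype.card ι [MOD 2])
    (hr : ∀ m, ((v - 1) ^ m).rank = ((u - 1) ^ m).rank + if m ∈ S then 1 else 0) :
    IsSpecialMatrix v := by
  have hmult := fun c (hc : 1 ≤ c) => jordanMult_add_of_rank_pow hn hr hc
  intro c hc hc0 hcN
  have hodd : ∀ k ∈ S, ¬ k ≡ Fintype.card ι [MOD 2] := fun k hk => ((hS k).1 hk).2.1
  have hle : ∀ k ∈ S, k ≤ Fintype.card ι := fun k hk =>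
    jordanMult_le_card hn ((hS k).1 hk).2.2.1
  -- The blocks created by the trade have the parity of `N`, so a block size of `v` of the other
  -- parity was already one of `u`.
  have hcu : 0 < jordanMult u c := by
    have h1 := hmult c hc
    have h2 : c - 1 ∉ S := fun h => by
      have h3 := hodd _ h
      have h4 := ((hS _).1 h).1
      unfold Nat.ModEq at h3 hcN
      omega
    have h3 : c + 1 ∉ S := fun h => by
      have h3 := hodd _ h
      unfold Nat.ModEq at h3 hcN
      omega
    rw [if_neg h2, if_neg h3] at h1
    omega
  have hcle := jordanMult_le_card hn hcu
  have hsum : (∑ k ∈ Finset.Ioc c (Fintype.card ι) with k ≡ Fintype.card ι [MOD 2], jordanMult v k) =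
      (∑ k ∈ Finset.Ioc c (Fintype.card ι) with k ≡ Fintype.card ι [MOD 2], jordanMult u k) +
      ∑ k ∈ Finset.Ioc c (Fintype.card ι) with k ≡ Fintype.card ι [MOD 2],
        ((if k - 1 ∈ S then 1 else 0) + if k + 1 ∈ S then 1 else 0) := by
    rw [← Finset.sum_add_distrib]
    refine Finset.sum_congr rfl fun k hk => ?_
    rw [Finset.mem_filter, Finset.mem_Ioc] at hk
    have h1 := hmult k (by omega)
    rw [if_neg fun h => hodd k h hk.2] at h1
    omega
  -- The parity of the sum above `c` changes exactly when `c ∈ S`, that is, exactly when the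
  -- condition failed for `u`.
  have h1 := sum_neighbours_modEq (Fintype.card ι) S (fun k hk => ⟨hle k hk, hodd k hk⟩)
    ((Fintype.card ι + 1 - c) / 2) c (by simp only [Nat.ModEq] at hcN; omega)
  have h2 := hS c
  rw [hsum]
  generalize (∑ k ∈ Finset.Ioc c (Fintype.card ι) with k ≡ Fintype.card ι [MOD 2],
    jordanMult u k) = A at h2 ⊢
  generalize (∑ k ∈ Finset.Ioc c (Fintype.card ι) with k ≡ Fintype.card ι [MOD 2],
    ((if k - 1 ∈ S then 1 else 0) + if k + 1 ∈ S then 1 else 0)) = B at h1 ⊢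
  by_cases h : c ∈ S
  · have h3 := (h2.1 h).2.2.2
    rw [if_pos h] at h1
    simp only [Nat.ModEq] at *
    omega
  · have h3 : A ≡ Fintype.card ι [MOD 2] := by
      by_contra h4
      exact h (h2.2 ⟨hc, hcN, hcu, h4⟩)
    rw [if_neg h] at h1
    simp only [Nat.ModEq] at *
    omega

end Special

/-! ### Degenerations and the shape of a relative special piece. -/

section SpecialPiece

variable {ι : Type} [Fintype ι] [DecidableEq ι] {H : Submonoid (Matrix ι ι ℂ)} {J : Matrix ι ι ℂ}

theorem continuous_of_polyFunTwo {Ψ : SL(2, ℂ) × SL(2, ℂ) →* H}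
    (h : ∀ i j, (fun x => (Ψ x : Matrix ι ι ℂ) i j) ∈ polyFunTwo) : Continuous Ψ :=
  Continuous.subtype_mk (continuous_matrix fun i j => continuous_of_mem_polyFunTwo (h i j)) _

theorem continuous_upper : Continuous upper :=
  Continuous.subtype_mk (continuous_matrix fun i j => by
    fin_cases i <;> fin_cases j <;> simp <;> fun_prop) _

theorem isConj_map_upper {Ψ : SL(2, ℂ) × SL(2, ℂ) →* H} {x : ℂ} (hx : x ≠ 0) :
    IsConj (Ψ (stdUnipotent, stdUnipotent)) (Ψ (stdUnipotent, upper x)) := by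
  obtain ⟨a, ha⟩ := exists_torus_mul_self (Units.mk0 x hx)
  have h1 : SemiconjBy ((1, torus a) : SL(2, ℂ) × SL(2, ℂ)) (stdUnipotent, stdUnipotent)
      (stdUnipotent, upper x) := by
    refine Prod.ext (by simp) ?_
    simp only [Prod.mk_mul_mk]
    rw [stdUnipotent_eq_upper, torus_mul_upper, mul_one, sq]
    congr 2
    exact congrArg Units.val ha
  exact ⟨Units.map Ψ (toUnits (1, torus a)), h1.map Ψ⟩

/-- For `x ≠ 0` the element `Ψ (stdUnipotent, upper x)` is conjugate to its value at `x = 1` by the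
torus of the second factor; now let `x` tend to zero. -/
theorem mk_mem_closureClasses {Ψ : SL(2, ℂ) × SL(2, ℂ) →* H}
    (h : ∀ i j, (fun x => (Ψ x : Matrix ι ι ℂ) i j) ∈ polyFunTwo)
    (hn : ConjClasses.mk (Ψ (stdUnipotent, 1)) ∈ unipotentClasses H) :
    ConjClasses.mk (Ψ (stdUnipotent, 1)) ∈
      closureClasses (ConjClasses.mk (Ψ (stdUnipotent, stdUnipotent))) := by
  refine ⟨hn, fun y hy => ?_⟩
  obtain ⟨c, hc⟩ := (ConjClasses.mk_eq_mk_iff_isConj.1 (ConjClasses.mem_carrier_iff_mk_eq.1 hy)).symm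
  have h1 : y = c.1 * Ψ (stdUnipotent, upper 0) * c⁻¹.1 := by
    rw [Units.eq_mul_inv_iff_mul_eq, upper_zero]
    exact hc.symm
  have h2 : Continuous fun x : ℂ => c.1 * Ψ (stdUnipotent, upper x) * c⁻¹.1 := by
    have := (continuous_of_polyFunTwo h).comp (continuous_const.prodMk continuous_upper :
      Continuous fun x => (stdUnipotent, upper x))
    exact (continuous_const.mul this).mul continuous_const
  have h3 := (h2.tendsto 0).mono_left (nhdsWithin_le_nhds (s := {0}ᶜ))
  rw [← h1] at h3
  refine mem_closure_of_tendsto h3 ?_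
  filter_upwards [self_mem_nhdsWithin] with x hx
  rw [ConjClasses.mem_carrier_iff_mk_eq, eq_comm, ConjClasses.mk_eq_mk_iff_isConj]
  refine (isConj_map_upper hx).trans ⟨c, ?_⟩
  rw [SemiconjBy, Units.inv_mul_cancel_right]

theorem IsClassicalGroup.conjClasses_eq_of_rank_pow (hH : IsClassicalGroup H J) {a b : H}
    (ha : IsNilpotent ((a : Matrix ι ι ℂ) - 1)) (hb : IsNilpotent ((b : Matrix ι ι ℂ) - 1))
    (h : ∀ m, (((a : Matrix ι ι ℂ) - 1) ^ m).rank = (((b : Matrix ι ι ℂ) - 1) ^ m).rank) :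
    ConjClasses.mk a = ConjClasses.mk b := by
  obtain ⟨k, hk, hconj⟩ := exists_conj_of_rank_pow_eq ha hb h
  refine hH.conjClasses_eq hk ?_
  rw [mul_sub, sub_mul, mul_one, one_mul] at hconj
  exact sub_left_injective hconj

/-- The classes in the relative special piece of a unipotent class. -/
theorem IsClassicalGroup.exists_rank_pow_of_mem_Spc (hH : IsClassicalGroup H J) {u₁ u₂ : H}
    (hn₂ : IsNilpotent ((u₂ : Matrix ι ι ℂ) - 1))
    (h : ConjClasses.mk u₂ ∈ Spc (ConjClasses.mk u₁)) :
    ∃ S : Finset ℕ, (∀ c ∈ S, 1 ≤ c ∧ ¬ c ≡ Fintype.card ι [MOD 2] ∧ 0 < jordanMult u₂.1 c) ∧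
      ∀ m, (((u₁ : Matrix ι ι ℂ) - 1) ^ m).rank =
        (((u₂ : Matrix ι ι ℂ) - 1) ^ m).rank + if m ∈ S then 1 else 0 := by
  classical
  let bad : Finset ℕ := (Finset.Icc 1 (Fintype.card ι)).filter fun c =>
    ¬ c ≡ Fintype.card ι [MOD 2] ∧ 0 < jordanMult u₂.1 c ∧
      ¬ (∑ k ∈ Finset.Ioc c (Fintype.card ι) with k ≡ Fintype.card ι [MOD 2], jordanMult u₂.1 k)
        ≡ Fintype.card ι [MOD 2]
  have hbad : ∀ c, c ∈ bad ↔ 1 ≤ c ∧ ¬ c ≡ Fintype.card ι [MOD 2] ∧ 0 < jordanMult u₂.1 c ∧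
      ¬ (∑ k ∈ Finset.Ioc c (Fintype.card ι) with k ≡ Fintype.card ι [MOD 2], jordanMult u₂.1 k)
        ≡ Fintype.card ι [MOD 2] := by
    intro c
    simp only [bad, Finset.mem_filter, Finset.mem_Icc]
    exact ⟨fun h => ⟨h.1.1, h.2⟩, fun h => ⟨⟨h.1, jordanMult_le_card hn₂ h.2.2.1⟩, h.2⟩⟩
  -- Trading at every violating size yields a special class whose closure contains the class of
  -- `u₂`.
  obtain ⟨Ψ, hpoly, hr, hr'⟩ := hH.exists_hom u₂.2 hn₂ bad fun c hc =>
    ⟨((hbad c).1 hc).1, ((hbad c).1 hc).2.1, ((hbad c).1 hc).2.2.1⟩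
  have hnil := isNilpotent_sub_one_of_rank_pow hn₂ hr'
  have heq : ConjClasses.mk (Ψ (stdUnipotent, 1)) = ConjClasses.mk u₂ :=
    hH.conjClasses_eq_of_rank_pow (isNilpotent_sub_one_of_rank_pow (S := ∅) hn₂ (by simpa using hr))
      hn₂ hr
  have hmem := mk_mem_closureClasses hpoly (by rw [heq]; exact ⟨u₂, hn₂, rfl⟩)
  have hspec : ConjClasses.mk (Ψ (stdUnipotent, stdUnipotent)) ∈ specialClasses H :=
    ⟨_, hnil, isSpecialMatrix_of_rank_pow hn₂ hbad hr', rfl⟩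
  -- Otherwise the closure of this special class would be removed from the special piece, and with
  -- it the class of `u₂`.
  have h1 : ConjClasses.mk u₁ ∈ closureClasses (ConjClasses.mk (Ψ (stdUnipotent, stdUnipotent))) := by
    by_contra h1
    exact h.2 (Set.mem_biUnion (x := ConjClasses.mk (Ψ (stdUnipotent, stdUnipotent))) ⟨hspec, h1⟩
      (heq ▸ hmem))
  -- The ranks of `u₁` lie between those of `u₂` and those raised by one on `bad`, so it suffices to
  -- record where they differ from the former.
  refine ⟨bad.filter fun m => (((u₁ : Matrix ι ι ℂ) - 1) ^ m).rank ≠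
    (((u₂ : Matrix ι ι ℂ) - 1) ^ m).rank, fun c hc => ?_, fun m => ?_⟩
  · have := (hbad c).1 (Finset.mem_filter.1 hc).1
    exact ⟨this.1, this.2.1, this.2.2.1⟩
  · have h2 := rank_pow_le_of_mem_closureClasses h1 m
    have h3 := rank_pow_le_of_mem_closureClasses h.1 m
    rw [hr'] at h2
    simp only [Finset.mem_filter]
    by_cases hb : m ∈ bad
    · rw [if_pos hb] at h2
      split_ifs with h4
      · omega
      · rw [not_and, not_not] at h4
        rw [h4 hb, add_zero]
    · rw [if_neg hb] at h2
      rw [if_neg fun h => hb h.1]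
      omega

end SpecialPiece

/-! ### Weights of representations -/

section Weights

open Module

/-- The multiplicity of the eigenvalue `ν` of `μ • diag(a, a⁻¹)` on the `k`-th symmetric power. -/
def weightMult (a : ℂˣ) (x : ℂ × ℕ) (ν : ℂ) : ℕ :=
  Fintype.card {j : Fin (x.2 + 1) // x.1 * ((a ^ ((x.2 : ℤ) - 2 * (j : ℕ)) : ℂˣ) : ℂ) = ν}

theorem finrank_ker_symMat_torus_sub (a : ℂˣ) (x : ℂ × ℕ) (ν : ℂ) :
    finrank ℂ (LinearMap.ker (x.1 • Matrix.toLin' (symMat x.2 (torus a).1) - ν • 1)) =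
      weightMult a x ν := by
  obtain ⟨μ, k⟩ := x
  let w : Fin (k + 1) → ℂ := fun j => μ * ((a ^ ((k : ℤ) - 2 * (j : ℕ)) : ℂˣ) : ℂ) - ν
  have h1 : μ • Matrix.toLin' (symMat k (torus a).1) - ν • 1 = Matrix.toLin' (Matrix.diagonal w) := by
    rw [coe_torus, symMat_diagonal, Module.End.one_eq_id, ← Matrix.toLin'_one, ← map_smul, ← map_smul,
      ← map_sub]
    congr 1
    ext i j
    by_cases hij : i = j
    · subst hij
      simp only [Matrix.sub_apply, Matrix.smul_apply, Matrix.diagonal_apply_eq, Matrix.one_apply_eq,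
        smul_eq_mul, mul_one, w]
      congr 2
      have hi := i.isLt
      rw [show (k : ℤ) - 2 * (i : ℕ) = ((k - i : ℕ) : ℤ) - ((i : ℕ) : ℤ) by omega, zpow_sub,
        zpow_natCast, zpow_natCast]
      simp
    · simp [Matrix.diagonal_apply_ne _ hij, Matrix.one_apply_ne hij]
  have h2 := rank_add_finrank_ker (Matrix.diagonal w) 1
  rw [pow_one, pow_one, Matrix.rank_diagonal, Fintype.card_fin] at h2
  change finrank ℂ (LinearMap.ker (μ • Matrix.toLin' (symMat k (torus a).1) - ν • 1)) = _
  rw [h1]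
  have h3 := Fintype.card_subtype_compl fun j : Fin (k + 1) => w j = 0
  have h4 := Fintype.card_subtype_le fun j : Fin (k + 1) => w j = 0
  rw [Fintype.card_fin] at h3 h4
  have h5 : weightMult a (μ, k) ν = Fintype.card {j : Fin (k + 1) // w j = 0} :=
    Fintype.card_congr (Equiv.subtypeEquivRight fun j => sub_eq_zero.symm)
  rw [h5]
  have h6 : Fintype.card {j : Fin (k + 1) // w j ≠ 0} = Fintype.card {j : Fin (k + 1) // ¬ w j = 0} :=
    rfl
  change (_ + finrank ℂ (LinearMap.ker (Matrix.toLin' (Matrix.diagonal w))) = _) at h2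
  change finrank ℂ (LinearMap.ker (Matrix.toLin' (Matrix.diagonal w))) = _
  omega

variable {V : Type} [AddCommGroup V] [Module ℂ V] {ρ : SL(2, ℂ) →* End ℂ V} {s : End ℂ V}
  {I : Type} [Fintype I] {d : I → ℂ × ℕ}

theorem IsDecomposition.finrank_ker_weight
    (h : IsDecomposition (dim := fun d => d.2 + 1) repModel (repFamily ρ s) d) (a : ℂˣ) (ν : ℂ) :
    finrank ℂ (LinearMap.ker (s * ρ (torus a) - ν • 1)) = ∑ i, weightMult a (d i) ν := by
  obtain ⟨e, he⟩ := h
  simp only [← finrank_ker_symMat_torus_sub]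
  refine finrank_ker_eq_sum e _ _ fun v i => ?_
  have h1 := he none (ρ (torus a) v) i
  have h2 := he (some (torus a)) v i
  change e (s (ρ (torus a) v)) i = (d i).1 • e (ρ (torus a) v) i at h1
  change e (ρ (torus a) v) i = Matrix.toLin' (symMat (d i).2 (torus a).1) (e v i) at h2
  rw [h2] at h1
  simp [h1]

theorem IsDecomposition.finrank_ker_unipotent_pow
    (h : IsDecomposition (dim := fun d => d.2 + 1) repModel (repFamily ρ s) d) (m : ℕ) :
    finrank ℂ (LinearMap.ker ((ρ stdUnipotent - 1) ^ m)) = ∑ i, min m ((d i).2 + 1) := by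
  obtain ⟨e, he⟩ := h
  have h1 : ∀ k, finrank ℂ (LinearMap.ker (Matrix.toLin' (symMat k stdUnipotent.1 - 1) ^ m)) =
      min m (k + 1) := fun k => by
    have h1 := rank_add_finrank_ker (symMat k stdUnipotent.1 - 1) m
    rw [rank_symMat_stdUnipotent_sub_one_pow, Fintype.card_fin] at h1
    omega
  simp only [← h1]
  refine finrank_ker_eq_sum e _ _ fun v i => ?_
  have h2 : ∀ v i, e ((ρ stdUnipotent - 1) v) i =
      Matrix.toLin' (symMat (d i).2 stdUnipotent.1 - 1) (e v i) := fun v i => by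
    have := he (some stdUnipotent) v i
    change e (ρ stdUnipotent v) i = Matrix.toLin' (symMat (d i).2 stdUnipotent.1) (e v i) at this
    simp [this]
  clear h1
  induction m generalizing v with
  | zero => rfl
  | succ m ih => rw [pow_succ, End.mul_apply, ih, h2, pow_succ, End.mul_apply]


theorem IsDecomposition.fst_eq {I : Type} {d : I → ℂ × ℕ}
    (h : IsDecomposition (dim := fun d => d.2 + 1) repModel (repFamily ρ s) d) {z : ℂ}
    (hs : s = z • 1) (i : I) : (d i).1 = z := by
  classical
  obtain ⟨e, he⟩ := h
  have h1 := he none (e.symm fun _ _ => 1) i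
  change e (s _) i = (d i).1 • e _ i at h1
  rw [hs, LinearMap.smul_apply, map_smul, End.one_apply, e.apply_symm_apply] at h1
  simpa using (congrFun h1 0).symm

theorem isSemisimple_of_eigenbasis {f : End ℂ V} [FiniteDimensional ℂ V] {I : Type}
    (b : Basis I ℂ V) {μ : I → ℂ} (h : ∀ i, f (b i) = μ i • b i) : f.IsSemisimple := by
  classical
  have : Fintype I := FiniteDimensional.fintypeBasisIndex b
  have hsep : (∏ ν ∈ Finset.univ.image μ, (Polynomial.X - Polynomial.C ν)).Separable :=
    Polynomial.separable_prod_X_sub_C_iff'.2 fun _ _ _ _ h => h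
  refine End.isSemisimple_of_squarefree_aeval_eq_zero hsep.squarefree (b.ext fun i => ?_)
  have hp : ∀ p : Polynomial ℂ, Polynomial.aeval f p (b i) = p.eval (μ i) • b i := by
    intro p
    induction p using Polynomial.induction_on' with
    | add p q hp hq => simp [hp, hq, add_smul]
    | monomial n c =>
      have : (f ^ n) (b i) = μ i ^ n • b i := by
        induction n with
        | zero => simp
        | succ n ih => rw [pow_succ, End.mul_apply, h, map_smul, ih, smul_smul, pow_succ, mul_comm]
      simp [Polynomial.aeval_monomial, this, smul_smul, mul_comm]
  rw [hp, Polynomial.eval_prod, Finset.prod_eq_zero (i := μ i)]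
  · simp
  · simp
  · simp

theorem IsAlgebraicRep.isSemisimple_torus [FiniteDimensional ℂ V] (hρ : IsAlgebraicRep ρ)
    (a : ℂˣ) : (ρ (torus a)).IsSemisimple := by
  obtain ⟨I, b, μ, n, h⟩ := exists_weight_basis hρ (s := 1) (by
    rw [End.one_eq_id]; exact End.isSemisimple_id) fun g => Commute.one_right _
  exact isSemisimple_of_eigenbasis b fun i => (h i).2 a

end Weights

/-! ### Families of strings that are determined by their weights -/

section Strings

variable {a : ℂˣ} {z : ℂ}

/-- Since `a` has infinite order, the weights of a string are distinct: exponents in steps of two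
from `e - k` to `e + k`. -/
theorem weightMult_zpow (ha : ∀ n : ℤ, a ^ n = 1 → n = 0) (hz : z ≠ 0) (e : ℤ) (k : ℕ) (j : ℤ) :
    weightMult a (z * ((a ^ e : ℂˣ) : ℂ), k) (z * ((a ^ j : ℂˣ) : ℂ)) =
      if j - e ≤ k ∧ e - j ≤ k ∧ (j - e - k) % 2 = 0 then 1 else 0 := by
  have hiff : ∀ i : Fin (k + 1), z * ((a ^ e : ℂˣ) : ℂ) * ((a ^ ((k : ℤ) - 2 * (i : ℕ)) : ℂˣ) : ℂ) =
      z * ((a ^ j : ℂˣ) : ℂ) ↔ e + (k - 2 * (i : ℕ)) = j := by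
    intro i
    rw [mul_assoc, mul_right_inj' hz, ← Units.val_mul, Units.val_inj, ← zpow_add]
    constructor
    · intro h
      have := ha (e + (k - 2 * (i : ℕ)) - j) (by rw [zpow_sub, h, mul_inv_cancel])
      omega
    · intro h
      rw [h]
  rw [weightMult]
  split_ifs with h
  · rw [Fintype.card_eq_one_iff]
    obtain ⟨t, ht⟩ : ∃ t : ℕ, (k : ℤ) - 2 * t = j - e := ⟨((k - (j - e)) / 2).toNat, by omega⟩
    refine ⟨⟨⟨t, by omega⟩, (hiff _).2 (by simp only; omega)⟩, ?_⟩
    rintro ⟨i, hi⟩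
    have := (hiff i).1 hi
    refine Subtype.ext (Fin.ext ?_)
    simp only
    omega
  · rw [Fintype.card_eq_zero_iff]
    refine ⟨fun ⟨i, hi⟩ => h ?_⟩
    have := (hiff i).1 hi
    have := i.isLt
    omega

theorem weightMult_eq_zero (e : ℤ) (k : ℕ) {ν : ℂ} (hν : ∀ j : ℤ, z * ((a ^ j : ℂˣ) : ℂ) ≠ ν) :
    weightMult a (z * ((a ^ e : ℂˣ) : ℂ), k) ν = 0 := by
  rw [weightMult, Fintype.card_eq_zero_iff]
  refine ⟨fun ⟨i, hi⟩ => hν (e + (k - 2 * (i : ℕ))) ?_⟩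
  rw [zpow_add, Units.val_mul, ← mul_assoc]
  exact hi

theorem weightMult_pos (x : ℂ × ℕ) (ν : ℂ) (i : ℕ) (hi : i ≤ x.2)
    (h : x.1 * ((a ^ ((x.2 : ℤ) - 2 * i) : ℂˣ) : ℂ) = ν) : 1 ≤ weightMult a x ν :=
  Fintype.card_pos_iff.2 ⟨⟨⟨i, by omega⟩, h⟩⟩

variable (a) in
/-- The multiplicity of the weight `ν` in a family of strings. -/
def totalMult (A : Multiset (ℂ × ℕ)) (ν : ℂ) : ℕ := (A.map fun x => weightMult a x ν).sum

theorem totalMult_add (A B : Multiset (ℂ × ℕ)) (ν : ℂ) :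
    totalMult a (A + B) ν = totalMult a A ν + totalMult a B ν := by
  simp [totalMult]

theorem count_le_totalMult (A : Multiset (ℂ × ℕ)) {ν : ℂ} {x : ℂ × ℕ} (h : 1 ≤ weightMult a x ν) :
    A.count x ≤ totalMult a A ν := by
  induction A using Multiset.induction_on with
  | empty => simp
  | cons y A ih =>
    have h1 : totalMult a (y ::ₘ A) ν = weightMult a y ν + totalMult a A ν := by simp [totalMult]
    rw [Multiset.count_cons, h1]
    split_ifs with h2
    · subst h2; omega
    · omega

theorem totalMult_le_count (B : Multiset (ℂ × ℕ)) {ν : ℂ} {x : ℂ × ℕ}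
    (h : ∀ y ∈ B, weightMult a y ν ≤ if y = x then 1 else 0) : totalMult a B ν ≤ B.count x := by
  induction B using Multiset.induction_on with
  | empty => simp [totalMult]
  | cons y A ih =>
    have h1 : totalMult a (y ::ₘ A) ν = weightMult a y ν + totalMult a A ν := by simp [totalMult]
    have h2 := h y (Multiset.mem_cons_self _ _)
    have h3 := ih fun y hy => h y (Multiset.mem_cons_of_mem hy)
    rw [Multiset.count_cons, h1]
    split_ifs at h2 ⊢ with h4 h5 h5
    · omega
    · exact absurd h4.symm h5
    · exact absurd h5.symm h4
    · omega

theorem exists_of_totalMult_pos {B : Multiset (ℂ × ℕ)} {ν : ℂ} (h : 1 ≤ totalMult a B ν) :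
    ∃ y ∈ B, 1 ≤ weightMult a y ν := by
  by_contra! h1
  have : totalMult a B ν = 0 := by
    rw [totalMult, Multiset.sum_eq_zero_iff]
    intro n hn
    obtain ⟨y, hy, rfl⟩ := Multiset.mem_map.1 hn
    exact Nat.lt_one_iff.1 (h1 y hy)
  omega

/-- The string `x` is centred at `z` or, if its length lies in `S`, at `z a` or `z a⁻¹`. -/
def IsCentred (a : ℂˣ) (z : ℂ) (S : Set ℕ) (x : ℂ × ℕ) : Prop :=
  ∃ e : ℤ, x.1 = z * ((a ^ e : ℂˣ) : ℂ) ∧ (e = 0 ∨ ((e = 1 ∨ e = -1) ∧ x.2 + 1 ∈ S))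

variable {S : Set ℕ} {A B : Multiset (ℂ × ℕ)} {k : ℕ}

theorem exists_mem_of_extremal_weight (hW : ∀ ν, totalMult a A ν = totalMult a B ν) {x : ℂ × ℕ}
    (hx : x ∈ A) {ν : ℂ} (h : 1 ≤ weightMult a x ν) : ∃ y ∈ B, 1 ≤ weightMult a y ν := by
  have h2 := count_le_totalMult A h
  rw [hW] at h2
  exact exists_of_totalMult_pos ((Multiset.one_le_count_iff_mem.2 hx).trans h2)

/-- A string with exponents from `j - 2k` to `j` has centre `j - k`. A string of centre `e₁`
containing its top weight bounds this by `e₁ - (k - k₁)` from above; one containing the bottom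
weight bounds it from below likewise. If `k + 1 ∉ S`, off-centre strings are shorter, which absorbs
their shift. -/
theorem centre_eq_zero_or {e₁ e₂ j : ℤ} {k₁ k₂ k : ℕ} (hk₁ : k₁ ≤ k) (hk₂ : k₂ ≤ k)
    (he₁ : e₁ = 0 ∨ ((e₁ = 1 ∨ e₁ = -1) ∧ k₁ + 1 ∈ S))
    (he₂ : e₂ = 0 ∨ ((e₂ = 1 ∨ e₂ = -1) ∧ k₂ + 1 ∈ S))
    (h1 : j - e₁ ≤ k₁) (h2 : e₂ - (j - k - k) ≤ k₂) :
    j - k = 0 ∨ ((j - k = 1 ∨ j - k = -1) ∧ k + 1 ∈ S) := by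
  by_cases hkS : k + 1 ∈ S
  · simp only [hkS, and_true]
    omega
  · have h3 : e₁ = 0 ∨ (e₁ = 1 ∨ e₁ = -1) ∧ k₁ < k := he₁.imp_right fun h =>
      ⟨h.1, lt_of_le_of_ne hk₁ fun h' => hkS (h' ▸ h.2)⟩
    have h4 : e₂ = 0 ∨ (e₂ = 1 ∨ e₂ = -1) ∧ k₂ < k := he₂.imp_right fun h =>
      ⟨h.1, lt_of_le_of_ne hk₂ fun h' => hkS (h' ▸ h.2)⟩
    left
    clear he₁ he₂ hkS
    omega

theorem isCentred_of_totalMult_eq (ha : ∀ n : ℤ, a ^ n = 1 → n = 0) (hz : z ≠ 0)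
    (hB : ∀ x ∈ B, IsCentred a z S x ∧ x.2 ≤ k) (hW : ∀ ν, totalMult a A ν = totalMult a B ν)
    {x : ℂ × ℕ} (hx : x ∈ A) (hxk : x.2 = k) : IsCentred a z S x := by
  obtain ⟨⟨_, k₁⟩, hy₁, hw₁⟩ := exists_mem_of_extremal_weight hW hx
    (ν := x.1 * ((a ^ (k : ℤ) : ℂˣ) : ℂ)) (weightMult_pos x _ 0 (by omega) (by simp [hxk]))
  obtain ⟨⟨_, k₂⟩, hy₂, hw₂⟩ := exists_mem_of_extremal_weight hW hx
    (ν := x.1 * ((a ^ (-k : ℤ) : ℂˣ) : ℂ))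
    (weightMult_pos x _ k (by omega) (by rw [hxk, show (k : ℤ) - 2 * k = -k by ring]))
  obtain ⟨⟨e₁, rfl, he₁⟩, hk₁⟩ := hB _ hy₁
  obtain ⟨⟨e₂, rfl, he₂⟩, hk₂⟩ := hB _ hy₂
  obtain ⟨j, hj⟩ : ∃ j : ℤ, z * ((a ^ j : ℂˣ) : ℂ) = x.1 * ((a ^ (k : ℤ) : ℂˣ) : ℂ) := by
    by_contra! h
    rw [weightMult_eq_zero e₁ k₁ h] at hw₁
    omega
  have hx1 : x.1 = z * ((a ^ (j - k) : ℂˣ) : ℂ) := by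
    rw [zpow_sub, Units.val_mul, ← mul_assoc, hj, mul_assoc, ← Units.val_mul, mul_inv_cancel]
    simp
  rw [← hj, weightMult_zpow ha hz] at hw₁
  rw [hx1, mul_assoc, ← Units.val_mul, ← zpow_add, weightMult_zpow ha hz] at hw₂
  refine ⟨j - k, hx1, ?_⟩
  rw [hxk]
  have h1 : j - e₁ ≤ k₁ := by
    by_contra h
    rw [if_neg fun h' => h h'.1] at hw₁
    omega
  have h2 : e₂ - (j - k - k) ≤ k₂ := by
    by_contra h
    rw [if_neg fun h' => h h'.2.1] at hw₂
    omega
  exact centre_eq_zero_or hk₁ hk₂ he₁ he₂ h1 h2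

/-- An extremal weight of `x` lies in no other string of `B`: strings of smaller or equal length do
not reach it, or miss it by parity, as all lengths in `S` have the same parity. Its multiplicity
bounds the count in `A` from above and that in `B` from below. -/
theorem count_le_count_of_totalMult_eq (ha : ∀ n : ℤ, a ^ n = 1 → n = 0) (hz : z ≠ 0)
    (hS : ∀ c ∈ S, ∀ c' ∈ S, c % 2 = c' % 2)
    (hB : ∀ x ∈ B, IsCentred a z S x ∧ x.2 ≤ k) (hW : ∀ ν, totalMult a A ν = totalMult a B ν)
    (hkS : k + 1 ∈ S) {x : ℂ × ℕ} (hxk : x.2 = k) (hx : IsCentred a z S x) :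
    A.count x ≤ B.count x := by
  obtain ⟨e, hxe, he⟩ := hx
  have hx : x = (z * ((a ^ e : ℂˣ) : ℂ), k) := Prod.ext hxe hxk
  -- The weight farther from `z` is chosen when `x` is off-centre; either end serves when `e = 0`.
  obtain ⟨j, hj, hje⟩ : ∃ j : ℤ, (j = k ∨ j = -k) ∧ (e = 0 ∨ e = 1 ∧ j = k ∨ e = -1 ∧ j = -k) := by
    rcases he with h | ⟨h | h, -⟩
    · exact ⟨k, Or.inl rfl, Or.inl h⟩
    · exact ⟨k, Or.inl rfl, Or.inr (Or.inl ⟨h, rfl⟩)⟩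
    · exact ⟨-k, Or.inr rfl, Or.inr (Or.inr ⟨h, rfl⟩)⟩
  have h1 : 1 ≤ weightMult a x (z * ((a ^ (e + j) : ℂˣ) : ℂ)) := by
    rw [hx, weightMult_zpow ha hz, if_pos (by omega)]
  refine (count_le_totalMult _ h1).trans ?_
  rw [hW]
  refine totalMult_le_count _ fun y hyB => ?_
  obtain ⟨⟨e', hye, he'⟩, hyk⟩ := hB y hyB
  obtain ⟨y₁, k'⟩ := y
  simp only at hyk he' hye
  subst hye
  rw [weightMult_zpow ha hz]
  split_ifs with h2 h3
  · exact le_rfl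
  · exfalso
    apply h3
    have h4 : k' = k ∧ e' = e := by
      rcases he' with h | ⟨h, hk'⟩
      · omega
      · have := hS _ hk' _ hkS
        omega
    rw [h4.1, h4.2, hx]
  · exact Nat.zero_le _
  · exact le_rfl

theorem filter_eq_replicate (hkS : k + 1 ∉ S) {C : Multiset (ℂ × ℕ)}
    (hC : ∀ x ∈ C, x.2 = k → IsCentred a z S x) : (C.filter fun x => x.2 = k) =
      Multiset.replicate (C.filter fun x => x.2 = k).card (z, k) := by
  refine Multiset.eq_replicate_card.2 fun x hx => ?_
  obtain ⟨hxC, hxk⟩ := Multiset.mem_filter.1 hx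
  obtain ⟨e, hxe, he⟩ := hC x hxC hxk
  rw [hxk] at he
  have : e = 0 := he.resolve_right fun h => hkS h.2
  subst this
  exact Prod.ext (by simpa using hxe) hxk

/-- If `k + 1 ∈ S`, the inequality of counts and the equality of cardinalities suffice; otherwise
all strings of this length are centred at `z` and only their number matters. -/
theorem filter_eq_of_totalMult_eq (ha : ∀ n : ℤ, a ^ n = 1 → n = 0) (hz : z ≠ 0)
    (hS : ∀ c ∈ S, ∀ c' ∈ S, c % 2 = c' % 2)
    (hB : ∀ x ∈ B, IsCentred a z S x ∧ x.2 ≤ k) (hW : ∀ ν, totalMult a A ν = totalMult a B ν)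
    (hcard : (A.filter fun x => x.2 = k).card = (B.filter fun x => x.2 = k).card) :
    (A.filter fun x => x.2 = k) = B.filter fun x => x.2 = k := by
  have hA : ∀ x ∈ A, x.2 = k → IsCentred a z S x := fun x hx hxk =>
    isCentred_of_totalMult_eq ha hz hB hW hx hxk
  by_cases hkS : k + 1 ∈ S
  · refine Multiset.eq_of_le_of_card_le (Multiset.le_iff_count.2 fun x => ?_) hcard.ge
    by_cases hx : x ∈ A.filter fun x => x.2 = k
    · obtain ⟨hxA, hxk⟩ := Multiset.mem_filter.1 hx
      rw [Multiset.count_filter_of_pos (p := fun x : ℂ × ℕ => x.2 = k) hxk,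
        Multiset.count_filter_of_pos (p := fun x : ℂ × ℕ => x.2 = k) hxk]
      exact count_le_count_of_totalMult_eq ha hz hS hB hW hkS hxk (hA x hxA hxk)
    · rw [Multiset.count_eq_zero_of_notMem hx]
      exact Nat.zero_le _
  · rw [filter_eq_replicate hkS hA, filter_eq_replicate hkS fun x hx _ => (hB x hx).1, hcard]

/-- A family of strings is determined by its weights and lengths if it has the same weights and
lengths as a family of centred strings. -/
theorem eq_of_totalMult_eq (ha : ∀ n : ℤ, a ^ n = 1 → n = 0) (hz : z ≠ 0)
    (hS : ∀ c ∈ S, ∀ c' ∈ S, c % 2 = c' % 2) (hB : ∀ x ∈ B, IsCentred a z S x)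
    (hW : ∀ ν, totalMult a A ν = totalMult a B ν)
    (hcard : ∀ k, (A.filter fun x => x.2 = k).card = (B.filter fun x => x.2 = k).card) : A = B := by
  -- Downward induction on the length: `K` exceeds all lengths and `t` counts the top lengths
  -- already matched. Removing matched strings preserves the equality of weights.
  suffices key : ∀ t K : ℕ, (∀ x ∈ A + B, x.2 < K) →
      (A.filter fun x => K ≤ x.2 + t) = B.filter fun x => K ≤ x.2 + t by
    obtain ⟨K, hK⟩ : ∃ K, ∀ x ∈ A + B, x.2 < K := by
      refine ⟨((A + B).map Prod.snd).sum + 1, fun x hx => Nat.lt_succ_of_le ?_⟩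
      exact Multiset.le_sum_of_mem (Multiset.mem_map_of_mem _ hx)
    have := key K K hK
    rwa [Multiset.filter_eq_self.2 (by simp), Multiset.filter_eq_self.2 (by simp)] at this
  intro t K hK
  induction t with
  | zero =>
    rw [Multiset.filter_eq_nil.2, Multiset.filter_eq_nil.2]
    · intro x hx
      have := hK x (Multiset.mem_add.2 (Or.inr hx))
      omega
    · intro x hx
      have := hK x (Multiset.mem_add.2 (Or.inl hx))
      omega
  | succ t ih =>
    by_cases htK : K ≤ t
    · rw [Multiset.filter_eq_self.2 fun x _ => by omega,
        Multiset.filter_eq_self.2 fun x _ => by omega] at ih ⊢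
      exact ih
    obtain ⟨k, hk⟩ : ∃ k, k + (t + 1) = K := ⟨K - (t + 1), by omega⟩
    have hsplit : ∀ C : Multiset (ℂ × ℕ), (C.filter fun x => K ≤ x.2 + (t + 1)) =
        (C.filter fun x => x.2 = k) + C.filter fun x => K ≤ x.2 + t := by
      intro C
      ext x
      simp only [Multiset.count_add, Multiset.count_filter]
      split_ifs <;> omega
    have hsplit' : ∀ (C : Multiset (ℂ × ℕ)) ν, totalMult a C ν =
        totalMult a (C.filter fun x => x.2 ≤ k) ν +
          totalMult a (C.filter fun x => K ≤ x.2 + t) ν := by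
      intro C ν
      rw [← totalMult_add]
      congr 1
      ext x
      simp only [Multiset.count_add, Multiset.count_filter]
      split_ifs <;> omega
    have hfil : ∀ C : Multiset (ℂ × ℕ), ((C.filter fun x => x.2 ≤ k).filter fun x => x.2 = k) =
        C.filter fun x => x.2 = k := fun C => by
      rw [Multiset.filter_filter]
      exact Multiset.filter_congr fun x _ => by omega
    rw [hsplit, hsplit, ih, ← hfil A, ← hfil B]
    congr 1
    refine filter_eq_of_totalMult_eq ha hz hS (fun x hx => ?_) (fun ν => ?_) ?_
    · obtain ⟨h1, h2⟩ := Multiset.mem_filter.1 hx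
      exact ⟨hB x h1, h2⟩
    · have := hW ν
      rw [hsplit' A, hsplit' B, ih] at this
      omega
    · rw [hfil, hfil, hcard]

end Strings

/-! ### Matrix representations of `SL₂(ℂ)` -/

section MatrixRep

open Module

variable {ι : Type} [Fintype ι] [DecidableEq ι]

/-- The representation on column vectors. -/
def repOf (f : SL(2, ℂ) →* Matrix ι ι ℂ) : SL(2, ℂ) →* End ℂ (ι → ℂ) :=
  (Matrix.toLinAlgEquiv' : Matrix ι ι ℂ ≃ₐ[ℂ] _).toMulEquiv.toMonoidHom.comp f

theorem repOf_apply (f : SL(2, ℂ) →* Matrix ι ι ℂ) (g : SL(2, ℂ)) :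
    repOf f g = Matrix.toLin' (f g) := rfl

theorem isAlgebraicRep_repOf {f : SL(2, ℂ) →* Matrix ι ι ℂ}
    (hf : ∀ i j, IsPolyFun fun g => f g i j) : IsAlgebraicRep (repOf f) := by
  intro ξ x
  have h : (fun g => ξ (repOf f g x)) =
      fun g => ∑ i, (∑ j, f g i j * x j) * ξ (Pi.single i 1) := by
    funext g
    have h1 := congrArg ξ ((Pi.basisFun ℂ ι).sum_repr (repOf f g x))
    rw [map_sum] at h1
    rw [← h1]
    refine Finset.sum_congr rfl fun i _ => ?_
    rw [map_smul, smul_eq_mul, Pi.basisFun_repr, Pi.basisFun_apply]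
    rfl
  rw [h]
  exact IsPolyFun.sum _ fun i _ => (IsPolyFun.sum _ fun j _ =>
    (hf i j).mul (isPolyFun_const _)).mul (isPolyFun_const _)

variable {f f' : SL(2, ℂ) →* Matrix ι ι ℂ} {s s' : Matrix ι ι ℂ} {I : Type} [Fintype I]
  {d : I → ℂ × ℕ}

theorem jordanMult_eq_card_of_isDecomposition {T : End ℂ (ι → ℂ)}
    (h : IsDecomposition (dim := fun d => d.2 + 1) repModel (repFamily (repOf f) T) d)
    {c : ℕ} (hc : 1 ≤ c) :
    jordanMult (f stdUnipotent) c = Nat.card {i // (d i).2 + 1 = c} := by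
  refine jordanMult_eq_card (fun m => ?_) hc
  have hsum : ∑ i, ((d i).2 + 1) = Fintype.card ι := by
    obtain ⟨e, -⟩ := h
    have := e.finrank_eq
    rw [Module.finrank_fintype_fun_eq_card, Module.finrank_pi_fintype] at this
    simpa using this.symm
  have h1 := rank_add_finrank_ker (f stdUnipotent - 1) m
  have h2 := h.finrank_ker_unipotent_pow m
  have h3 := sum_min_add_sum_tsub (fun i => (d i).2 + 1) m
  have h4 : repOf f stdUnipotent - 1 = Matrix.toLin' (f stdUnipotent - 1) := by
    rw [map_sub, Matrix.toLin'_one]; rfl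
  rw [h4] at h2
  rw [h2] at h1
  omega

theorem exists_isUnit_conj {T T' : End ℂ (ι → ℂ)} {I' : Type} [Fintype I'] {d' : I' → ℂ × ℕ}
    (h : IsDecomposition (dim := fun d => d.2 + 1) repModel (repFamily (repOf f) T) d)
    (h' : IsDecomposition (dim := fun d => d.2 + 1) repModel (repFamily (repOf f') T') d')
    (hcount : ∀ x, Nat.card {i // d i = x} = Nat.card {i // d' i = x}) :
    ∃ k : Matrix ι ι ℂ, IsUnit k ∧ k * LinearMap.toMatrix' T = LinearMap.toMatrix' T' * k ∧
      ∀ g, k * f g = f' g * k := by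
  obtain ⟨e, he⟩ := h.exists_equiv h' hcount
  refine ⟨LinearMap.toMatrix' e.toLinearMap, ?_, ?_, fun g => ?_⟩
  · refine IsUnit.of_mul_eq_one (LinearMap.toMatrix' e.symm.toLinearMap) ?_
    rw [← LinearMap.toMatrix'_mul, ← LinearMap.toMatrix'_one]
    congr 1
    ext; simp
  · rw [← LinearMap.toMatrix'_mul, ← LinearMap.toMatrix'_mul]
    congr 1
    exact LinearMap.ext fun v => he none v
  · apply Matrix.toLin'.injective
    rw [Matrix.toLin'_mul, Matrix.toLin'_mul, Matrix.toLin'_toMatrix']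
    exact LinearMap.ext fun v => he (some g) v

theorem exists_isDecomposition_repOf (hf : ∀ i j, IsPolyFun fun g => f g i j)
    (hs : End.IsSemisimple (Matrix.toLin' s)) (hcomm : ∀ g, Commute (f g) s) :
    ∃ (I : Type) (_ : Fintype I) (d : I → ℂ × ℕ), IsDecomposition (dim := fun d => d.2 + 1)
      repModel (repFamily (repOf f) (Matrix.toLin' s)) d :=
  exists_isDecomposition_repFamily (isAlgebraicRep_repOf hf) hs fun g => by
    exact (hcomm g).map (Matrix.toLinAlgEquiv' : Matrix ι ι ℂ ≃ₐ[ℂ] _)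

theorem isSemisimple_toLin'_smul_one (c : ℂ) :
    End.IsSemisimple (Matrix.toLin' (c • (1 : Matrix ι ι ℂ))) :=
  isSemisimple_of_eigenbasis (Pi.basisFun ℂ ι) (μ := fun _ => c) fun i => by simp

/-- Algebraic representations of `SL₂(ℂ)` are determined by the image of a unipotent element. -/
theorem exists_isUnit_conj_of_jordanMult (hf : ∀ i j, IsPolyFun fun g => f g i j)
    (hf' : ∀ i j, IsPolyFun fun g => f' g i j)
    (h : ∀ c, jordanMult (f stdUnipotent) c = jordanMult (f' stdUnipotent) c) :
    ∃ k : Matrix ι ι ℂ, IsUnit k ∧ ∀ g, k * f g = f' g * k := by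
  -- With the identity as the commuting operator, the summands are distinguished by their lengths
  -- alone.
  have hs := isSemisimple_toLin'_smul_one (ι := ι) 1
  obtain ⟨I, _, d, hd⟩ := exists_isDecomposition_repOf hf hs fun g => by simp
  obtain ⟨I', _, d', hd'⟩ := exists_isDecomposition_repOf hf' hs fun g => by simp
  have h1 : Matrix.toLin' ((1 : ℂ) • (1 : Matrix ι ι ℂ)) = (1 : ℂ) • 1 := by
    rw [map_smul, Matrix.toLin'_one]; rfl
  obtain ⟨k, hk, -, hk'⟩ := exists_isUnit_conj hd hd' fun x => by
    have h2 : ∀ {J : Type} [Fintype J] (d : J → ℂ × ℕ), (∀ i, (d i).1 = 1) →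
        Nat.card {i // d i = x} = if x.1 = 1 then Nat.card {i // (d i).2 + 1 = x.2 + 1} else 0 := by
      intro J _ d hd
      split_ifs with hx
      · refine Nat.card_congr (Equiv.subtypeEquivRight fun i => ?_)
        rw [Prod.ext_iff, hd, hx]
        simp
      · have : IsEmpty {i // d i = x} := ⟨fun i => hx (i.2 ▸ hd i.1)⟩
        exact Nat.card_of_isEmpty
    rw [h2 d (hd.fst_eq h1), h2 d' (hd'.fst_eq h1),
      ← jordanMult_eq_card_of_isDecomposition hd (by omega), h,
      ← jordanMult_eq_card_of_isDecomposition hd' (by omega)]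
  exact ⟨k, hk, hk'⟩

/-! #### Weights and lengths of a decomposition -/

theorem totalMult_map_eq {V : Type} [AddCommGroup V] [Module ℂ V] {ρ : SL(2, ℂ) →* End ℂ V}
    {T : End ℂ V} (h : IsDecomposition (dim := fun d => d.2 + 1) repModel (repFamily ρ T) d)
    (a : ℂˣ) (ν : ℂ) : totalMult a (Finset.univ.val.map d) ν =
      finrank ℂ (LinearMap.ker (T * ρ (torus a) - ν • 1)) := by
  rw [h.finrank_ker_weight, totalMult, Multiset.map_map]
  rfl

theorem card_filter_map_eq {T : End ℂ (ι → ℂ)}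
    (h : IsDecomposition (dim := fun d => d.2 + 1) repModel (repFamily (repOf f) T) d) (k : ℕ) :
    ((Finset.univ.val.map d).filter fun x => x.2 = k).card =
      jordanMult (f stdUnipotent) (k + 1) := by
  classical
  rw [jordanMult_eq_card_of_isDecomposition h (by omega), Multiset.filter_map, Multiset.card_map,
    Nat.card_eq_fintype_card, Fintype.card_subtype]
  simp only [add_left_inj]
  rfl

theorem count_map_eq_card (x : ℂ × ℕ) :
    (Finset.univ.val.map d).count x = Nat.card {i // d i = x} := by
  classical
  rw [Multiset.count_map, Nat.card_eq_fintype_card, Fintype.card_subtype]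
  simp only [eq_comm]
  rfl

end MatrixRep

/-! ### The reference family of centred strings. -/

section Reference

variable {a : ℂˣ} {z : ℂ} {S : Finset ℕ}

theorem totalMult_sum (f : ℕ → Multiset (ℂ × ℕ)) (M : ℕ) (ν : ℂ) :
    totalMult a (∑ k ∈ Finset.range M, f k) ν = ∑ k ∈ Finset.range M, totalMult a (f k) ν := by
  induction M with
  | zero => simp [totalMult]
  | succ M ih => rw [Finset.sum_range_succ, Finset.sum_range_succ, totalMult_add, ih]

theorem totalMult_replicate (n : ℕ) (x : ℂ × ℕ) (ν : ℂ) :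
    totalMult a (Multiset.replicate n x) ν = n * weightMult a x ν := by
  simp [totalMult]

theorem sum_filter_snd_eq (D : Multiset (ℂ × ℕ)) {M : ℕ} (hD : ∀ x ∈ D, x.2 < M) :
    ∑ k ∈ Finset.range M, (D.filter fun x => x.2 = k) = D := by
  classical
  ext x
  rw [Multiset.count_sum']
  simp only [Multiset.count_filter]
  rw [Finset.sum_ite_eq]
  split_ifs with h
  · rfl
  · exact (Multiset.count_eq_zero_of_notMem fun hx => h (Finset.mem_range.2 (hD x hx))).symm

theorem card_filter_sum (f : ℕ → Multiset (ℂ × ℕ)) (hf : ∀ k, ∀ x ∈ f k, x.2 = k) (M k : ℕ) :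
    ((∑ j ∈ Finset.range M, f j).filter fun x => x.2 = k).card = if k < M then (f k).card else 0 := by
  induction M with
  | zero => simp
  | succ M ih =>
    rw [Finset.sum_range_succ, Multiset.filter_add, Multiset.card_add, ih]
    by_cases hk : k = M
    · subst hk
      rw [if_neg (lt_irrefl k), if_pos (Nat.lt_succ_self k), zero_add,
        Multiset.filter_eq_self.2 (hf k)]
    · rw [Multiset.filter_eq_nil.2 fun x hx h => hk (by rw [← h, hf M x hx]), Multiset.card_zero,
        add_zero]
      congr 1
      exact propext (by omega)

/-- This is the character of Sym^k ⊗ ℂ² = Sym^(k+1) ⊕ Sym^(k-1), the last summand being absent for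
`k = 0`. -/
theorem weightMult_add_weightMult (ha : ∀ n : ℤ, a ^ n = 1 → n = 0) (hz : z ≠ 0) (k : ℕ) (ν : ℂ) :
    weightMult a (z * ((a ^ (1 : ℤ) : ℂˣ) : ℂ), k) ν +
      weightMult a (z * ((a ^ (-1 : ℤ) : ℂˣ) : ℂ), k) ν =
    weightMult a (z, k + 1) ν + if k = 0 then 0 else weightMult a (z, k - 1) ν := by
  have h0 : ∀ k ν, weightMult a (z, k) ν = weightMult a (z * ((a ^ (0 : ℤ) : ℂˣ) : ℂ), k) ν := by
    simp
  rw [h0, h0]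
  by_cases hν : ∃ j : ℤ, z * ((a ^ j : ℂˣ) : ℂ) = ν
  · obtain ⟨j, rfl⟩ := hν
    rw [weightMult_zpow ha hz, weightMult_zpow ha hz, weightMult_zpow ha hz, weightMult_zpow ha hz]
    split_ifs <;> omega
  · push Not at hν
    simp only [weightMult_eq_zero _ _ hν, ite_self]

theorem sum_shift (s f : ℕ → ℕ) (M : ℕ) (h0 : s 0 = 0) (hM : ∀ c, M ≤ c → s c = 0) :
    ∑ k ∈ Finset.range M, (s k + s (k + 2)) * f k =
      ∑ k ∈ Finset.range M, s (k + 1) * (f (k + 1) + if k = 0 then 0 else f (k - 1)) := by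
  simp only [add_mul, mul_add, Finset.sum_add_distrib]
  congr 1
  · have h1 := Finset.sum_range_succ (fun k => s k * f k) M
    rw [Finset.sum_range_succ', h0, hM M le_rfl] at h1
    simpa using h1.symm
  · have h1 := Finset.sum_range_succ' (fun k => s (k + 1) * if k = 0 then 0 else f (k - 1)) M
    rw [Finset.sum_range_succ, hM (M + 1) (by omega)] at h1
    simpa using h1.symm

/-- The strings of an algebraic representation of `SL₂(ℂ) × SL₂(ℂ)` under the first factor and a
diagonal element of the second factor, given those of the diagonal. -/
theorem exists_centred (ha : ∀ n : ℤ, a ^ n = 1 → n = 0) (hz : z ≠ 0) {m m₁ : ℕ → ℕ} {M : ℕ}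
    (hS : ∀ c ∈ S, 1 ≤ c ∧ c < M ∧ 2 ≤ m c) (hmM : ∀ c, M < c → m c = 0)
    (hm : ∀ c, 1 ≤ c → m₁ c + 2 * (if c ∈ S then 1 else 0) = m c +
      ((if c - 1 ∈ S then 1 else 0) + if c + 1 ∈ S then 1 else 0))
    {D : Multiset (ℂ × ℕ)} (hD : ∀ x ∈ D, x.1 = z) (hDM : ∀ x ∈ D, x.2 < M)
    (hDc : ∀ k, (D.filter fun x => x.2 = k).card = m₁ (k + 1)) :
    ∃ B : Multiset (ℂ × ℕ), (∀ x ∈ B, IsCentred a z S x) ∧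
      (∀ ν, totalMult a D ν = totalMult a B ν) ∧
      ∀ k, (B.filter fun x => x.2 = k).card = m (k + 1) := by
  let s : ℕ → ℕ := fun c => if c ∈ S then 1 else 0
  -- For `k + 1 ∈ S`, two strings are moved from `z` to `z a` and `z a⁻¹`, the effect of the
  -- diagonal element of the second factor on ℂ².
  let b : ℕ → Multiset (ℂ × ℕ) := fun k =>
    Multiset.replicate (m (k + 1) - 2 * s (k + 1)) (z, k) +
      (Multiset.replicate (s (k + 1)) (z * ((a ^ (1 : ℤ) : ℂˣ) : ℂ), k) +
        Multiset.replicate (s (k + 1)) (z * ((a ^ (-1 : ℤ) : ℂˣ) : ℂ), k))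
  have hs2 : ∀ c, 2 * s c ≤ m c := fun c => by
    simp only [s]
    split_ifs with h
    · exact (hS c h).2.2
    · exact Nat.zero_le _
  have hb : ∀ k, ∀ x ∈ b k, x.2 = k ∧ IsCentred a z S x := by
    intro k x hx
    have hmem : s (k + 1) ≠ 0 → k + 1 ∈ S := fun h => by
      by_contra h'
      exact h (if_neg h')
    simp only [b, Multiset.mem_add, Multiset.mem_replicate] at hx
    rcases hx with ⟨-, rfl⟩ | ⟨h, rfl⟩ | ⟨h, rfl⟩
    · exact ⟨rfl, 0, by simp, Or.inl rfl⟩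
    · exact ⟨rfl, 1, rfl, Or.inr ⟨Or.inl rfl, hmem h⟩⟩
    · exact ⟨rfl, -1, rfl, Or.inr ⟨Or.inr rfl, hmem h⟩⟩
  refine ⟨∑ k ∈ Finset.range M, b k, fun x hx => ?_, fun ν => ?_, fun k => ?_⟩
  · obtain ⟨k, -, hk⟩ := Multiset.mem_sum.1 hx
    exact (hb k x hk).2
  · rw [totalMult_sum]
    conv_lhs => rw [← sum_filter_snd_eq D hDM, totalMult_sum]
    have h1 : ∀ k, totalMult a (D.filter fun x => x.2 = k) ν =
        (m (k + 1) - 2 * s (k + 1)) * weightMult a (z, k) ν +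
          (s k + s (k + 2)) * weightMult a (z, k) ν := by
      intro k
      rw [filter_eq_replicate (a := a) (z := z) (S := ∅) (by simp) fun x hx _ =>
        ⟨0, by simpa using hD x hx, Or.inl rfl⟩, totalMult_replicate, hDc, ← add_mul]
      congr 1
      have h2 := hm (k + 1) (by omega)
      have h3 := hs2 (k + 1)
      simp only [s, Nat.add_sub_cancel] at h2 h3 ⊢
      rw [show k + 1 + 1 = k + 2 from rfl] at h2
      omega
    have h2 : ∀ k, totalMult a (b k) ν = (m (k + 1) - 2 * s (k + 1)) * weightMult a (z, k) ν +
        s (k + 1) * (weightMult a (z, k + 1) ν + if k = 0 then 0 else weightMult a (z, k - 1) ν) := by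
      intro k
      rw [totalMult_add, totalMult_add, totalMult_replicate, totalMult_replicate,
        totalMult_replicate, ← mul_add, weightMult_add_weightMult ha hz]
    simp only [h1, h2, Finset.sum_add_distrib]
    congr 1
    refine sum_shift s (fun k => weightMult a (z, k) ν) M ?_ fun c hc => if_neg fun h => ?_
    · exact if_neg fun h => by have := (hS 0 h).1; omega
    · have := (hS c h).2.1
      omega
  · rw [card_filter_sum b (fun k x hx => (hb k x hx).1)]
    split_ifs with h
    · have := hs2 (k + 1)
      simp only [b, Multiset.card_add, Multiset.card_replicate]
      omega
    · exact (hmM _ (by omega)).symm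

end Reference

/-! ### Unramified parameters -/

section PolyComp

theorem isPolyFun_comp {f : SL(2, ℂ) × SL(2, ℂ) → ℂ} (hf : f ∈ polyFunTwo)
    {σ : SL(2, ℂ) → SL(2, ℂ) × SL(2, ℂ)} (h1 : ∀ i j, IsPolyFun fun g => (σ g).1.1 i j)
    (h2 : ∀ i j, IsPolyFun fun g => (σ g).2.1 i j) : IsPolyFun fun g => f (σ g) := by
  obtain ⟨p, hp⟩ := mem_polyFunTwo.1 hf
  have h3 : (fun g => f (σ g)) = fun g => p.eval
      (Sum.elim (fun a => (σ g).1.1 a.1 a.2) (fun a => (σ g).2.1 a.1 a.2)) :=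
    funext fun g => hp (σ g).1 (σ g).2
  rw [h3]
  clear h3 hp
  induction p using MvPolynomial.induction_on with
  | C a => simpa using isPolyFun_const a
  | add p q hp hq => simpa using hp.add hq
  | mul_X p i hp =>
    cases i with
    | inl i => simpa using hp.mul (h1 i.1 i.2)
    | inr i => simpa using hp.mul (h2 i.1 i.2)

end PolyComp

section Weil

variable (F : Type*) [Field F] [ValuativeRel F] [TopologicalSpace F] [IsNonarchimedeanLocalField F]

/-- The square root of the cardinality of the residue field. -/
def sqrtCard : ℂˣ :=
  Units.mk0 ((√(residueCard F : ℝ) : ℝ) : ℂ)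
    (by exact_mod_cast (Real.sqrt_pos.2 (by exact_mod_cast residueCard_pos F)).ne')

theorem eq_zero_of_sqrtCard_zpow_eq_one (n : ℤ) (h : sqrtCard F ^ n = 1) : n = 0 := by
  have h1 : (√(residueCard F : ℝ)) ^ n = 1 := by
    have h0 : (((√(residueCard F : ℝ) : ℝ) : ℂ)) ^ n = 1 := by
      have h0 := congrArg Units.val h
      rw [Units.val_zpow_eq_zpow_val] at h0
      exact h0
    exact_mod_cast h0
  have h2 : 1 < √(residueCard F : ℝ) := by
    rw [Real.lt_sqrt zero_le_one]
    simpa using one_lt_residueCard F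
  exact zpow_right_injective₀ (by linarith) h2.ne' (by simpa using h1)

variable {F}

theorem exists_weilTorus_eq_torus (w : WeilGroup F) : ∃ a : ℂˣ, weilTorus F w = torus a :=
  ⟨Units.mk0 ((√(weilNorm w) : ℝ) : ℂ)
    (by exact_mod_cast (Real.sqrt_pos.2 (weilNorm_pos w)).ne'), rfl⟩

theorem weilTorus_of_mem_frobenius {w : WeilGroup F} (hw : w ∈ frobenius F) :
    weilTorus F w = torus (sqrtCard F) := by
  have h : weilNorm w = residueCard F := by
    rw [weilNorm, show weilDeg w = 1 from hw, zpow_one]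
  refine Subtype.ext ?_
  change !![((√(weilNorm w) : ℝ) : ℂ), 0; 0, ((√(weilNorm w) : ℝ) : ℂ)⁻¹] = _
  rw [h]
  rfl

theorem weilTorus_of_mem_inertia {w : WeilGroup F} (hw : w ∈ inertia F) : weilTorus F w = 1 := by
  have h : weilNorm w = 1 := by
    rw [weilNorm, show weilDeg w = 0 from hw, zpow_zero]
  refine Subtype.ext ?_
  change !![((√(weilNorm w) : ℝ) : ℂ), 0; 0, ((√(weilNorm w) : ℝ) : ℂ)⁻¹] = 1
  rw [h]
  simp [Matrix.one_fin_two]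

theorem continuous_weilTorus : Continuous (weilTorus F) := by
  let r : Multiplicative ℤ → ℂ := fun n => ((√((residueCard F : ℝ) ^ n.toAdd) : ℝ) : ℂ)
  have h : ∀ f : Multiplicative ℤ → Matrix (Fin 2) (Fin 2) ℂ, Continuous fun w => f (weilDegHom F w) :=
    fun f => continuous_of_discreteTopology.comp continuous_weilDegHom
  exact Continuous.subtype_mk (h fun n => !![r n, 0; 0, (r n)⁻¹]) _

theorem eq_on_weilGroup {M : Type*} [Monoid M] {f f' : WeilGroup F →* M} {v : WeilGroup F}
    (hv : v ∈ frobenius F) (h : f v = f' v) (hi : ∀ i ∈ inertia F, f i = f' i) (w : WeilGroup F) :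
    f w = f' w := by
  obtain ⟨i, hi', hw⟩ := exists_eq_zpow_mul hv w
  have h1 : v ∈ f.eqLocus f' := h
  have h2 : w ∈ f.eqLocus f' := hw ▸ mul_mem (zpow_mem h1 _) (hi i hi')
  exact h2

theorem semiconj_on_weilGroup {M : Type*} [Monoid M] {f f' : WeilGroup F →* M} {k : M}
    {v : WeilGroup F} (hv : v ∈ frobenius F) (h : SemiconjBy k (f v) (f' v))
    (hi : ∀ i ∈ inertia F, SemiconjBy k (f i) (f' i)) (w : WeilGroup F) :
    SemiconjBy k (f w) (f' w) := by
  let L : Subgroup (WeilGroup F) :=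
    { carrier := {w | SemiconjBy k (f w) (f' w)}
      one_mem' := by simp
      mul_mem' := fun {a b} ha hb => by
        simp only [Set.mem_ofPred_eq, map_mul] at *
        exact ha.mul_right hb
      inv_mem' := fun {a} ha => by
        have h1 : f a * f a⁻¹ = 1 := by rw [← map_mul, mul_inv_cancel, map_one]
        have h2 : f' a⁻¹ * f' a = 1 := by rw [← map_mul, inv_mul_cancel, map_one]
        change k * f a⁻¹ = f' a⁻¹ * k
        calc k * f a⁻¹ = f' a⁻¹ * (f' a * k) * f a⁻¹ := by rw [← mul_assoc, h2, one_mul]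
          _ = f' a⁻¹ * (k * f a) * f a⁻¹ := by rw [ha.eq]
          _ = f' a⁻¹ * k := by simp only [mul_assoc, h1, mul_one] }
  obtain ⟨i, hi', hw⟩ := exists_eq_zpow_mul hv w
  have h1 : v ∈ L := h
  have h2 : w ∈ L := hw ▸ mul_mem (zpow_mem h1 _) (show i ∈ L from hi i hi')
  exact h2

end Weil

/-! ### Twisting by the unramified character of sign `z`. -/

section Twist

open Module

variable {F : Type*} [Field F] [ValuativeRel F] [TopologicalSpace F] [IsNonarchimedeanLocalField F]
  {ι : Type} [Fintype ι] [DecidableEq ι] {H : Submonoid (Matrix ι ι ℂ)}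

variable (ι) in
/-- Signs as scalar matrices. -/
def signMat : ℤˣ →* Matrix ι ι ℂ where
  toFun ζ := ((ζ : ℤ) : ℂ) • 1
  map_one' := by simp
  map_mul' ζ ξ := by simp [smul_smul, mul_comm]

theorem signMat_apply (ζ : ℤˣ) : signMat ι ζ = ((ζ : ℤ) : ℂ) • 1 := rfl

theorem signMat_zpow_mem {z : ℤˣ} (hz : signMat ι z ∈ H) (n : ℤ) : signMat ι (z ^ n) ∈ H := by
  rcases Int.units_eq_one_or (z ^ n) with h | h
  · rw [h, map_one]
    exact H.one_mem
  · rcases Int.units_eq_one_or z with h' | h'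
    · rw [h', one_zpow] at h
      exact absurd h (by decide)
    · rw [h, ← h']
      exact hz

theorem commute_signMat (ζ : ℤˣ) (A : Matrix ι ι ℂ) : Commute (signMat ι ζ) A :=
  (Commute.one_left A).smul_left _

/-- The twist of a homomorphism by the unramified character that maps Frobenius elements to `z`. -/
def twist {K : Type*} [Monoid K] {z : ℤˣ} (hz : signMat ι z ∈ H) (f : K →* H) :
    WeilGroup F × K →* H where
  toFun x := ⟨signMat ι (z ^ weilDeg x.1), signMat_zpow_mem hz _⟩ * f x.2
  map_one' := by simp [weilDeg_one]
  map_mul' x y := by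
    refine Subtype.ext ?_
    change signMat ι (z ^ weilDeg (x.1 * y.1)) * (f (x.2 * y.2) : Matrix ι ι ℂ) =
      (signMat ι (z ^ weilDeg x.1) * f x.2) * (signMat ι (z ^ weilDeg y.1) * f y.2)
    rw [weilDeg_mul, zpow_add, map_mul, map_mul, Submonoid.coe_mul]
    rw [mul_assoc, mul_assoc]
    congr 1
    rw [← mul_assoc, (commute_signMat _ (f x.2 : Matrix ι ι ℂ)).eq, mul_assoc]

variable {K : Type*} [Monoid K] {z : ℤˣ} (hz : signMat ι z ∈ H) (f : K →* H)

theorem coe_twist (x : WeilGroup F × K) :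
    (twist hz f x : Matrix ι ι ℂ) = signMat ι (z ^ weilDeg x.1) * f x.2 := rfl

theorem twist_one_left (k : K) : twist (F := F) hz f (1, k) = f k := by
  refine Subtype.ext ?_
  rw [coe_twist, weilDeg_one, zpow_zero, map_one, one_mul]

theorem continuous_twist [TopologicalSpace K] (hf : Continuous f) :
    Continuous (twist (F := F) hz f) := by
  have h : Continuous fun w : WeilGroup F => signMat ι (z ^ weilDeg w) :=
    (continuous_of_discreteTopology (f := fun n : Multiplicative ℤ => signMat ι (z ^ n.toAdd))).comp
      continuous_weilDegHom
  exact ((h.comp continuous_fst).mul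
    (continuous_subtype_val.comp (hf.comp continuous_snd))).subtype_mk _

variable {Ψ : SL(2, ℂ) × SL(2, ℂ) →* H}

theorem isAParameter_twist (h : ∀ i j, (fun x => (Ψ x : Matrix ι ι ℂ) i j) ∈ polyFunTwo) :
    IsAParameter (twist (F := F) hz Ψ) where
  continuous := continuous_twist hz Ψ (continuous_of_polyFunTwo h)
  algebraic i j := by
    simp only [twist_one_left]
    exact mem_polyFunTwo.1 (h i j)
  semisimple w := by
    rw [coe_twist, show ((w, 1, 1) : WeilGroup F × SL(2, ℂ) × SL(2, ℂ)).2 = 1 from rfl, map_one,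
      Submonoid.coe_one, mul_one]
    exact isSemisimple_toLin'_smul_one _
  bounded := by
    refine ⟨1, fun w i j => ?_⟩
    rw [coe_twist, show ((w, 1, 1) : WeilGroup F × SL(2, ℂ) × SL(2, ℂ)).2 = 1 from rfl, map_one,
      Submonoid.coe_one, mul_one, signMat_apply, Matrix.smul_apply, Matrix.one_apply]
    rcases Int.units_eq_one_or (z ^ weilDeg w) with h | h <;> rw [h] <;> split_ifs <;> simp

theorem isLParameter_twist (h : ∀ i j, (fun x => (Ψ x : Matrix ι ι ℂ) i j) ∈ polyFunTwo) :
    IsLParameter ((twist (F := F) hz Ψ).comp (rF' F)) where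
  continuous := by
    have : Continuous (rF' F) := by
      refine continuous_fst.prodMk (continuous_snd.prodMk (continuous_weilTorus.comp continuous_fst))
    exact (continuous_twist hz Ψ (continuous_of_polyFunTwo h)).comp this
  algebraic i j := by
    have h1 : ∀ g : SL(2, ℂ), (twist (F := F) hz Ψ).comp (rF' F) (1, g) = Ψ (g, 1) := by
      intro g
      change twist hz Ψ (1, g, weilTorus F 1) = _
      rw [twist_one_left, map_one]
    simp only [h1]
    exact isPolyFun_comp (σ := fun g => (g, 1)) (h i j) isPolyFun_entry fun i j =>
      isPolyFun_const ((1 : SL(2, ℂ)).1 i j)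
  semisimple w := by
    obtain ⟨a, ha⟩ := exists_weilTorus_eq_torus w
    have h1 : ((twist (F := F) hz Ψ).comp (rF' F) (w, 1) : Matrix ι ι ℂ) =
        signMat ι (z ^ weilDeg w) * Ψ (1, torus a) := by
      rw [← ha]; rfl
    rw [h1, Matrix.toLin'_mul]
    have h2 : IsAlgebraicRep (repOf (H.subtype.comp (Ψ.comp (MonoidHom.inr _ _)))) :=
      isAlgebraicRep_repOf fun i j => isPolyFun_comp (σ := fun g => (1, g)) (h i j)
        (fun i j => isPolyFun_const ((1 : SL(2, ℂ)).1 i j)) isPolyFun_entry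
    refine End.IsSemisimple.mul_of_commute (f := Matrix.toLin' (signMat ι (z ^ weilDeg w)))
      (g := Matrix.toLin' (Ψ (1, torus a) : Matrix ι ι ℂ)) ?_ ?_ (h2.isSemisimple_torus a)
    · exact (commute_signMat _ _).map (Matrix.toLinAlgEquiv' : Matrix ι ι ℂ ≃ₐ[ℂ] _)
    · exact isSemisimple_toLin'_smul_one _

end Twist

/-! ### L-parameters with a given infinitesimal character -/

section Uniqueness

open Module

variable {F : Type*} [Field F] [ValuativeRel F] [TopologicalSpace F] [IsNonarchimedeanLocalField F]
  {ι : Type} [Fintype ι] [DecidableEq ι] {H : Submonoid (Matrix ι ι ℂ)}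

/-- The restriction of a parameter to the Weil group, as a matrix representation. -/
def weilPart {K : Type*} [Monoid K] (φ : WeilGroup F × K →* H) : WeilGroup F →* Matrix ι ι ℂ :=
  H.subtype.comp (φ.comp (MonoidHom.inl _ _))

/-- The restriction of a parameter to the second factor, as a matrix representation. -/
def algPart {K : Type*} [Monoid K] (φ : WeilGroup F × K →* H) : K →* Matrix ι ι ℂ :=
  H.subtype.comp (φ.comp (MonoidHom.inr _ _))

theorem coe_eq_weilPart_mul_algPart {K : Type*} [Monoid K] (φ : WeilGroup F × K →* H)
    (w : WeilGroup F) (g : K) : (φ (w, g) : Matrix ι ι ℂ) = weilPart φ w * algPart φ g := by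
  change (φ (w, g) : Matrix ι ι ℂ) = ((φ (w, 1) * φ (1, g) : H) : Matrix ι ι ℂ)
  rw [← map_mul, Prod.mk_mul_mk, mul_one, one_mul]

theorem commute_algPart_weilPart {K : Type*} [Monoid K] (φ : WeilGroup F × K →* H)
    (w : WeilGroup F) (g : K) : Commute (algPart φ g) (weilPart φ w) := by
  change ((φ (1, g) * φ (w, 1) : H) : Matrix ι ι ℂ) = _
  rw [← map_mul, Prod.mk_mul_mk, mul_one, one_mul, coe_eq_weilPart_mul_algPart]

theorem finrank_ker_toLin'_sub_smul_one (A : Matrix ι ι ℂ) (ν : ℂ) :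
    (A - ν • 1).rank + finrank ℂ (LinearMap.ker (Matrix.toLin' A - ν • 1)) = Fintype.card ι := by
  have h := rank_add_finrank_ker (A - ν • 1) 1
  rw [pow_one, pow_one, map_sub, map_smul, Matrix.toLin'_one] at h
  exact h

theorem finrank_ker_eq_of_isConj {a b : H} (h : IsConj a b) (ν : ℂ) :
    finrank ℂ (LinearMap.ker (Matrix.toLin' (a : Matrix ι ι ℂ) - ν • 1)) =
      finrank ℂ (LinearMap.ker (Matrix.toLin' (b : Matrix ι ι ℂ) - ν • 1)) := by
  obtain ⟨c, hc⟩ := h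
  have h1 : (c : H).1 * (a - ν • 1) = ((b : Matrix ι ι ℂ) - ν • 1) * (c : H).1 := by
    have h2 : (c : H).1 * a = b * (c : H).1 := congrArg Subtype.val hc
    rw [mul_sub, sub_mul, h2, mul_smul_comm, smul_mul_assoc, mul_one, one_mul]
  have h3 : IsUnit (c : H).1.det := (Matrix.isUnit_iff_isUnit_det _).1 (Units.map H.subtype c).isUnit
  have h4 : ((a : Matrix ι ι ℂ) - ν • 1).rank = ((b : Matrix ι ι ℂ) - ν • 1).rank := by
    rw [← Matrix.rank_mul_eq_right_of_isUnit_det _ _ h3, h1,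
      Matrix.rank_mul_eq_left_of_isUnit_det _ _ h3]
  have h5 := finrank_ker_toLin'_sub_smul_one (a : Matrix ι ι ℂ) ν
  have h6 := finrank_ker_toLin'_sub_smul_one (b : Matrix ι ι ℂ) ν
  omega

theorem jordanMult_eq_of_rank_pow {u v : Matrix ι ι ℂ}
    (h : ∀ m, ((u - 1) ^ m).rank = ((v - 1) ^ m).rank) (c : ℕ) : jordanMult u c = jordanMult v c := by
  rw [jordanMult, jordanMult, h, h, h]

theorem HomClass.exists_isConj {A : Type*} [Monoid A] {f f' : A →* H}
    (h : HomClass.mk f = HomClass.mk f') : ∃ c : Hˣ, ∀ a, SemiconjBy (c : H) (f a) (f' a) :=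
  Quotient.exact (s := conjSetoid A H) h

section InfChar

variable {φ : WeilGroup F × SL(2, ℂ) →* H} {z : ℤˣ} {hz : signMat ι z ∈ H} {f : SL(2, ℂ) →* H}

/-- The norm is one on inertia, so there the infinitesimal character is `φ` itself, and it is
conjugate to a trivial homomorphism. -/
theorem weilPart_eq_one_of_mem_inertia
    (h : HomClass.mk (φ.comp (rF F)) = HomClass.mk ((twist hz f).comp (rF F))) {i : WeilGroup F}
    (hi : i ∈ inertia F) : weilPart φ i = 1 := by
  obtain ⟨c, hc⟩ := HomClass.exists_isConj h
  have h1 : (c : H) * φ (i, weilTorus F i) = twist hz f (i, weilTorus F i) * c := hc i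
  have h2 : twist hz f (i, (1 : SL(2, ℂ))) = 1 := by
    refine Subtype.ext ?_
    rw [coe_twist, show weilDeg i = 0 from hi, zpow_zero, map_one, one_mul, map_one]
  rw [weilTorus_of_mem_inertia hi, h2, one_mul] at h1
  exact congrArg Subtype.val (c.isUnit.mul_left_cancel (h1.trans (mul_one _).symm))

/-- At Frobenius the infinitesimal character is the product of the commuting operators `φ (v, 1)`
and `φ (1, torus √q)`. Its eigenvalues are the weights of the strings of `φ`, which therefore depend
only on the infinitesimal character. -/
theorem exists_multiset_of_isLParameter (hφ : IsLParameter φ) {v : WeilGroup F}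
    (hv : v ∈ frobenius F)
    (h : HomClass.mk (φ.comp (rF F)) = HomClass.mk ((twist hz f).comp (rF F))) :
    ∃ (I : Type) (_ : Fintype I) (d : I → ℂ × ℕ),
      IsDecomposition repModel (repFamily (repOf (algPart φ)) (Matrix.toLin' (weilPart φ v))) d ∧
      ∀ ν, totalMult (sqrtCard F) (Finset.univ.val.map d) ν = finrank ℂ (LinearMap.ker
        (Matrix.toLin' (signMat ι z * (f (torus (sqrtCard F)) : Matrix ι ι ℂ)) - ν • 1)) := by
  obtain ⟨I, hI, d, hd⟩ := exists_isDecomposition_repOf (f := algPart φ) hφ.algebraic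
    (hφ.semisimple v) (commute_algPart_weilPart φ v)
  refine ⟨I, hI, d, hd, fun ν => ?_⟩
  obtain ⟨c, hc⟩ := HomClass.exists_isConj h
  have h1 : IsConj (φ (v, torus (sqrtCard F))) (twist hz f (v, torus (sqrtCard F))) :=
    weilTorus_of_mem_frobenius hv ▸ ⟨c, hc v⟩
  have h2 := finrank_ker_eq_of_isConj h1 ν
  rw [coe_twist, show weilDeg (v, torus (sqrtCard F)).1 = 1 from hv, zpow_one,
    coe_eq_weilPart_mul_algPart, Matrix.toLin'_mul] at h2
  rw [totalMult_map_eq hd, ← h2]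
  rfl

end InfChar

theorem exists_multiset_of_algebraic {f : SL(2, ℂ) →* H}
    (hf : ∀ i j, IsPolyFun fun g => (f g : Matrix ι ι ℂ) i j) (z : ℤˣ) (a : ℂˣ) :
    ∃ D : Multiset (ℂ × ℕ), (∀ x ∈ D, x.1 = ((z : ℤ) : ℂ)) ∧
      (∀ k, (D.filter (·.2 = k)).card = jordanMult (f stdUnipotent : Matrix ι ι ℂ) (k + 1)) ∧
      ∀ ν, totalMult a D ν = finrank ℂ (LinearMap.ker
        (Matrix.toLin' (signMat ι z * (f (torus a) : Matrix ι ι ℂ)) - ν • 1)) := by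
  let f₀ : SL(2, ℂ) →* Matrix ι ι ℂ := H.subtype.comp f
  have hf₀ : ∀ g, (f g : Matrix ι ι ℂ) = f₀ g := fun _ => rfl
  clear_value f₀
  simp only [hf₀] at hf ⊢
  obtain ⟨I, hI, d, hd⟩ := exists_isDecomposition_repOf (s := signMat ι z) hf
    (isSemisimple_toLin'_smul_one _) fun g => (commute_signMat z _).symm
  refine ⟨Finset.univ.val.map d, fun x hx => ?_, card_filter_map_eq hd, fun ν => ?_⟩
  · obtain ⟨i, -, rfl⟩ := Multiset.mem_map.1 hx
    refine hd.fst_eq ?_ i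
    rw [signMat_apply, map_smul, Matrix.toLin'_one, Module.End.one_eq_id]
  · rw [totalMult_map_eq hd, hf₀, Matrix.toLin'_mul, repOf_apply]
    rfl

/-- The strings of both parameters have weights prescribed by `f` and lengths prescribed by `u`. The
family from `exists_centred` has the same weights and lengths, and being centred it is the only such
family by `eq_of_totalMult_eq`. -/
theorem IsClassicalGroup.homClass_eq_of_infChar_eq [CharZero F] {J : Matrix ι ι ℂ}
    (hH : IsClassicalGroup H J) {z : ℤˣ} {hz : signMat ι z ∈ H} {u : H}
    (hn : IsNilpotent ((u : Matrix ι ι ℂ) - 1)) {S : Finset ℕ}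
    (hS : ∀ c ∈ S, 1 ≤ c ∧ ¬ c ≡ Fintype.card ι [MOD 2] ∧ 0 < jordanMult (u : Matrix ι ι ℂ) c)
    {f : SL(2, ℂ) →* H} (hf : ∀ i j, IsPolyFun fun g => (f g : Matrix ι ι ℂ) i j)
    (hr : ∀ m, (((f stdUnipotent : Matrix ι ι ℂ) - 1) ^ m).rank =
      (((u : Matrix ι ι ℂ) - 1) ^ m).rank + if m ∈ S then 1 else 0)
    {φ φ' : WeilGroup F × SL(2, ℂ) →* H} (hφ : IsLParameter φ) (hφ' : IsLParameter φ')
    (h : HomClass.mk (φ.comp (rF F)) = HomClass.mk ((twist hz f).comp (rF F)))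
    (h' : HomClass.mk (φ'.comp (rF F)) = HomClass.mk ((twist hz f).comp (rF F)))
    (hu : ConjClasses.mk (φ (1, stdUnipotent)) = ConjClasses.mk u)
    (hu' : ConjClasses.mk (φ' (1, stdUnipotent)) = ConjClasses.mk u) :
    HomClass.mk φ = HomClass.mk φ' := by
  obtain ⟨v, hv⟩ := frobenius_nonempty F
  have hz0 : ((z : ℤ) : ℂ) ≠ 0 := by exact_mod_cast z.ne_zero
  have ha := eq_zero_of_sqrtCard_zpow_eq_one F
  obtain ⟨D, hD, hDc, hDw⟩ := exists_multiset_of_algebraic hf z (sqrtCard F)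
  have hle : ∀ c, 0 < jordanMult (u : Matrix ι ι ℂ) c → c ≤ Fintype.card ι :=
    fun c => jordanMult_le_card hn
  obtain ⟨B, hB, hBw, hBc⟩ := exists_centred (S := S) ha hz0
    (m := jordanMult (u : Matrix ι ι ℂ)) (m₁ := jordanMult (f stdUnipotent : Matrix ι ι ℂ))
    (M := Fintype.card ι + 1)
    (fun c hc => by
      obtain ⟨h1, h2, h3⟩ := hS c hc
      obtain ⟨t, ht⟩ := hH.even_jordanMult u.2 hn h1 h2
      exact ⟨h1, Nat.lt_succ_of_le (hle c h3), by omega⟩)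
    (fun c hc => by
      by_contra h0
      have := hle c (Nat.pos_of_ne_zero h0)
      omega)
    (fun c hc => jordanMult_add_of_rank_pow hn hr hc) hD
    (fun x hx => by
      have h1 : 0 < (D.filter (·.2 = x.2)).card :=
        Multiset.card_pos_iff_exists_mem.2 ⟨x, Multiset.mem_filter.2 ⟨hx, rfl⟩⟩
      rw [hDc] at h1
      have := jordanMult_le_card (isNilpotent_sub_one_of_rank_pow hn hr) h1
      omega) hDc
  have key : ∀ {φ : WeilGroup F × SL(2, ℂ) →* H}, IsLParameter φ →
      HomClass.mk (φ.comp (rF F)) = HomClass.mk ((twist hz f).comp (rF F)) →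
      ConjClasses.mk (φ (1, stdUnipotent)) = ConjClasses.mk u →
      ∃ (I : Type) (_ : Fintype I) (d : I → ℂ × ℕ),
        IsDecomposition repModel (repFamily (repOf (algPart φ)) (Matrix.toLin' (weilPart φ v))) d ∧
        Finset.univ.val.map d = B := by
    intro φ hφ h hu
    obtain ⟨I, hI, d, hd, hw⟩ := exists_multiset_of_isLParameter hφ hv h
    refine ⟨I, hI, d, hd, eq_of_totalMult_eq ha hz0 (S := S) (fun c hc c' hc' => ?_) hB
      (fun ν => by rw [hw, ← hDw, hBw]) fun k => ?_⟩
    · have h1 := (hS c hc).2.1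
      have h2 := (hS c' hc').2.1
      simp only [Nat.ModEq] at h1 h2
      omega
    · rw [card_filter_map_eq hd, hBc]
      exact jordanMult_eq_of_rank_pow
        (fun m => (rank_pow_eq_of_isConj (ConjClasses.mk_eq_mk_iff_isConj.1 hu) m).symm) _
  obtain ⟨I, _, d, hd, hdB⟩ := key hφ h hu
  obtain ⟨I', _, d', hd', hdB'⟩ := key hφ' h' hu'
  -- Equal families of strings give a matrix intertwining Frobenius and `SL₂`; as inertia acts
  -- trivially on both sides, it intertwines the parameters, and conjugacy descends to `H`.
  obtain ⟨k, hk, hkT, hkg⟩ := exists_isUnit_conj hd hd' fun x => by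
    rw [← count_map_eq_card, ← count_map_eq_card, hdB, hdB']
  rw [LinearMap.toMatrix'_toLin', LinearMap.toMatrix'_toLin'] at hkT
  have hkw : ∀ w, k * weilPart φ w = weilPart φ' w * k :=
    semiconj_on_weilGroup (f := weilPart φ) (f' := weilPart φ') hv hkT fun i hi => by
      rw [weilPart_eq_one_of_mem_inertia h hi, weilPart_eq_one_of_mem_inertia h' hi]
      exact SemiconjBy.one_right k
  refine hH.homClass_eq hk fun ⟨w, g⟩ => ?_
  rw [coe_eq_weilPart_mul_algPart, coe_eq_weilPart_mul_algPart, ← mul_assoc, hkw, mul_assoc, hkg,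
    mul_assoc]

end Uniqueness

/-! ### Quasi-basic parameters -/

section QuasiBasic

variable {F : Type*} [Field F] [ValuativeRel F] [TopologicalSpace F] [IsNonarchimedeanLocalField F]
  {ι : Type} [Fintype ι] [DecidableEq ι] {H : Submonoid (Matrix ι ι ℂ)} {z : ℤˣ}
  {O : ConjClasses H}

theorem isQuasiBasic_twist (hz : signMat ι z ∈ H) {f : SL(2, ℂ) →* H}
    (hf : ∀ i j, IsPolyFun fun g => (f g : Matrix ι ι ℂ) i j)
    (hO : ConjClasses.mk (f stdUnipotent) = O) :
    IsQuasiBasic (F := F) z O (twist hz (f.comp (MonoidHom.snd _ _))) where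
  isAParameter := isAParameter_twist hz fun i j => by
    obtain ⟨p, hp⟩ := hf i j
    have h : (fun x : SL(2, ℂ) × SL(2, ℂ) => (f.comp (MonoidHom.snd _ _) x : Matrix ι ι ℂ) i j) =
        fun x => p.eval fun a => x.2.1 a.1 a.2 := funext fun x => hp x.2
    rw [h]
    exact snd_mem_polyFunTwo
  trivial w hw g := by
    refine Subtype.ext ?_
    change signMat ι (z ^ weilDeg w) * (f 1 : Matrix ι ι ℂ) = 1
    rw [show weilDeg w = 0 from hw, zpow_zero, map_one, map_one, one_mul]
    rfl
  frobenius w hw := by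
    change signMat ι (z ^ weilDeg w) * (f 1 : Matrix ι ι ℂ) = _
    rw [show weilDeg w = 1 from hw, zpow_one, map_one, Submonoid.coe_one, mul_one]
    rfl
  unipotent := by
    rw [twist_one_left]
    exact hO

/-- A quasi-basic parameter is fixed on the Weil group and on the first `SL₂`. On the second `SL₂`
it is determined up to conjugacy by the unipotent class, through complete reducibility. -/
theorem IsClassicalGroup.quasiBasicInfChars_eq [CharZero F] {J : Matrix ι ι ℂ}
    (hH : IsClassicalGroup H J) (hz : signMat ι z ∈ H) {f : SL(2, ℂ) →* H}
    (hf : ∀ i j, IsPolyFun fun g => (f g : Matrix ι ι ℂ) i j)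
    (hO : ConjClasses.mk (f stdUnipotent) = O) :
    quasiBasicInfChars F z O = {HomClass.mk ((twist hz f).comp (rF F))} := by
  refine Set.Subset.antisymm ?_ (Set.singleton_subset_iff.2
    ⟨_, isQuasiBasic_twist hz hf hO, congrArg HomClass.mk (MonoidHom.ext fun w => rfl)⟩)
  rintro _ ⟨ψ, hψ, rfl⟩
  obtain ⟨v, hv⟩ := frobenius_nonempty F
  have h1 : ∀ w, weilPart ψ w = signMat ι (z ^ weilDeg w) := fun w => by
    refine eq_on_weilGroup (f' := (H.subtype.comp (twist hz (1 : Unit →* H))).comp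
      (MonoidHom.inl _ _)) hv ?_ (fun i hi => ?_) w |>.trans (mul_one _)
    · refine (hψ.frobenius v hv).trans ?_
      change _ = signMat ι (z ^ weilDeg v) * 1
      rw [show weilDeg v = 1 from hv, zpow_one, mul_one]
      rfl
    · refine (congrArg Subtype.val (hψ.trivial i hi 1)).trans ?_
      change 1 = signMat ι (z ^ weilDeg i) * 1
      rw [show weilDeg i = 0 from hi, zpow_zero, mul_one, map_one]
  let f' : SL(2, ℂ) →* H := ψ.comp ((MonoidHom.inr _ _).comp (MonoidHom.inr _ _))
  have h2 : ∀ w g, (ψ (w, g, g) : Matrix ι ι ℂ) = signMat ι (z ^ weilDeg w) * f' g := by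
    intro w g
    have h3 : ψ (w, g, g) = ψ (w, 1, 1) * (ψ (1, g, 1) * ψ (1, 1, g)) := by
      rw [← map_mul, ← map_mul]
      simp
    rw [h3, hψ.trivial 1 weilDeg_one, one_mul, ← h1]
    rfl
  have hf' : ∀ i j, IsPolyFun fun g => (f' g : Matrix ι ι ℂ) i j := fun i j =>
    isPolyFun_comp (σ := fun g => (1, g)) (f := fun x => (ψ (1, x) : Matrix ι ι ℂ) i j)
      (mem_polyFunTwo.2 (hψ.isAParameter.algebraic i j))
      (fun i j => isPolyFun_const ((1 : SL(2, ℂ)).1 i j)) isPolyFun_entry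
  obtain ⟨k, hk, hkg⟩ := exists_isUnit_conj_of_jordanMult (f := H.subtype.comp f')
    (f' := H.subtype.comp f) hf' hf (jordanMult_eq_of_rank_pow fun m =>
      (rank_pow_eq_of_isConj (ConjClasses.mk_eq_mk_iff_isConj.1 (hψ.unipotent.trans hO.symm)) m).symm)
  refine hH.homClass_eq hk fun w => ?_
  change k * (ψ (w, weilTorus F w, weilTorus F w) : Matrix ι ι ℂ) =
    signMat ι (z ^ weilDeg w) * (f (weilTorus F w) : Matrix ι ι ℂ) * k
  rw [h2, ← mul_assoc, ← (commute_signMat _ k).eq, mul_assoc, mul_assoc]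
  exact congrArg _ (hkg _)

theorem IsClassicalGroup.existsUnique_isArthurType [CharZero F] {J : Matrix ι ι ℂ}
    (hH : IsClassicalGroup H J) (hz : signMat ι z ∈ H) {O₁ O₂ : ConjClasses H}
    (hO₁ : O₁ ∈ unipotentClasses H) (hO₂ : O₂ ∈ Spc O₁) :
    ∃ χ : HomClass (WeilGroup F) H, quasiBasicInfChars F z O₁ = {χ} ∧
      ∃ φ ∈ LParameters F H, infChar φ = χ ∧ unipotentClass φ = O₂ ∧ IsArthurType φ ∧
        ∀ φ' ∈ LParameters F H, infChar φ' = χ → unipotentClass φ' = O₂ → φ' = φ := by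
  obtain ⟨u₁, hn₁, rfl⟩ := hO₁
  obtain ⟨u₂, hn₂, rfl⟩ := hO₂.1.1
  obtain ⟨S, hS, hr⟩ := hH.exists_rank_pow_of_mem_Spc hn₂ hO₂
  obtain ⟨Ψ, hΨ, hΨ₁, hΨ₂⟩ := hH.exists_hom u₂.2 hn₂ S hS
  -- The infinitesimal character of φ_ψ sees `Ψ` only on the diagonal. There the unipotent element
  -- has the class of `u₁`, so `f` computes the quasi-basic infinitesimal character of `O₁` as well.
  let f : SL(2, ℂ) →* H := Ψ.comp ((MonoidHom.id _).prod (MonoidHom.id _))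
  have hf : ∀ i j, IsPolyFun fun g => (f g : Matrix ι ι ℂ) i j := fun i j =>
    isPolyFun_comp (σ := fun g => (g, g)) (hΨ i j) isPolyFun_entry isPolyFun_entry
  have hfu : ConjClasses.mk (f stdUnipotent) = ConjClasses.mk u₁ :=
    hH.conjClasses_eq_of_rank_pow (isNilpotent_sub_one_of_rank_pow hn₂ hΨ₂) hn₁
      fun m => (hΨ₂ m).trans (hr m).symm
  have hn : IsNilpotent ((Ψ (stdUnipotent, 1) : Matrix ι ι ℂ) - 1) :=
    isNilpotent_sub_one_of_rank_pow (S := ∅) hn₂ (by simpa using hΨ₁)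
  have hφ : IsLParameter ((twist (F := F) hz Ψ).comp (rF' F)) := isLParameter_twist hz hΨ
  have hu : ConjClasses.mk ((twist (F := F) hz Ψ).comp (rF' F) (1, stdUnipotent)) =
      ConjClasses.mk u₂ := by
    have h : (twist (F := F) hz Ψ).comp (rF' F) (1, stdUnipotent) = Ψ (stdUnipotent, 1) := by
      change twist hz Ψ (1, stdUnipotent, weilTorus F 1) = _
      rw [twist_one_left, map_one]
    rw [h]
    exact hH.conjClasses_eq_of_rank_pow hn hn₂ hΨ₁
  refine ⟨_, hH.quasiBasicInfChars_eq hz hf hfu, HomClass.mk ((twist hz Ψ).comp (rF' F)),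
    ⟨_, hφ, rfl⟩, congrArg HomClass.mk (MonoidHom.ext fun w => rfl), hu,
    ⟨_, ⟨_, isAParameter_twist hz hΨ, rfl⟩, rfl⟩, ?_⟩
  rintro _ ⟨φ', hφ', rfl⟩ h hu'
  exact hH.homClass_eq_of_infChar_eq hn₂ hS hf hΨ₂ hφ' hφ h
    (congrArg HomClass.mk (MonoidHom.ext fun w => rfl)) hu' hu

theorem SplitGroup.IsPossibleSign.signMat_mem_dual {G : SplitGroup} {z : ℤˣ}
    (h : G.IsPossibleSign z) : signMat G.Index z ∈ G.dual := by
  rcases Int.units_eq_one_or z with rfl | rfl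
  · rw [map_one]
    exact G.dual.one_mem
  · cases G with
    | oddOrthogonal n =>
      have h1 : signMat (oddOrthogonal n).Index (-1) = -1 := by simp [signMat_apply]
      rw [h1]
      exact SymplecticGroup.neg_mem (Submonoid.one_mem _)
    | symplectic n => exact absurd (show (-1 : ℤˣ) = 1 from h) (by decide)

end QuasiBasic

end WeakArthur

end

theorem mainTheorem5 (F : Type*) [Field F] [CharZero F] [ValuativeRel F] [TopologicalSpace F]
    [IsNonarchimedeanLocalField F]
    (G : WeakArthur.SplitGroup) (hG : 1 ≤ G.rank)
    (z : ℤˣ) (hz : G.IsPossibleSign z)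
    (O₁ O₂ : ConjClasses G.dual)
    (hO₁ : O₁ ∈ WeakArthur.unipotentClasses G.dual) (hO₂ : O₂ ∈ WeakArthur.Spc O₁) :
    ∃ χ : WeakArthur.HomClass (WeakArthur.WeilGroup F) G.dual,
      WeakArthur.quasiBasicInfChars F z O₁ = {χ} ∧
      ∃ φ ∈ WeakArthur.LParameters F G.dual,
        WeakArthur.infChar φ = χ ∧ WeakArthur.unipotentClass φ = O₂ ∧
        WeakArthur.IsArthurType φ ∧
        ∀ φ' ∈ WeakArthur.LParameters F G.dual,
          WeakArthur.infChar φ' = χ → WeakArthur.unipotentClass φ' = O₂ → φ' = φ := by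
  obtain ⟨J, hJ⟩ := WeakArthur.exists_isClassicalGroup_dual G
  exact hJ.existsUnique_isArthurType hz.signMat_mem_dual hO₁ hO₂
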